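/- \textbf{Theorem.} Consider \textsc{Swap Bribery} for $k$-approval: given are $n\ge 1$ votes $v_1,\dots,v_n$, each a strict linear order on a set $C$ of $m$ candidates, an integer $k$ with $1\le k\le m$, a preferred candidate $p\in C$, a cost function $c: C\times C\times\{v_1,\dots,v_n\}\to\mathbb{N}$, and a budget $\beta\in\mathbb{N}$. A swap $(v_i,a,b)$ exchanges the candidates $a$ and $b$ in $v_i$; it may be applied if $a$ immediately precedes $b$ at that moment, and it costs $c(a,b,v_i)$. A \emph{solution} is a set of swaps which can be applied one after the other in some order, whose total cost is at most $\beta$, and after which $p$ is a winner, i.e. no candidate is among the first $k$ candidates in more votes than $p$. The task is to decide whether a solution exists and, if so, to output one. Algorithms are programs for a random access machine with unit-cost steps (addition and truncated subtraction of natural numbers, indirect addressing, comparison with zero and, for randomized algorithms, fair random bits); $k$ is part of the input, and $\log=\log_2$. (i) There are a randomized algorithm, whose answer is always correct when it halts, and an absolute constant $C_0$ such that on every instance its expected running time is at most $$2^{2(\log n+\log k)nk}\cdot C_0\, m^{k+1}.$$ (ii) There are a deterministic algorithm that solves every instance, and absolute constants $c_1$, $C_1$, such that on every instance with $m\ge 2$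 its running time is at most $$2^{c_1(\log n+\log k)nk}\cdot C_1\, m^{k+1}\log m.$$ (iii) For every constant $k\ge 1$, the problem is fixed-parameter tractable with parameter $n$: there are a deterministic algorithm that solves every instance with this value of $k$, a computable function $f$ and an integer $d$ such that its running time is at most $f(n)\cdot |I|^{d}$, where $|I|$ is the number of bits of the instance $I$. -/

import Mathlib

open MeasureTheory

/-! ### A randomized random access machine with unit-cost steps

The machine has registers, a random access memory (both holding natural numbers, initially `0`), a
read-only input array, and a write-only output tape. The arithmetic instructions are addition and
truncated subtraction only: there is no unit-cost multiplication, so the length of the numbers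
grows by at most one bit per step. The control flow is structured (sequence, branch, loop). -/

/-- Programs. All arguments of type `ℕ` are indices of registers, except the second argument of
`const`, which is a number. -/
inductive Prog where
  /-- do nothing -/
  | skip : Prog
  /-- `const d c`: register `d` becomes the number `c` -/
  | const (d c : ℕ) : Prog
  /-- `add d a b`: register `d` becomes the sum of the registers `a` and `b` -/
  | add (d a b : ℕ) : Prog
  /-- `sub d a b`: register `d` becomes `max (a - b) 0`, for the contents of `a` and `b` -/
  | sub (d a b : ℕ) : Prog
  /-- `read d a`: register `d` becomes the input entry whose index is in register `a`
  (`0` beyond the end of the input) -/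
  | read (d a : ℕ) : Prog
  /-- `load d a`: register `d` becomes the memory cell whose address is in register `a` -/
  | load (d a : ℕ) : Prog
  /-- `store a b`: the memory cell whose address is in register `a` becomes register `b` -/
  | store (a b : ℕ) : Prog
  /-- `flip d`: register `d` becomes a fair random bit -/
  | flip (d : ℕ) : Prog
  /-- `emit a`: register `a` is appended to the output -/
  | emit (a : ℕ) : Prog
  /-- first `P`, then `Q` -/
  | seq (P Q : Prog) : Prog
  /-- `branch a P Q`: `P` if register `a` is nonzero, `Q` otherwise -/
  | branch (a : ℕ) (P Q : Prog) : Prog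
  /-- `loop a P`: repeat `P` as long as register `a` is nonzero -/
  | loop (a : ℕ) (P : Prog) : Prog

namespace Prog

/-- A program is deterministic if it never asks for a random bit. -/
def Deterministic : Prog → Prop
  | flip _ => False
  | seq P Q => P.Deterministic ∧ Q.Deterministic
  | branch _ P Q => P.Deterministic ∧ Q.Deterministic
  | loop _ P => P.Deterministic
  | _ => True

/-- A configuration: the programs still to be executed (the first one comes next), and the contents
of the registers, the memory and the output tape. -/
structure Config where
  todo : List Prog
  reg : ℕ → ℕ
  mem : ℕ → ℕ
  out : List ℕ

/-- One step of the machine on the input `x`; `coin` is the random bit available in this step. -/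
def step (x : List ℕ) (coin : Bool) (c : Config) : Config :=
  match c.todo with
  | [] => c
  | skip :: K => { c with todo := K }
  | const d z :: K => { c with todo := K, reg := Function.update c.reg d z }
  | add d a b :: K => { c with todo := K, reg := Function.update c.reg d (c.reg a + c.reg b) }
  | sub d a b :: K => { c with todo := K, reg := Function.update c.reg d (c.reg a - c.reg b) }
  | read d a :: K => { c with todo := K, reg := Function.update c.reg d (x.getD (c.reg a) 0) }
  | load d a :: K => { c with todo := K, reg := Function.update c.reg d (c.mem (c.reg a)) }
  | store a b :: K => { c with todo := K, mem := Function.update c.mem (c.reg a) (c.reg b) }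
  | flip d :: K => { c with todo := K, reg := Function.update c.reg d coin.toNat }
  | emit a :: K => { c with todo := K, out := c.out ++ [c.reg a] }
  | seq P Q :: K => { c with todo := P :: Q :: K }
  | branch a P Q :: K => { c with todo := if c.reg a ≠ 0 then P :: K else Q :: K }
  | loop a P :: K => { c with todo := if c.reg a ≠ 0 then P :: loop a P :: K else K }

/-- The configuration after `t` steps of `P` on the input `x`, where `ω s` is the random bit of the
step with number `s`. -/
def run (P : Prog) (x : List ℕ) (ω : ℕ → Bool) : ℕ → Config
  | 0 => { todo := [P], reg := fun _ => 0, mem := fun _ => 0, out := [] }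
  | t + 1 => step x (ω t) (run P x ω t)

/-- `P` on the input `x` with the random bits `ω` has halted after at most `t` steps. -/
def HaltedAt (P : Prog) (x : List ℕ) (ω : ℕ → Bool) (t : ℕ) : Prop :=
  (P.run x ω t).todo = []

/-- The running time: the number of steps until `P` halts, and `⊤` if it never does. -/
noncomputable def time (P : Prog) (x : List ℕ) (ω : ℕ → Bool) : ℕ∞ :=
  ⨅ (t : ℕ) (_ : P.HaltedAt x ω t), (t : ℕ∞)

/-- The law of an infinite sequence of independent fair coin tosses. -/
noncomputable def coinLaw : Measure (ℕ → Bool) :=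
  Measure.infinitePi fun _ : ℕ => (PMF.uniformOfFintype Bool).toMeasure

/-- The expected running time of `P` on the input `x`. -/
noncomputable def expectedTime (P : Prog) (x : List ℕ) : ENNReal :=
  ∫⁻ ω, (P.time x ω : ENNReal) ∂coinLaw

/-- On the input `x`, every output that `P` halts with satisfies `R`, whatever the random bits. -/
def AlwaysCorrect (P : Prog) (x : List ℕ) (R : List ℕ → Prop) : Prop :=
  ∀ (ω : ℕ → Bool) (t : ℕ), P.HaltedAt x ω t → R (P.run x ω t).out

/-- `P`, for deterministic `P`, halts on the input `x` after at most `t` steps, with an output that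
satisfies `R` (the random bits are irrelevant and set to `false`). -/
def SolvesIn (P : Prog) (x : List ℕ) (R : List ℕ → Prop) (t : ℕ) : Prop :=
  P.HaltedAt x (fun _ => false) t ∧ R (P.run x (fun _ => false) t).out

end Prog

/-- The number of bits of a list of natural numbers, with one delimiter for each entry. -/
def bitLength (x : List ℕ) : ℕ := (x.map fun a => Nat.size a + 1).sum

/-- Fixed-parameter tractability of the problem whose instances `I` are encoded by `enc I`, with the
parameter `κ I`, and for which `R I` is the set of the correct outputs: a deterministic algorithm
solves it in time `f (κ I) * |I| ^ O(1)` for some computable function `f`. -/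
def FixedParameterTractable {ι : Type} (enc : ι → List ℕ) (R : ι → List ℕ → Prop) (κ : ι → ℕ) :
    Prop :=
  ∃ P : Prog, P.Deterministic ∧ ∃ f : ℕ → ℕ, Computable f ∧ ∃ d : ℕ, ∀ I : ι,
    P.SolvesIn (enc I) (R I) (f (κ I) * bitLength (enc I) ^ d)

/-! ### Elections and swaps -/

/-- A vote on the candidates `0, …, m - 1`, that is, a strict linear order on them, given by the
bijection that maps each candidate to its rank; ranks are counted from `0`. -/
abbrev Vote (m : ℕ) : Type := Fin m ≃ Fin m

namespace Vote

/-- The swap of `s.1` and `s.2` is admissible if `s.1` immediately precedes `s.2`. -/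
def Admissible {m : ℕ} (v : Vote m) (s : Fin m × Fin m) : Prop :=
  (v s.1 : ℕ) + 1 = (v s.2 : ℕ)

/-- The vote in which `s.1` and `s.2` have exchanged their positions. -/
def applySwap {m : ℕ} (v : Vote m) (s : Fin m × Fin m) : Vote m :=
  v.trans (Equiv.swap (v s.1) (v s.2))

/-- The swaps in the list can be applied one after the other, in the order of the list. -/
def AdmissibleList {m : ℕ} : Vote m → List (Fin m × Fin m) → Prop
  | _, [] => True
  | v, s :: l => v.Admissible s ∧ AdmissibleList (v.applySwap s) l

/-- The set `Γ` of swaps is admissible in `v`, and applying its swaps, each of them once, in some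
suitable order yields the vote `w`. -/
def Yields {m : ℕ} (v : Vote m) (Γ : Finset (Fin m × Fin m)) (w : Vote m) : Prop :=
  ∃ l : List (Fin m × Fin m), l.Nodup ∧ l.toFinset = Γ ∧ v.AdmissibleList l ∧
    l.foldl applySwap v = w

end Vote

/-- The scoring vector `(1, …, 1, 0, …, 0)` of `k`-approval, with `k` ones; ranks start at `0`. -/
def approvalVector (k : ℕ) {m : ℕ} (r : Fin m) : ℕ := if (r : ℕ) < k then 1 else 0

/-- The score of a candidate in a family of votes, for the scoring vector `s`. -/
def score {n m : ℕ} (s : Fin m → ℕ) (V : Fin n → Vote m) (c : Fin m) : ℕ := ∑ i, s (V i c)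

/-- The candidate `c` is a winner: no candidate has a higher score. -/
def IsWinner {n m : ℕ} (s : Fin m → ℕ) (V : Fin n → Vote m) (c : Fin m) : Prop :=
  ∀ d : Fin m, score s V d ≤ score s V c

/-! ### Swap Bribery for `k`-approval -/

/-- An instance of Swap Bribery for `k`-approval, with `n ≥ 1` votes on `m` candidates, where
`1 ≤ k ≤ m`. The price of the swap of `a` and `b` in vote `i`, when `a` immediately precedes `b`, is
`cost i a b`. -/
structure SwapBribery where
  n : ℕ
  m : ℕ
  k : ℕ
  n_pos : 1 ≤ n
  k_pos : 1 ≤ k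
  k_le : k ≤ m
  votes : Fin n → Vote m
  preferred : Fin m
  cost : Fin n → Fin m → Fin m → ℕ
  budget : ℕ

namespace SwapBribery

/-- A set of swaps, the triple `(i, a, b)` standing for the swap of `a` and `b` in vote `i`, is a
solution if it is admissible, its total cost is at most the budget, and the preferred candidate is a
winner of the `k`-approval election that results from it. -/
def IsSolution (I : SwapBribery) (Γ : Finset (Fin I.n × Fin I.m × Fin I.m)) : Prop :=
  (∑ s ∈ Γ, I.cost s.1 s.2.1 s.2.2 ≤ I.budget) ∧
  ∃ W : Fin I.n → Vote I.m,
    (∀ i, (I.votes i).Yields ((Γ.filter fun s => s.1 = i).image Prod.snd) (W i)) ∧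
    IsWinner (approvalVector I.k) W I.preferred

/-- The input array: `n`, `m`, `k`, the preferred candidate, the budget, then each vote as the list
of all candidates in the order of their ranks, then the costs in lexicographic order. -/
def encode (I : SwapBribery) : List ℕ :=
  [I.n, I.m, I.k, (I.preferred : ℕ), I.budget] ++
  ((List.finRange I.n).flatMap fun i =>
    (List.finRange I.m).map fun r => ((I.votes i).symm r : ℕ)) ++
  ((List.finRange I.n).flatMap fun i =>
    (List.finRange I.m).flatMap fun a => (List.finRange I.m).map fun b => I.cost i a b)

/-- The correct outputs: `0` if there is no solution; otherwise `1`, followed by the triples of some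
solution, listed in any order without repetitions. -/
def CorrectOutput (I : SwapBribery) (y : List ℕ) : Prop :=
  ((¬ ∃ Γ, I.IsSolution Γ) ∧ y = [0]) ∨
  ∃ L : List (Fin I.n × Fin I.m × Fin I.m), L.Nodup ∧ I.IsSolution L.toFinset ∧
    y = 1 :: L.flatMap fun s => [(s.1 : ℕ), (s.2.1 : ℕ), (s.2.2 : ℕ)]

end SwapBribery

/-! The combinatorial core has three steps. First, only the final sets of approved candidates
matter. If `S` is to be the set of the first `k` candidates of a vote, every pair (outsider, member)
in which the outsider comes first must be swapped, because an admissible swap reverses no pair but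
its own (`Vote.crossing_subset`). Conversely these pairs alone suffice: as long as one exists, an
adjacent one exists, and swapping it removes exactly that pair (`Vote.exists_yields_crossing`). So a
solution amounts to a choice of `k`-sets, one for each vote, that makes `p` win and whose crossing
pairs are affordable.

Secondly, the set of one vote may be exchanged, provided that it keeps its attitude to `p` and
avoids the set `X` of candidates that are approved elsewhere but not in this vote. A newly approved
candidate then has score one, and `p` has at least that score (`SwapBribery.Feasible.update`). Here
`X` has at most `(n - 1) * k` elements.

Thirdly, a small family of sets contains a good replacement for every such `X`. Given the part `Y`
of the set chosen so far, collect `Q = (n - 1) * k + 1` cheapest extensions of `Y`, each disjoint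
from the earlier ones outside `Y`. As `X` has fewer than `Q` elements, they cannot all be hit by
`X`. Hence either the current set already meets this pool outside `Y`, or a pool extension avoids
`X` and costs no more (`pool_spec`, `exists_next`). In both cases the next member can be taken from
a pool of at most `Q * k` candidates, and `k` such choices determine a set (`exists_build`).
Replacing the votes one by one gives `exists_valid_table`: it is enough to try one bit for each
vote, telling whether `p` is approved there, and `n * k` choices below `Q * k`.

The exhaustive search over `2 ^ n * (Q * k) ^ (n * k)` possibilities, each handled in time of order
`m ^ (k + 1)` times a polynomial in `n` and `k`, is a deterministic program. Since `Q ≤ n * k`,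
there is slack to absorb the polynomial and `2 ^ n`, and the time is at most a constant times `(n *
k) ^ (2 * n * k) * m ^ (k + 1)` (`iterations_le`, `solver_halts`). This one program yields all three
statements: its expected time is at most its worst-case bound, `log m ≥ 1` for `m ≥ 2`, and `m` is
at most the length of the input.

The program is written in a language whose loops are bounded by parameters that commands cannot
change. The cost of a command therefore depends on the parameters only, and `Cmd.cost_le` bounds it
by an absolute constant times the largest product of nested loop bounds. Compilation to the machine
is verified once, by simulation (`Cmd.runs_compile`). -/

/-! ### Executions of program fragments -/

namespace Prog

/-- The contents of the registers, the memory and the output tape. -/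
@[ext] structure Mach where
  reg : ℕ → ℕ
  mem : ℕ → ℕ
  out : List ℕ

/-- The configuration with the contents `σ` and the programs `K` still to be executed. -/
def Mach.before (σ : Mach) (K : List Prog) : Config := ⟨K, σ.reg, σ.mem, σ.out⟩

/-- The contents `σ` with `z` written to register `d`. -/
def Mach.write (σ : Mach) (d z : ℕ) : Mach := { σ with reg := Function.update σ.reg d z }

@[simp] theorem Mach.write_reg (σ : Mach) (d z r : ℕ) :
    (σ.write d z).reg r = if r = d then z else σ.reg r := by
  simp [Mach.write, Function.update_apply]

@[simp] theorem Mach.write_mem (σ : Mach) (d z : ℕ) : (σ.write d z).mem = σ.mem := rfl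

/-- The configuration `t` steps after `c`. -/
def runFrom (x : List ℕ) (ω : ℕ → Bool) (c : Config) : ℕ → Config
  | 0 => c
  | t + 1 => step x (ω t) (runFrom x ω c t)

theorem runFrom_add (x : List ℕ) (ω : ℕ → Bool) (c : Config) (s t : ℕ) :
    runFrom x ω c (s + t) = runFrom x (fun i => ω (s + i)) (runFrom x ω c s) t := by
  induction t with
  | zero => rfl
  | succ t ih => rw [← Nat.add_assoc]; simp only [runFrom, ih]

theorem run_eq_runFrom (P : Prog) (x : List ℕ) (ω : ℕ → Bool) (t : ℕ) :
    P.run x ω t = runFrom x ω ((⟨fun _ => 0, fun _ => 0, []⟩ : Mach).before [P]) t := by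
  induction t with
  | zero => rfl
  | succ t ih => simp only [runFrom, run, ih]

/-- `P` leads from `σ` to `σ'` in at most `T` steps, whatever the random bits. -/
def Runs (x : List ℕ) (P : Prog) (σ σ' : Mach) (T : ℕ) : Prop :=
  ∀ K, ∃ t ≤ T, ∀ ω, runFrom x ω (σ.before (P :: K)) t = σ'.before K

variable {x : List ℕ} {P Q : Prog} {σ σ₁ σ₂ : Mach} {T T₁ T₂ : ℕ}

theorem Runs.mono (h : Runs x P σ σ₁ T₁) (hT : T₁ ≤ T₂) : Runs x P σ σ₁ T₂ := fun K =>
  let ⟨t, ht, h'⟩ := h K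
  ⟨t, ht.trans hT, h'⟩

theorem Runs.congr (h : Runs x P σ σ₁ T) (e : σ₁ = σ₂) : Runs x P σ σ₂ T := e ▸ h

theorem runs_skip : Runs x skip σ σ 1 := fun _ => ⟨1, le_rfl, fun _ => rfl⟩

theorem runs_const {d c : ℕ} : Runs x (const d c) σ (σ.write d c) 1 :=
  fun _ => ⟨1, le_rfl, fun _ => rfl⟩

theorem runs_add {d a b : ℕ} :
    Runs x (add d a b) σ (σ.write d (σ.reg a + σ.reg b)) 1 := fun _ => ⟨1, le_rfl, fun _ => rfl⟩

theorem runs_sub {d a b : ℕ} :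
    Runs x (sub d a b) σ (σ.write d (σ.reg a - σ.reg b)) 1 := fun _ => ⟨1, le_rfl, fun _ => rfl⟩

theorem runs_read {d a : ℕ} :
    Runs x (read d a) σ (σ.write d (x.getD (σ.reg a) 0)) 1 := fun _ => ⟨1, le_rfl, fun _ => rfl⟩

theorem runs_load {d a : ℕ} :
    Runs x (load d a) σ (σ.write d (σ.mem (σ.reg a))) 1 := fun _ => ⟨1, le_rfl, fun _ => rfl⟩

theorem runs_store {a b : ℕ} :
    Runs x (store a b) σ { σ with mem := Function.update σ.mem (σ.reg a) (σ.reg b) } 1 :=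
  fun _ => ⟨1, le_rfl, fun _ => rfl⟩

theorem runs_emit {a : ℕ} : Runs x (emit a) σ { σ with out := σ.out ++ [σ.reg a] } 1 :=
  fun _ => ⟨1, le_rfl, fun _ => rfl⟩

theorem Runs.seq (h₁ : Runs x P σ σ₁ T₁) (h₂ : Runs x Q σ₁ σ₂ T₂) :
    Runs x (seq P Q) σ σ₂ (T₁ + T₂ + 1) := by
  intro K
  obtain ⟨t₁, ht₁, e₁⟩ := h₁ (Q :: K)
  obtain ⟨t₂, ht₂, e₂⟩ := h₂ K
  refine ⟨1 + t₁ + t₂, by omega, fun ω => ?_⟩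
  rw [runFrom_add, runFrom_add]
  have : runFrom x ω (σ.before (Prog.seq P Q :: K)) 1 = σ.before (P :: Q :: K) := rfl
  rw [this, e₁, e₂]

theorem Runs.branch_pos {a : ℕ} (ha : σ.reg a ≠ 0) (h : Runs x P σ σ₁ T) :
    Runs x (branch a P Q) σ σ₁ (T + 1) := by
  intro K
  obtain ⟨t, ht, e⟩ := h K
  refine ⟨1 + t, by omega, fun ω => ?_⟩
  have : runFrom x ω (σ.before (branch a P Q :: K)) 1 = σ.before (P :: K) := by
    simp [runFrom, step, Mach.before, ha]
  rw [runFrom_add, this, e]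

theorem Runs.branch_zero {a : ℕ} (ha : σ.reg a = 0) (h : Runs x Q σ σ₁ T) :
    Runs x (branch a P Q) σ σ₁ (T + 1) := by
  intro K
  obtain ⟨t, ht, e⟩ := h K
  refine ⟨1 + t, by omega, fun ω => ?_⟩
  have : runFrom x ω (σ.before (branch a P Q :: K)) 1 = σ.before (Q :: K) := by
    simp [runFrom, step, Mach.before, ha]
  rw [runFrom_add, this, e]

theorem runs_loop_zero {a : ℕ} (ha : σ.reg a = 0) : Runs x (loop a P) σ σ 1 :=
  fun K => ⟨1, le_rfl, fun ω => by simp [runFrom, step, Mach.before, ha]⟩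

theorem Runs.loop_succ {a : ℕ} (ha : σ.reg a ≠ 0) (h₁ : Runs x P σ σ₁ T₁)
    (h₂ : Runs x (loop a P) σ₁ σ₂ T₂) : Runs x (loop a P) σ σ₂ (T₁ + T₂ + 1) := by
  intro K
  obtain ⟨t₁, ht₁, e₁⟩ := h₁ (loop a P :: K)
  obtain ⟨t₂, ht₂, e₂⟩ := h₂ K
  refine ⟨1 + t₁ + t₂, by omega, fun ω => ?_⟩
  have : runFrom x ω (σ.before (loop a P :: K)) 1 = σ.before (P :: loop a P :: K) := by
    simp [runFrom, step, Mach.before, ha]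
  rw [runFrom_add, runFrom_add, this, e₁, e₂]

/-- A loop whose control register counts down from `N`. -/
theorem runs_loop_of_invariant {a N : ℕ} (J : ℕ → Mach → Prop)
    (hcount : ∀ i τ, J i τ → τ.reg a = N - i)
    (hstep : ∀ i < N, ∀ τ, J i τ → ∃ τ', Runs x P τ τ' T ∧ J (i + 1) τ') (h₀ : J 0 σ) :
    ∃ σ', Runs x (loop a P) σ σ' (N * (T + 1) + 1) ∧ J N σ' := by
  -- Induction on the number `r` of iterations left, because a loop unfolds at its front.
  have key : ∀ r i τ, i + r = N → J i τ →
      ∃ σ', Runs x (loop a P) τ σ' (r * (T + 1) + 1) ∧ J N σ' := by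
    intro r
    induction r with
    | zero =>
      intro i τ hi hJ
      have hi' : i = N := by omega
      subst hi'
      exact ⟨τ, by simpa using runs_loop_zero (by simp [hcount _ _ hJ]), hJ⟩
    | succ r ih =>
      intro i τ hi hJ
      obtain ⟨τ₁, h₁, hJ₁⟩ := hstep i (by omega) τ hJ
      obtain ⟨σ', h₂, hJ₂⟩ := ih (i + 1) τ₁ (by omega) hJ₁
      refine ⟨σ', (Runs.loop_succ ?_ h₁ h₂).mono (le_of_eq (by ring)), hJ₂⟩
      rw [hcount _ _ hJ]
      omega
  exact key N 0 σ (by omega) h₀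

/-- Copy register `a` to register `d`. -/
def mov (d a : ℕ) : Prog := seq (const d 0) (add d d a)

/-- The target is cleared before the addition, so source and target have to differ. -/
theorem runs_mov {d a : ℕ} (h : a ≠ d) : Runs x (mov d a) σ (σ.write d (σ.reg a)) 3 := by
  have := (runs_const (x := x) (σ := σ) (d := d) (c := 0)).seq
    (runs_add (x := x) (d := d) (a := d) (b := a))
  refine this.congr (Mach.ext (funext fun r => ?_) rfl rfl)
  by_cases hr : r = d <;> simp [h, hr]

/-- A run that ends with an empty list of programs determines the halting behaviour. -/
theorem Runs.halts {P : Prog} (h : Runs x P ⟨fun _ => 0, fun _ => 0, []⟩ σ T) :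
    ∃ t ≤ T, ∀ ω, P.HaltedAt x ω t ∧ ∀ s, P.HaltedAt x ω s → (P.run x ω s).out = σ.out := by
  obtain ⟨t, ht, e⟩ := h []
  -- Halted configurations are fixed points, so any two halting times show the same contents.
  have stay : ∀ (c : Config) (ω : ℕ → Bool) (s : ℕ), c.todo = [] → runFrom x ω c s = c := by
    intro c ω s hc
    induction s with
    | zero => rfl
    | succ s ih => simp only [runFrom, ih]; simp [step, hc]
  refine ⟨t, ht, fun ω => ⟨?_, fun s hs => ?_⟩⟩
  · rw [HaltedAt, run_eq_runFrom, e]; rfl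
  · rw [HaltedAt, run_eq_runFrom] at hs
    rw [run_eq_runFrom]
    rcases le_total s t with hst | hst
    · obtain ⟨r, rfl⟩ := Nat.exists_eq_add_of_le hst
      have := e ω
      rw [runFrom_add, stay _ _ _ hs] at this
      rw [this]; rfl
    · obtain ⟨r, rfl⟩ := Nat.exists_eq_add_of_le hst
      rw [runFrom_add, e, stay _ _ _ rfl]; rfl

end Prog

/-! ### A language with bounded loops and its compilation -/

namespace Bounded

/-- The variables, the arrays and the output of a program with bounded loops. -/
structure State where
  var : ℕ → ℕ
  arr : Fin 16 → ℕ → ℕ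
  out : List ℕ

namespace State

/-- Assign `z` to the variable `y`. -/
def setVar (s : State) (y z : ℕ) : State := { s with var := Function.update s.var y z }

/-- Assign `z` to the entry `i` of the array `j`. -/
def putArr (s : State) (j : Fin 16) (i z : ℕ) : State :=
  { s with arr := Function.update s.arr j (Function.update (s.arr j) i z) }

/-- Append `z` to the output. -/
def emit (s : State) (z : ℕ) : State := { s with out := s.out ++ [z] }

variable (s : State) (y z : ℕ) (j : Fin 16) (i : ℕ)

@[simp] theorem setVar_var (y' : ℕ) :
    (s.setVar y z).var y' = if y' = y then z else s.var y' := by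
  simp [setVar, Function.update_apply]

@[simp] theorem setVar_arr : (s.setVar y z).arr = s.arr := rfl

@[simp] theorem setVar_out : (s.setVar y z).out = s.out := rfl

@[simp] theorem putArr_var : (s.putArr j i z).var = s.var := rfl

@[simp] theorem putArr_arr (j' : Fin 16) (i' : ℕ) :
    (s.putArr j i z).arr j' i' = if j' = j ∧ i' = i then z else s.arr j' i' := by
  by_cases h : j' = j
  · subst h; simp [putArr, Function.update_apply]
  · simp [putArr, h]

@[simp] theorem putArr_out : (s.putArr j i z).out = s.out := rfl

@[simp] theorem emit_var : (s.emit z).var = s.var := rfl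

@[simp] theorem emit_arr : (s.emit z).arr = s.arr := rfl

@[simp] theorem emit_out : (s.emit z).out = s.out ++ [z] := rfl

end State

/-- Terms. `par p` is a parameter, `inp e` an input entry, `arr j e` an array entry, and
`sum y p e` the sum of `e` over the values of the variable `y` below the parameter `p`. -/
inductive Term where
  | lit (c : ℕ) : Term
  | par (p : ℕ) : Term
  | var (y : ℕ) : Term
  | inp (e : Term) : Term
  | arr (j : Fin 16) (e : Term) : Term
  | add (e f : Term) : Term
  | sub (e f : Term) : Term
  | ite (c e f : Term) : Term
  | sum (y p : ℕ) (e : Term) : Term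

/-- Commands. `loop y p c` executes `c` for each value of `y` below the parameter `p`. -/
inductive Cmd where
  | set (y : ℕ) (e : Term) : Cmd
  | put (j : Fin 16) (e f : Term) : Cmd
  | emit (e : Term) : Cmd
  | seq (c d : Cmd) : Cmd
  | cond (e : Term) (c d : Cmd) : Cmd
  | loop (y p : ℕ) (c : Cmd) : Cmd
  | skip : Cmd

/-- The value of a term, for the input `x` and the parameters `ν`. -/
def Term.eval (x : List ℕ) (ν : ℕ → ℕ) : Term → State → ℕ
  | lit c, _ => c
  | par p, _ => ν p
  | var y, s => s.var y
  | inp e, s => x.getD (e.eval x ν s) 0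
  | arr j e, s => s.arr j (e.eval x ν s)
  | add e f, s => e.eval x ν s + f.eval x ν s
  | sub e f, s => e.eval x ν s - f.eval x ν s
  | ite c e f, s => if c.eval x ν s ≠ 0 then e.eval x ν s else f.eval x ν s
  | sum y p e, s => ∑ i ∈ Finset.range (ν p), e.eval x ν (s.setVar y i)

/-- Iterate `f 0`, …, `f (N - 1)`. -/
def iter (f : ℕ → State → State) : ℕ → State → State
  | 0, s => s
  | N + 1, s => f N (iter f N s)

/-- The effect of a command. -/
def Cmd.exec (x : List ℕ) (ν : ℕ → ℕ) : Cmd → State → State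
  | set y e, s => s.setVar y (e.eval x ν s)
  | put j e f, s => s.putArr j (e.eval x ν s) (f.eval x ν s)
  | emit e, s => s.emit (e.eval x ν s)
  | seq c d, s => d.exec x ν (c.exec x ν s)
  | cond e c d, s => if e.eval x ν s ≠ 0 then c.exec x ν s else d.exec x ν s
  | loop y p c, s => iter (fun i s => c.exec x ν (s.setVar y i)) (ν p) s
  | skip, s => s

/-- A bound on the number of steps in which the machine evaluates a term. -/
def Term.cost (ν : ℕ → ℕ) : Term → ℕ
  | lit _ => 1
  | par _ => 3
  | var _ => 3
  | inp e => e.cost ν + 2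
  | arr _ e => e.cost ν + 14
  | add e f => e.cost ν + f.cost ν + 3
  | sub e f => e.cost ν + f.cost ν + 3
  | ite c e f => c.cost ν + e.cost ν + f.cost ν + 2
  | sum _ p e => ν p * (e.cost ν + 11) + 19

/-- A bound on the number of steps in which the machine executes a command. -/
def Cmd.cost (ν : ℕ → ℕ) : Cmd → ℕ
  | set _ e => e.cost ν + 4
  | put _ e f => e.cost ν + f.cost ν + 16
  | emit e => e.cost ν + 2
  | seq c d => c.cost ν + d.cost ν + 1
  | cond e c d => e.cost ν + c.cost ν + d.cost ν + 2
  | loop _ p c => ν p * (c.cost ν + 11) + 19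
  | skip => 1

/-- The register of a parameter. -/
def parReg (p : ℕ) : ℕ := 3 * p
/-- The register of a variable. -/
def varReg (y : ℕ) : ℕ := 3 * y + 1
/-- A register for an intermediate result. -/
def tmp (d : ℕ) : ℕ := 3 * d + 2

/-- Multiply `tmp d` by `16` and add `j`. -/
def address (d : ℕ) (j : Fin 16) : Prog :=
  .seq (.add (tmp d) (tmp d) (tmp d)) <| .seq (.add (tmp d) (tmp d) (tmp d)) <|
  .seq (.add (tmp d) (tmp d) (tmp d)) <| .seq (.add (tmp d) (tmp d) (tmp d)) <|
  .seq (.const (tmp (d + 1)) j) (.add (tmp d) (tmp d) (tmp (d + 1)))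

/-- Execute `B` for the values `0, 1, …` of the variable `y`, as often as `tmp d` says. -/
def counted (d y : ℕ) (B : Prog) : Prog :=
  .seq (.const (tmp (d + 1)) 0) <| .seq (.const (tmp (d + 2)) 1) <|
  .loop (tmp d) <| .seq (Prog.mov (varReg y) (tmp (d + 1))) <| .seq B <|
  .seq (.add (tmp (d + 1)) (tmp (d + 1)) (tmp (d + 2))) (.sub (tmp d) (tmp d) (tmp (d + 2)))

/-- The program that evaluates a term into `tmp d`, using only `tmp d`, `tmp (d + 1)`, …. -/
def Term.compile : Term → ℕ → Prog
  | lit c, d => .const (tmp d) c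
  | par p, d => Prog.mov (tmp d) (parReg p)
  | var y, d => Prog.mov (tmp d) (varReg y)
  | inp e, d => .seq (e.compile d) (.read (tmp d) (tmp d))
  | arr j e, d => .seq (e.compile d) (.seq (address d j) (.load (tmp d) (tmp d)))
  | add e f, d => .seq (e.compile d) (.seq (f.compile (d + 1)) (.add (tmp d) (tmp d) (tmp (d + 1))))
  | sub e f, d => .seq (e.compile d) (.seq (f.compile (d + 1)) (.sub (tmp d) (tmp d) (tmp (d + 1))))
  | ite c e f, d => .seq (c.compile d) (.branch (tmp d) (e.compile d) (f.compile d))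
  | sum y p e, d =>
      .seq (.const (tmp d) 0) <| .seq (Prog.mov (tmp (d + 1)) (varReg y)) <|
      .seq (Prog.mov (tmp (d + 2)) (parReg p)) <|
      .seq (counted (d + 2) y (.seq (e.compile (d + 5)) (.add (tmp d) (tmp d) (tmp (d + 5))))) <|
      Prog.mov (varReg y) (tmp (d + 1))

/-- The program that executes a command, using only `tmp d`, `tmp (d + 1)`, …. -/
def Cmd.compile : Cmd → ℕ → Prog
  | set y e, d => .seq (e.compile d) (Prog.mov (varReg y) (tmp d))
  | put j e f, d => .seq (e.compile d) (.seq (address d j)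
      (.seq (f.compile (d + 1)) (.store (tmp d) (tmp (d + 1)))))
  | emit e, d => .seq (e.compile d) (.emit (tmp d))
  | seq c c', d => .seq (c.compile d) (c'.compile d)
  | cond e c c', d => .seq (e.compile d) (.branch (tmp d) (c.compile d) (c'.compile d))
  | loop y p c, d => .seq (Prog.mov (tmp d) (parReg p)) (counted d y (c.compile (d + 3)))
  | skip, _ => .skip

/-- The machine contents `σ` represent the parameters `ν` and the state `s`. -/
structure Sim (ν : ℕ → ℕ) (s : State) (σ : Prog.Mach) : Prop where
  par : ∀ p, σ.reg (parReg p) = ν p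
  var : ∀ y, σ.reg (varReg y) = s.var y
  arr : ∀ j i, σ.mem (16 * i + (j : Fin 16)) = s.arr j i
  out : σ.out = s.out

/-- The intermediate results before `tmp d` are the same. -/
def Keeps (d : ℕ) (σ σ' : Prog.Mach) : Prop := ∀ e < d, σ'.reg (tmp e) = σ.reg (tmp e)

theorem Keeps.rfl {d : ℕ} {σ : Prog.Mach} : Keeps d σ σ := fun _ _ => Eq.refl _

theorem Keeps.trans {d : ℕ} {σ σ' σ'' : Prog.Mach} (h : Keeps d σ σ') (h' : Keeps d σ' σ'') :
    Keeps d σ σ'' := fun e he => (h' e he).trans (h e he)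

theorem Keeps.mono {d d' : ℕ} {σ σ' : Prog.Mach} (h : Keeps d' σ σ') (hd : d ≤ d') :
    Keeps d σ σ' := fun e he => h e (he.trans_le hd)

theorem Keeps.write {d d' z : ℕ} {σ : Prog.Mach} (h : d ≤ d') : Keeps d σ (σ.write (tmp d') z) := by
  intro e he
  simp only [tmp, Prog.Mach.write_reg]
  rw [if_neg (by omega)]

section
variable {x : List ℕ} {ν : ℕ → ℕ} {s : State} {σ : Prog.Mach} {d : ℕ}

/-- Parameters, variables and intermediate results live in different residue classes modulo 3. -/
theorem Sim.write_tmp (h : Sim ν s σ) (z : ℕ) : Sim ν s (σ.write (tmp d) z) where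
  par p := by
    rw [← h.par p, Prog.Mach.write_reg, if_neg]; simp only [parReg, tmp]; omega
  var y := by
    rw [← h.var y, Prog.Mach.write_reg, if_neg]; simp only [varReg, tmp]; omega
  arr := h.arr
  out := h.out

theorem Sim.write_var (h : Sim ν s σ) (y z : ℕ) :
    Sim ν (s.setVar y z) (σ.write (varReg y) z) where
  par p := by
    rw [← h.par p, Prog.Mach.write_reg, if_neg]; simp only [parReg, varReg]; omega
  var y' := by
    rw [Prog.Mach.write_reg, State.setVar_var, ← h.var y']
    simp [varReg]
  arr := h.arr
  out := h.out

theorem Keeps.write_var {y z : ℕ} : Keeps d σ (σ.write (varReg y) z) := by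
  intro e he
  simp only [tmp, varReg, Prog.Mach.write_reg]
  rw [if_neg (by omega)]

/-- Four doublings replace the multiplication by 16. The scratch register ends with some `z` that
nobody needs. -/
theorem runs_address (j : Fin 16) :
    ∃ z, Prog.Runs x (address d j) σ
      ((σ.write (tmp (d + 1)) z).write (tmp d) (16 * σ.reg (tmp d) + j)) 11 := by
  refine ⟨j, ?_⟩
  have := (Prog.runs_add (x := x) (σ := σ) (d := tmp d) (a := tmp d) (b := tmp d)).seq
    (Prog.runs_add (d := tmp d) (a := tmp d) (b := tmp d) |>.seq
    (Prog.runs_add (d := tmp d) (a := tmp d) (b := tmp d) |>.seq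
    (Prog.runs_add (d := tmp d) (a := tmp d) (b := tmp d) |>.seq
    (Prog.runs_const (d := tmp (d + 1)) (c := j) |>.seq
    (Prog.runs_add (d := tmp d) (a := tmp d) (b := tmp (d + 1)))))))
  have h : tmp d ≠ tmp (d + 1) := by simp only [tmp]; omega
  refine this.congr (Prog.Mach.ext (funext fun r => ?_) rfl rfl)
  simp only [Prog.Mach.write_reg, if_true, h, h.symm, if_false]
  by_cases h₁ : r = tmp d
  · simp [h₁]; ring
  · simp [h₁]

/-- The invariant rule for `counted`. -/
theorem runs_counted {y N T : ℕ} {B : Prog} (J : ℕ → State → Prog.Mach → Prop)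
    (S : ℕ → State) (h : Sim ν (S 0) σ) (hJ : J 0 (S 0) σ) (hN : σ.reg (tmp d) = N)
    -- The loop control itself writes three registers (rounds left, index, the constant one) and the
    -- variable `y`, so the invariant has to survive such writes.
    (hJw : ∀ i τ d' z, d ≤ d' → d' < d + 3 → J i (S i) τ → J i (S i) (τ.write (tmp d') z))
    (hJv : ∀ i τ z, J i (S i) τ → J i (S i) (τ.write (varReg y) z))
    (hB : ∀ i < N, ∀ τ, Sim ν ((S i).setVar y i) τ → J i (S i) τ → ∃ τ', Prog.Runs x B τ τ' T ∧
      Sim ν (S (i + 1)) τ' ∧ J (i + 1) (S (i + 1)) τ' ∧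
      ∀ e, d ≤ e → e < d + 3 → τ'.reg (tmp e) = τ.reg (tmp e)) :
    ∃ σ', Prog.Runs x (counted d y B) σ σ' (N * (T + 9) + 5) ∧ Sim ν (S N) σ' ∧
      J N (S N) σ' := by
  have h01 : tmp d ≠ tmp (d + 1) := by simp only [tmp]; omega
  have h02 : tmp d ≠ tmp (d + 2) := by simp only [tmp]; omega
  have h12 : tmp (d + 1) ≠ tmp (d + 2) := by simp only [tmp]; omega
  have hv0 : tmp d ≠ varReg y := by simp only [tmp, varReg]; omega
  have hv1 : tmp (d + 1) ≠ varReg y := by simp only [tmp, varReg]; omega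
  have hv2 : tmp (d + 2) ≠ varReg y := by simp only [tmp, varReg]; omega
  set σ₁ := σ.write (tmp (d + 1)) 0
  set σ₂ := σ₁.write (tmp (d + 2)) 1
  obtain ⟨σ', hr, hS, hJ', -⟩ := Prog.runs_loop_of_invariant (x := x) (a := tmp d) (N := N)
    (σ := σ₂) (T := T + 8)
    (P := .seq (Prog.mov (varReg y) (tmp (d + 1))) <| .seq B <|
      .seq (.add (tmp (d + 1)) (tmp (d + 1)) (tmp (d + 2))) (.sub (tmp d) (tmp d) (tmp (d + 2))))
    (fun i τ => Sim ν (S i) τ ∧ J i (S i) τ ∧ τ.reg (tmp d) = N - i ∧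
      τ.reg (tmp (d + 1)) = i ∧ τ.reg (tmp (d + 2)) = 1)
    (fun i τ hτ => hτ.2.2.1)
    (by
      rintro i hi τ ⟨hs, hj, h0, h1, h2⟩
      have m1 := Prog.runs_mov (x := x) (σ := τ) hv1
      rw [h1] at m1
      obtain ⟨τ', hr, hs', hj', hk'⟩ := hB i hi (τ.write (varReg y) i) (hs.write_var y i)
        (hJv _ _ _ hj)
      refine ⟨_, (m1.seq (hr.seq (Prog.runs_add.seq Prog.runs_sub))).mono (by omega),
        (hs'.write_tmp _).write_tmp _,
        hJw _ _ _ _ le_rfl (by omega) (hJw _ _ _ _ (by omega) (by omega) hj'),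
        ?_, ?_, ?_⟩
      all_goals
        have e0 := hk' d le_rfl (by omega)
        have e1 := hk' (d + 1) (by omega) (by omega)
        have e2 := hk' (d + 2) (by omega) (by omega)
        simp only [Prog.Mach.write_reg, hv0, hv1, hv2, if_false] at e0 e1 e2
      · simp [h01, h12.symm, e0, e2, h0, h2]; omega
      · simp [h01.symm, e1, e2, h1, h2]
      · simp [h02.symm, h12.symm, e2, h2])
    ⟨(h.write_tmp _).write_tmp _,
      hJw _ _ _ _ (by omega) (by omega) (hJw _ _ _ _ (by omega) (by omega) hJ),
      by simp [σ₁, σ₂, h01, h02, hN], by simp [σ₁, σ₂, h12], by simp [σ₂]⟩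
  exact ⟨σ', (Prog.runs_const.seq (Prog.runs_const.seq hr)).mono
    (by simp only [show T + 8 + 1 = T + 9 from rfl]; omega), hS, hJ'⟩

theorem Term.runs_compile (e : Term) : ∀ {d : ℕ} {s : State} {σ : Prog.Mach}, Sim ν s σ →
    ∃ σ', Prog.Runs x (e.compile d) σ σ' (e.cost ν) ∧ Sim ν s σ' ∧
      σ'.reg (tmp d) = e.eval x ν s ∧ Keeps d σ σ' := by
  induction e with
  | lit c =>
    intro d s σ h
    exact ⟨_, Prog.runs_const, h.write_tmp _, by simp [eval], Keeps.write le_rfl⟩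
  | par p =>
    intro d s σ h
    exact ⟨_, Prog.runs_mov (by simp only [parReg, tmp]; omega), h.write_tmp _,
      by simp [eval, h.par], Keeps.write le_rfl⟩
  | var y =>
    intro d s σ h
    exact ⟨_, Prog.runs_mov (by simp only [varReg, tmp]; omega), h.write_tmp _,
      by simp [eval, h.var], Keeps.write le_rfl⟩
  | inp e ih =>
    intro d s σ h
    obtain ⟨σ₁, r₁, s₁, v₁, k₁⟩ := ih (d := d) h
    exact ⟨_, r₁.seq Prog.runs_read, s₁.write_tmp _, by simp [eval, v₁],
      k₁.trans (Keeps.write le_rfl)⟩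
  | arr j e ih =>
    intro d s σ h
    obtain ⟨σ₁, r₁, s₁, v₁, k₁⟩ := ih (d := d) h
    obtain ⟨z, r₂⟩ := runs_address (x := x) (σ := σ₁) (d := d) j
    exact ⟨_, r₁.seq (r₂.seq Prog.runs_load), ((s₁.write_tmp _).write_tmp _).write_tmp _,
      by simp [eval, v₁, s₁.arr],
      ((k₁.trans (Keeps.write (by omega))).trans (Keeps.write le_rfl)).trans (Keeps.write le_rfl)⟩
  | add e f ihe ihf =>
    intro d s σ h
    obtain ⟨σ₁, r₁, s₁, v₁, k₁⟩ := ihe (d := d) h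
    obtain ⟨σ₂, r₂, s₂, v₂, k₂⟩ := ihf (d := d + 1) s₁
    exact ⟨_, (r₁.seq (r₂.seq Prog.runs_add)).mono (by simp only [cost]; omega), s₂.write_tmp _,
      by simp [eval, v₂, k₂ d (by omega), v₁],
      (k₁.trans (k₂.mono (by omega))).trans (Keeps.write le_rfl)⟩
  | sub e f ihe ihf =>
    intro d s σ h
    obtain ⟨σ₁, r₁, s₁, v₁, k₁⟩ := ihe (d := d) h
    obtain ⟨σ₂, r₂, s₂, v₂, k₂⟩ := ihf (d := d + 1) s₁
    exact ⟨_, (r₁.seq (r₂.seq Prog.runs_sub)).mono (by simp only [cost]; omega), s₂.write_tmp _,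
      by simp [eval, v₂, k₂ d (by omega), v₁],
      (k₁.trans (k₂.mono (by omega))).trans (Keeps.write le_rfl)⟩
  | ite c e f ihc ihe ihf =>
    intro d s σ h
    obtain ⟨σ₁, r₁, s₁, v₁, k₁⟩ := ihc (d := d) h
    by_cases hc : c.eval x ν s = 0
    · obtain ⟨σ₂, r₂, s₂, v₂, k₂⟩ := ihf (d := d) s₁
      exact ⟨_, (r₁.seq (r₂.branch_zero (by rw [v₁, hc]))).mono (by simp only [cost]; omega), s₂,
        by simp [eval, hc, v₂], k₁.trans k₂⟩
    · obtain ⟨σ₂, r₂, s₂, v₂, k₂⟩ := ihe (d := d) s₁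
      exact ⟨_, (r₁.seq (r₂.branch_pos (by rwa [v₁]))).mono (by simp only [cost]; omega), s₂,
        by simp [eval, hc, v₂], k₁.trans k₂⟩
  | sum y p e ih =>
    intro d s σ h
    have hpv (q d : ℕ) : parReg q ≠ tmp d := by simp only [parReg, tmp]; omega
    have hvt (q d : ℕ) : varReg q ≠ tmp d := by simp only [varReg, tmp]; omega
    have htv (q d : ℕ) : tmp d ≠ varReg q := by simp only [varReg, tmp]; omega
    have htt (d d' : ℕ) : tmp d = tmp d' ↔ d = d' := by simp only [tmp]; omega
    set σ₁ := σ.write (tmp d) 0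
    set σ₂ := σ₁.write (tmp (d + 1)) (s.var y)
    set σ₃ := σ₂.write (tmp (d + 2)) (ν p)
    have h₁ : Sim ν s σ₁ := h.write_tmp _
    have h₂ : Sim ν s σ₂ := h₁.write_tmp _
    have h₃ : Sim ν s σ₃ := h₂.write_tmp _
    have m₂ := Prog.runs_mov (x := x) (σ := σ₁) (hvt y (d + 1))
    rw [h₁.var] at m₂
    have m₃ := Prog.runs_mov (x := x) (σ := σ₂) (hpv p (d + 2))
    rw [h₂.par] at m₃
    obtain ⟨σ', r, hs, j₁, j₂, k⟩ := runs_counted (x := x) (ν := ν) (σ := σ₃) (d := d + 2) (y := y)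
      (N := ν p) (T := e.cost ν + 2)
      -- `tmp d` accumulates, `tmp (d + 1)` saves the old value of `y`, and the next three control
      -- the loop; the summand starts at `d + 5`.
      (B := .seq (e.compile (d + 5)) (.add (tmp d) (tmp d) (tmp (d + 5))))
      (fun i _ τ => τ.reg (tmp d) = ∑ i ∈ Finset.range i, e.eval x ν (s.setVar y i) ∧
        τ.reg (tmp (d + 1)) = s.var y ∧ Keeps d σ τ)
      -- Between rounds `y` still holds the index of the previous round; before the first round it
      -- is untouched.
      (fun i => if i = 0 then s else s.setVar y (i - 1)) h₃
      ⟨by simp [σ₃, σ₂, σ₁, htt], by simp [σ₃, σ₂, htt], ((Keeps.write le_rfl).trans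
        (Keeps.write (by omega))).trans (Keeps.write (by omega))⟩ (by simp [σ₃])
      (by
        rintro i τ d' z hd - ⟨j₁, j₂, j₃⟩
        refine ⟨?_, ?_, j₃.trans (Keeps.write (by omega))⟩
        all_goals simp only [Prog.Mach.write_reg, htt]
        all_goals rw [if_neg (by omega)]; assumption)
      (by
        rintro i τ z ⟨j₁, j₂, j₃⟩
        simp only [Prog.Mach.write_reg, htv, if_false]
        exact ⟨j₁, j₂, j₃.trans Keeps.write_var⟩)
      (by
        rintro i hi τ hs ⟨j₁, j₂, j₃⟩
        have hset : (State.setVar (if i = 0 then s else s.setVar y (i - 1)) y i) =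
            s.setVar y i := by
          split_ifs
          · rfl
          · simp [State.setVar]
        rw [hset] at hs
        obtain ⟨τ', r, s', v', k'⟩ := ih (d := d + 5) hs
        refine ⟨_, r.seq Prog.runs_add, by simpa using s'.write_tmp _, ⟨?_, ?_, ?_⟩, ?_⟩
        · simp [v', k' d (by omega), j₁, Finset.sum_range_succ]
        · simp [htt, k' (d + 1) (by omega), j₂]
        · exact (j₃.trans (k'.mono (by omega))).trans (Keeps.write le_rfl)
        · intro e he he'
          simp only [Prog.Mach.write_reg, htt]
          rw [if_neg (by omega), k' e (by omega)])
    -- Evaluating a term must have no side effect, so `y` gets its old value back.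
    have m₄ := Prog.runs_mov (x := x) (σ := σ') (htv y (d + 1))
    rw [j₂] at m₄
    refine ⟨_, (Prog.runs_const.seq (m₂.seq (m₃.seq (r.seq m₄)))).mono
      (by simp only [cost, show e.cost ν + 2 + 9 = e.cost ν + 11 from rfl]; omega), ?_, ?_, ?_⟩
    · have := hs.write_var y (s.var y)
      convert this using 1
      split_ifs
      · simp [State.setVar]
      · simp [State.setVar]
    · simp [htv, j₁, eval]
    · exact k.trans Keeps.write_var

theorem Cmd.runs_compile (c : Cmd) : ∀ {d : ℕ} {s : State} {σ : Prog.Mach}, Sim ν s σ →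
    ∃ σ', Prog.Runs x (c.compile d) σ σ' (c.cost ν) ∧ Sim ν (c.exec x ν s) σ' ∧
      Keeps d σ σ' := by
  induction c with
  | set y e =>
    intro d s σ h
    obtain ⟨σ₁, r₁, s₁, v₁, k₁⟩ := e.runs_compile (x := x) (d := d) h
    have m := Prog.runs_mov (x := x) (σ := σ₁)
      (show tmp d ≠ varReg y by simp only [varReg, tmp]; omega)
    rw [v₁] at m
    exact ⟨_, r₁.seq m, s₁.write_var _ _, k₁.trans Keeps.write_var⟩
  | put j e f =>
    intro d s σ h
    obtain ⟨σ₁, r₁, s₁, v₁, k₁⟩ := e.runs_compile (x := x) (d := d) h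
    obtain ⟨z, r₂⟩ := runs_address (x := x) (σ := σ₁) (d := d) j
    -- The address waits in `tmp d` while the value is computed from `tmp (d + 1)` on.
    obtain ⟨σ₃, r₃, s₃, v₃, k₃⟩ := f.runs_compile (x := x) (d := d + 1)
      ((s₁.write_tmp (d := d + 1) z).write_tmp (d := d) (16 * σ₁.reg (tmp d) + j))
    refine ⟨_, (r₁.seq (r₂.seq (r₃.seq Prog.runs_store))).mono (by simp only [cost]; omega),
      ⟨s₃.par, s₃.var, ?_, s₃.out⟩, ?_⟩
    · intro j' i
      have e₃ := k₃ d (by omega)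
      simp only [Prog.Mach.write_reg, if_true, v₁] at e₃
      simp only [exec, State.putArr_arr, e₃, v₃, Function.update_apply]
      rw [s₃.arr]
      congr 1
      rw [eq_iff_iff]
      constructor
      · intro h
        -- The arrays are interleaved with period 16, and `j < 16`, so an address determines the
        -- array and the index.
        have : i = e.eval x ν s ∧ (j' : ℕ) = j := by omega
        exact ⟨Fin.ext this.2, this.1⟩
      · rintro ⟨rfl, rfl⟩; rfl
    · exact ((k₁.trans (Keeps.write (by omega))).trans (Keeps.write le_rfl)).trans
        (k₃.mono (by omega))
  | emit e =>
    intro d s σ h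
    obtain ⟨σ₁, r₁, s₁, v₁, k₁⟩ := e.runs_compile (x := x) (d := d) h
    exact ⟨_, r₁.seq Prog.runs_emit, ⟨s₁.par, s₁.var, s₁.arr, by simp [exec, s₁.out, v₁]⟩, k₁⟩
  | seq c c' ih ih' =>
    intro d s σ h
    obtain ⟨σ₁, r₁, s₁, k₁⟩ := ih (d := d) h
    obtain ⟨σ₂, r₂, s₂, k₂⟩ := ih' (d := d) s₁
    exact ⟨_, r₁.seq r₂, s₂, k₁.trans k₂⟩
  | cond e c c' ih ih' =>
    intro d s σ h
    obtain ⟨σ₁, r₁, s₁, v₁, k₁⟩ := e.runs_compile (x := x) (d := d) h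
    by_cases he : e.eval x ν s = 0
    · obtain ⟨σ₂, r₂, s₂, k₂⟩ := ih' (d := d) s₁
      exact ⟨_, (r₁.seq (r₂.branch_zero (by rw [v₁, he]))).mono (by simp only [cost]; omega),
        by simpa [exec, he] using s₂, k₁.trans k₂⟩
    · obtain ⟨σ₂, r₂, s₂, k₂⟩ := ih (d := d) s₁
      exact ⟨_, (r₁.seq (r₂.branch_pos (by rwa [v₁]))).mono (by simp only [cost]; omega),
        by simpa [exec, he] using s₂, k₁.trans k₂⟩
  | loop y p c ih =>
    intro d s σ h
    have m := Prog.runs_mov (x := x) (σ := σ)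
      (show parReg p ≠ tmp d by simp only [parReg, tmp]; omega)
    rw [h.par] at m
    obtain ⟨σ', r, hs, k⟩ := runs_counted (x := x) (ν := ν) (d := d) (y := y)
      (N := ν p) (T := c.cost ν) (B := c.compile (d + 3))
      (fun _ _ τ => Keeps d σ τ)
      (fun i => iter (fun i s => c.exec x ν (s.setVar y i)) i s) (h.write_tmp (d := d) (ν p))
      (Keeps.write le_rfl) (by simp)
      (fun i τ d' z hd _ hk => hk.trans (Keeps.write hd))
      (fun i τ z hk => hk.trans Keeps.write_var)
      (by
        intro i hi τ hs hk
        obtain ⟨τ', r, s', k'⟩ := ih (d := d + 3) hs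
        exact ⟨τ', r, s', hk.trans (k'.mono (by omega)), fun e _ he => k' e he⟩)
    refine ⟨σ', (m.seq r).mono ?_, hs, k⟩
    have : ν p * (c.cost ν + 9) ≤ ν p * (c.cost ν + 11) := Nat.mul_le_mul_left _ (by omega)
    simp only [cost]
    omega
  | skip =>
    intro d s σ h
    exact ⟨σ, Prog.runs_skip, h, Keeps.rfl⟩

/-- Copy the variable `y` to the parameter `p`. -/
def publish (p y : ℕ) : Prog := Prog.mov (parReg p) (varReg y)

theorem runs_publish (p y : ℕ) (h : Sim ν s σ) :
    ∃ σ', Prog.Runs x (publish p y) σ σ' 3 ∧ Sim (Function.update ν p (s.var y)) s σ' := by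
  have m := Prog.runs_mov (x := x) (σ := σ)
    (show varReg y ≠ parReg p by simp only [varReg, parReg]; omega)
  rw [h.var] at m
  refine ⟨_, m, ⟨fun q => ?_, fun z => ?_, h.arr, h.out⟩⟩
  · simp only [Prog.Mach.write_reg, Function.update_apply, ← h.par q]
    simp [parReg]
  · rw [← h.var z, Prog.Mach.write_reg, if_neg]
    simp only [varReg, parReg]; omega
end

/-! ### Scripts -/

/-- The parameters and the state after the commands of a script, except the final one. -/
def prepare (x : List ℕ) : List (Cmd × ℕ × ℕ) → (ℕ → ℕ) × State → (ℕ → ℕ) × State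
  | [], a => a
  | (c, p, y) :: l, (ν, s) =>
      prepare x l (Function.update ν p ((c.exec x ν s).var y), c.exec x ν s)

/-- A bound on the number of steps for the commands of a script, except the final one. -/
def prepareCost (x : List ℕ) : List (Cmd × ℕ × ℕ) → (ℕ → ℕ) × State → ℕ
  | [], _ => 0
  | (c, p, y) :: l, (ν, s) => c.cost ν + 5 +
      prepareCost x l (Function.update ν p ((c.exec x ν s).var y), c.exec x ν s)

/-- The program of a script. -/
def compileScript : List (Cmd × ℕ × ℕ) → Cmd → Prog
  | [], c => c.compile 0
  | (c, p, y) :: l, c' => .seq (c.compile 0) (.seq (publish p y) (compileScript l c'))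

/-- Loop bounds such as `m ^ k` have to be computed before they can bound a loop. Each is computed
under the parameters known so far and then published; every command is charged with the parameters
in force when it runs. -/
theorem runs_compileScript {x : List ℕ} (l : List (Cmd × ℕ × ℕ)) (c : Cmd) :
    ∀ {ν : ℕ → ℕ} {s : State} {σ : Prog.Mach}, Sim ν s σ → ∃ σ',
      Prog.Runs x (compileScript l c) σ σ'
        (prepareCost x l (ν, s) + c.cost (prepare x l (ν, s)).1) ∧
      σ'.out = (c.exec x (prepare x l (ν, s)).1 (prepare x l (ν, s)).2).out := by
  induction l with
  | nil =>
    intro ν s σ h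
    obtain ⟨σ', r, hs, -⟩ := c.runs_compile (x := x) (d := 0) h
    exact ⟨σ', r.mono (by simp [prepare, prepareCost]), hs.out⟩
  | cons a l ih =>
    obtain ⟨c₁, p, y⟩ := a
    intro ν s σ h
    obtain ⟨σ₁, r₁, h₁, -⟩ := c₁.runs_compile (x := x) (d := 0) h
    obtain ⟨σ₂, r₂, h₂⟩ := runs_publish (x := x) p y h₁
    obtain ⟨σ₃, r₃, h₃⟩ := ih h₂
    exact ⟨σ₃, (r₁.seq (r₂.seq r₃)).mono (by simp only [prepareCost, prepare]; omega), h₃⟩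

theorem Term.deterministic_compile (e : Term) : ∀ d, (e.compile d).Deterministic := by
  induction e <;> intro d <;>
    simp_all [Term.compile, Prog.Deterministic, Prog.mov, counted, address]

theorem Cmd.deterministic_compile (c : Cmd) : ∀ d, (c.compile d).Deterministic := by
  induction c <;> intro d <;>
    simp_all [Cmd.compile, Prog.Deterministic, Prog.mov, counted, address,
      Term.deterministic_compile]

theorem deterministic_compileScript (l : List (Cmd × ℕ × ℕ)) (c : Cmd) :
    (compileScript l c).Deterministic := by
  induction l with
  | nil => exact c.deterministic_compile 0
  | cons a l ih =>
    simp [compileScript, Prog.Deterministic, publish, Prog.mov, Cmd.deterministic_compile, ih]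

/-- The initial state. -/
def State.init : State := ⟨fun _ => 0, fun _ _ => 0, []⟩

theorem sim_init : Sim (fun _ => 0) State.init ⟨fun _ => 0, fun _ => 0, []⟩ :=
  ⟨fun _ => rfl, fun _ => rfl, fun _ _ => rfl, rfl⟩

/-- The program of a script halts in time with the output that the script computes. -/
theorem compileScript_halts (x : List ℕ) (l : List (Cmd × ℕ × ℕ)) (c : Cmd) :
    ∃ t ≤ prepareCost x l (fun _ => 0, State.init) +
        c.cost (prepare x l (fun _ => 0, State.init)).1,
      ∀ ω, (compileScript l c).HaltedAt x ω t ∧ ∀ s, (compileScript l c).HaltedAt x ω s →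
        ((compileScript l c).run x ω s).out = (c.exec x (prepare x l (fun _ => 0, State.init)).1
          (prepare x l (fun _ => 0, State.init)).2).out := by
  obtain ⟨σ', r, h⟩ := runs_compileScript (x := x) l c sim_init
  rw [← h]
  exact r.halts
end Bounded

/-! ### Swaps that bring a given set to the top -/

namespace Vote

variable {m : ℕ}

/-- The pairs that have to be swapped to bring the set `S` to the top of the vote `v`. -/
def crossing (v : Vote m) (S : Finset (Fin m)) : Finset (Fin m × Fin m) :=
  Finset.univ.filter fun s => s.1 ∉ S ∧ s.2 ∈ S ∧ v s.1 < v s.2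

@[simp] theorem mem_crossing {v : Vote m} {S : Finset (Fin m)} {s : Fin m × Fin m} :
    s ∈ v.crossing S ↔ s.1 ∉ S ∧ s.2 ∈ S ∧ v s.1 < v s.2 := by simp [crossing]

theorem applySwap_apply (v : Vote m) (s : Fin m × Fin m) (c : Fin m) :
    v.applySwap s c = if c = s.1 then v s.2 else if c = s.2 then v s.1 else v c := by
  simp only [applySwap, Equiv.trans_apply, Equiv.swap_apply_def, v.injective.eq_iff]

/-- An admissible swap changes the order of no other pair. -/
theorem applySwap_lt_iff {v : Vote m} {s : Fin m × Fin m} (hs : v.Admissible s) {a b : Fin m}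
    (h₁ : (a, b) ≠ s) (h₂ : (b, a) ≠ s) : v.applySwap s a < v.applySwap s b ↔ v a < v b := by
  obtain ⟨c, d⟩ := s
  have hne : c ≠ d := by rintro rfl; simp [Admissible] at hs
  simp only [Admissible] at hs
  simp only [ne_eq, Prod.mk.injEq] at h₁ h₂
  -- The swapped ranks are consecutive, so a third candidate lies on the same side of both.
  have key : ∀ e : Fin m, e ≠ c → e ≠ d → (v e : ℕ) ≠ v c ∧ (v e : ℕ) ≠ v d := fun e hc hd =>
    ⟨fun h => hc (v.injective (Fin.ext h)), fun h => hd (v.injective (Fin.ext h))⟩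
  simp only [applySwap_apply, Fin.lt_def]
  by_cases hac : a = c
  · subst hac
    by_cases hbd : b = d
    · exact absurd ⟨rfl, hbd⟩ h₁
    · by_cases hba : b = a
      · subst hba; simp
      · have := key b hba hbd
        simp [hba, hbd]; omega
  · by_cases had : a = d
    · subst had
      by_cases hbc : b = c
      · exact absurd ⟨hbc, rfl⟩ h₂
      · by_cases hba : b = a
        · subst hba; simp
        · have := key b hbc hba
          simp [hba, hbc, hac]; omega
    · have := key a hac had
      by_cases hbc : b = c
      · subst hbc; simp [hac, had]; omega
      · by_cases hbd : b = d
        · subst hbd; simp [hac, had, hbc]; omega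
        · simp [hac, had, hbc, hbd]

/-- No swap of another pair can reverse `a` and `b`, and while `a` is before `b` only the
orientation `(a, b)` is admissible. -/
theorem mem_of_inverted {a b : Fin m} (l : List (Fin m × Fin m)) : ∀ v : Vote m,
    v.AdmissibleList l → v a < v b → l.foldl applySwap v b < l.foldl applySwap v a →
      (a, b) ∈ l := by
  induction l with
  | nil => intro v _ h h'; exact absurd h' (not_lt.2 h.le)
  | cons s l ih =>
    rintro v ⟨hs, hl⟩ h h'
    by_cases e : (a, b) = s
    · exact e ▸ List.mem_cons_self
    · refine List.mem_cons_of_mem _ (ih _ hl ?_ h')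
      refine (applySwap_lt_iff hs e ?_).2 h
      rintro rfl
      simp only [Admissible] at hs
      rw [Fin.lt_def] at h
      omega

/-- The lower bound on costs: a crossing pair starts with the outsider first and ends with the
outsider below rank `k` and the member above, so it is inverted. -/
theorem crossing_subset {v w : Vote m} {Γ : Finset (Fin m × Fin m)} (h : v.Yields Γ w) (k : ℕ) :
    v.crossing (Finset.univ.filter fun c => (w c : ℕ) < k) ⊆ Γ := by
  rintro ⟨a, b⟩ hab
  obtain ⟨l, -, rfl, hl, rfl⟩ := h
  simp only [mem_crossing, Finset.mem_filter, Finset.mem_univ, true_and] at hab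
  exact List.mem_toFinset.2 (mem_of_inverted l v hl hab.2.2 (Fin.lt_def.2 (by omega)))

/-- Look at the candidate just after `a`: if it is in `S`, the pair is found; if not, it takes the
role of `a`, closer to `b`. -/
theorem exists_adjacent_crossing {v : Vote m} {S : Finset (Fin m)} {a b : Fin m}
    (h : (a, b) ∈ v.crossing S) : ∃ s ∈ v.crossing S, v.Admissible s := by
  obtain ⟨N, hN⟩ : ∃ N, (v b : ℕ) - v a ≤ N := ⟨_, le_rfl⟩
  induction N generalizing a with
  | zero =>
    have := Fin.lt_def.1 (mem_crossing.1 h).2.2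
    simp only at this; omega
  | succ N ih =>
    obtain ⟨ha, hb, hab⟩ := mem_crossing.1 h
    simp only [Fin.lt_def] at ha hb hab
    by_cases hadj : (v a : ℕ) + 1 = v b
    · exact ⟨_, h, hadj⟩
    · have hlt : (v a : ℕ) + 1 < m := by have := (v b).2; omega
      set c := v.symm ⟨v a + 1, hlt⟩ with hc
      have hvc : (v c : ℕ) = v a + 1 := by simp [hc]
      by_cases hcS : c ∈ S
      · exact ⟨(a, c), mem_crossing.2 ⟨ha, hcS, Fin.lt_def.2 (by simp only; omega)⟩, hvc.symm⟩
      · exact ih (a := c) (mem_crossing.2 ⟨hcS, hb, Fin.lt_def.2 (by simp only; omega)⟩) (by omega)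

/-- All other pairs keep their order, and the reverse of a crossing pair never crosses, as its first
entry is in `S`. -/
theorem crossing_applySwap {v : Vote m} {S : Finset (Fin m)} {s : Fin m × Fin m}
    (h : s ∈ v.crossing S) (hs : v.Admissible s) :
    (v.applySwap s).crossing S = (v.crossing S).erase s := by
  obtain ⟨h₁, h₂, h₃⟩ := mem_crossing.1 h
  ext ⟨a, b⟩
  by_cases e : (a, b) = s
  · subst e
    simp only [mem_crossing, Finset.mem_erase, ne_eq, not_true_eq_false, false_and, iff_false]
    rintro ⟨-, -, h'⟩
    simp only [applySwap_apply] at h' h₃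
    simp only [if_true] at h'
    split_ifs at h' with h₄
    · exact lt_irrefl _ h'
    · exact lt_asymm h' h₃
  · simp only [mem_crossing, Finset.mem_erase, ne_eq, e, not_false_eq_true, true_and]
    refine and_congr_right fun ha => and_congr_right fun hb => applySwap_lt_iff hs e ?_
    rintro rfl
    exact h₁ hb

/-- The crossing pairs can be swapped in some order, and then `S` is at the top. -/
theorem exists_yields_crossing (v : Vote m) (S : Finset (Fin m)) :
    ∃ w, v.Yields (v.crossing S) w ∧ ∀ c, c ∈ S ↔ (w c : ℕ) < S.card := by
  obtain ⟨N, hN⟩ : ∃ N, (v.crossing S).card = N := ⟨_, rfl⟩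
  induction N generalizing v with
  | zero =>
    rw [Finset.card_eq_zero] at hN
    refine ⟨v, ⟨[], List.nodup_nil, by simp [hN], trivial, rfl⟩, ?_⟩
    have hup : ∀ a ∉ S, ∀ b ∈ S, v b < v a := by
      intro a ha b hb
      by_contra! hle
      have hne : v a ≠ v b := fun e => ha (v.injective e ▸ hb)
      have : (a, b) ∈ v.crossing S := mem_crossing.2 ⟨ha, hb, lt_of_le_of_ne hle hne⟩
      simp [hN] at this
    have hcard : (S.image fun c => (v c : ℕ)).card = S.card :=
      Finset.card_image_of_injective _ fun a b h => v.injective (Fin.ext h)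
    intro c
    constructor
    · intro hc
      -- With no crossing pair left, everything ranked above a member is a member; counting these
      -- ranks bounds the rank of `c`.
      have : Finset.range (v c + 1) ⊆ S.image fun c => (v c : ℕ) := by
        intro r hr
        rw [Finset.mem_range] at hr
        have hrm : r < m := by have := (v c).2; omega
        refine Finset.mem_image.2 ⟨v.symm ⟨r, hrm⟩, ?_, by simp⟩
        by_contra hn
        have := hup _ hn c hc
        simp only [Equiv.apply_symm_apply, Fin.lt_def] at this
        omega
      have := Finset.card_le_card this
      rw [hcard, Finset.card_range] at this
      omega
    · intro hc
      by_contra hn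
      have : (S.image fun c => (v c : ℕ)) ⊆ Finset.range (v c) := by
        intro r hr
        obtain ⟨b, hb, rfl⟩ := Finset.mem_image.1 hr
        exact Finset.mem_range.2 (Fin.lt_def.1 (hup c hn b hb))
      have := Finset.card_le_card this
      rw [hcard, Finset.card_range] at this
      omega
  | succ N ih =>
    -- Swap an adjacent crossing pair first. It has left the crossing set, so the induction
    -- hypothesis never swaps it again and the list has no repetition.
    obtain ⟨⟨a, b⟩, hab⟩ : (v.crossing S).Nonempty := Finset.card_pos.1 (by omega)
    obtain ⟨s, hs, hadj⟩ := exists_adjacent_crossing hab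
    have hcr := crossing_applySwap hs hadj
    obtain ⟨w, ⟨l, hl, hlS, hla, hw⟩, htop⟩ := ih (v.applySwap s)
      (by rw [hcr, Finset.card_erase_of_mem hs, hN]; rfl)
    rw [hcr] at hlS
    refine ⟨w, ⟨s :: l, List.nodup_cons.2 ⟨fun h => ?_, hl⟩, ?_, ⟨hadj, hla⟩, hw⟩, htop⟩
    · have := List.mem_toFinset.2 h
      simp [hlS] at this
    · rw [List.toFinset_cons, hlS, Finset.insert_erase hs]

end Vote

/-! ### Solutions as choices of approved sets -/

theorem score_approvalVector {n m k : ℕ} (V : Fin n → Vote m) (c : Fin m) :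
    score (approvalVector k) V c = (Finset.univ.filter fun i => (V i c : ℕ) < k).card := by
  rw [Finset.card_filter]; rfl

namespace SwapBribery

/-- A choice of the candidates to be approved in each vote that makes the preferred candidate a
winner within the budget. -/
structure IsTarget (I : SwapBribery) (S : Fin I.n → Finset (Fin I.m)) : Prop where
  card : ∀ i, (S i).card = I.k
  winner : ∀ d, (Finset.univ.filter fun i => d ∈ S i).card ≤
    (Finset.univ.filter fun i => I.preferred ∈ S i).card
  cost : ∑ i, ∑ s ∈ (I.votes i).crossing (S i), I.cost i s.1 s.2 ≤ I.budget

/-- The sets approved in the resulting votes serve: their crossing pairs are among the swaps of `Γ`,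
and costs are nonnegative. -/
theorem IsSolution.exists_isTarget {I : SwapBribery} {Γ : Finset (Fin I.n × Fin I.m × Fin I.m)}
    (h : I.IsSolution Γ) : ∃ S, I.IsTarget S := by
  obtain ⟨hc, W, hW, hwin⟩ := h
  refine ⟨fun i => Finset.univ.filter fun c => (W i c : ℕ) < I.k, fun i => ?_, fun d => ?_, ?_⟩
  · have : (Finset.univ.filter fun c => (W i c : ℕ) < I.k) =
        (Finset.univ.filter fun r : Fin I.m => (r : ℕ) < I.k).map (W i).symm.toEmbedding := by
      ext c; simp [Finset.mem_map_equiv]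
    rw [this, Finset.card_map, Fin.card_filter_val_lt, min_eq_right I.k_le]
  · simpa [score_approvalVector] using hwin d
  · refine le_trans ?_ hc
    rw [← Finset.sum_fiberwise Γ (fun s => s.1)]
    refine Finset.sum_le_sum fun i _ => ?_
    refine (Finset.sum_le_sum_of_subset (Vote.crossing_subset (hW i) I.k)).trans (le_of_eq ?_)
    rw [Finset.sum_image]
    · refine Finset.sum_congr rfl fun s hs => ?_
      rw [← (Finset.mem_filter.1 hs).2]
    · intro s hs t ht e
      exact Prod.ext (((Finset.mem_filter.1 hs).2).trans (Finset.mem_filter.1 ht).2.symm) e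

/-- Performing exactly the crossing swaps in each vote brings `S i` to the first `k` ranks. -/
theorem IsTarget.isSolution {I : SwapBribery} {S : Fin I.n → Finset (Fin I.m)} (h : I.IsTarget S) :
    I.IsSolution (Finset.univ.filter fun s => s.2 ∈ (I.votes s.1).crossing (S s.1)) := by
  choose W hW hW' using fun i => Vote.exists_yields_crossing (I.votes i) (S i)
  refine ⟨?_, W, fun i => ?_, fun d => ?_⟩
  · refine le_trans (le_of_eq ?_) h.cost
    rw [Finset.sum_filter, Fintype.sum_prod_type]
    refine Finset.sum_congr rfl fun i _ => ?_
    rw [← Finset.sum_filter]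
    refine Finset.sum_congr ?_ fun _ _ => rfl
    ext s
    rw [Finset.mem_filter]
    simp
  · convert hW i using 1
    ext s
    simp only [Finset.mem_image, Finset.mem_filter, Finset.mem_univ, true_and]
    constructor
    · rintro ⟨⟨j, t⟩, ⟨ht, rfl⟩, rfl⟩; exact ht
    · intro hs; exact ⟨(i, s), ⟨hs, rfl⟩, rfl⟩
  · rw [score_approvalVector, score_approvalVector]
    have hk := h.card
    simpa only [hW', hk] using h.winner d

end SwapBribery

/-! ### Cheapest tuples and representative sets -/

namespace Representatives

/-- The digit of `t` in place `s`, in base `r`. -/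
def digit (r t s : ℕ) : ℕ := t / r ^ s % r

theorem digit_lt {r : ℕ} (hr : 0 < r) (t s : ℕ) : digit r t s < r := Nat.mod_lt _ hr

/-- Makes enumeration by counting exhaustive. The induction splits off the lowest digit. -/
theorem exists_digit_eq {r : ℕ} (k : ℕ) (τ : ℕ → ℕ) (h : ∀ s < k, τ s < r) :
    ∃ t < r ^ k, ∀ s < k, digit r t s = τ s := by
  induction k generalizing τ with
  | zero => exact ⟨0, by simp, by simp⟩
  | succ k ih =>
    obtain ⟨t, ht, hs⟩ := ih (fun s => τ (s + 1)) fun s hs => h _ (by omega)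
    have h₀ := h 0 (by omega)
    refine ⟨τ 0 + r * t, ?_, ?_⟩
    · calc τ 0 + r * t < r + r * t := by omega
        _ = r * (t + 1) := by ring
        _ ≤ r * r ^ k := Nat.mul_le_mul_left _ ht
        _ = r ^ (k + 1) := by ring
    · rintro (_ | s) hs'
      · simp [digit, Nat.mod_eq_of_lt h₀]
      · rw [← hs s (by omega), digit, digit, pow_succ', ← Nat.div_div_eq_div_mul,
          Nat.add_mul_div_left _ _ (by omega), Nat.div_eq_of_lt h₀, zero_add]

open Classical in
/-- The first number below `N` with property `P` for which `w` is minimal. -/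
noncomputable def best (P : ℕ → Prop) (w : ℕ → ℕ) : ℕ → Option ℕ
  | 0 => none
  | t + 1 => match best P w t with
    | none => if P t then some t else none
    | some u => if P t ∧ w t < w u then some t else some u

theorem best_eq_none {P : ℕ → Prop} {w : ℕ → ℕ} {N : ℕ} (h : best P w N = none) :
    ∀ t < N, ¬ P t := by
  induction N with
  | zero => simp
  | succ N ih =>
    simp only [best] at h
    split at h
    · rename_i h'
      split_ifs at h with hP
      intro t ht
      rcases Nat.lt_succ_iff_lt_or_eq.1 ht with ht | rfl
      · exact ih h' t ht
      · exact hP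
    · split_ifs at h

theorem best_eq_some {P : ℕ → Prop} {w : ℕ → ℕ} {N u : ℕ} (h : best P w N = some u) :
    u < N ∧ P u ∧ ∀ t < N, P t → w u ≤ w t := by
  induction N generalizing u with
  | zero => simp [best] at h
  | succ N ih =>
    simp only [best] at h
    split at h
    · rename_i h'
      split_ifs at h with hP
      obtain rfl := Option.some.inj h
      refine ⟨by omega, hP, fun t ht hPt => ?_⟩
      rcases Nat.lt_succ_iff_lt_or_eq.1 ht with ht | rfl
      · exact absurd hPt (best_eq_none h' t ht)
      · exact le_rfl
    · rename_i v h'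
      obtain ⟨h₁, h₂, h₃⟩ := ih h'
      split_ifs at h with hP
      · obtain rfl := Option.some.inj h
        refine ⟨by omega, hP.1, fun t ht hPt => ?_⟩
        rcases Nat.lt_succ_iff_lt_or_eq.1 ht with ht | rfl
        · exact hP.2.le.trans (h₃ t ht hPt)
        · exact le_rfl
      · obtain rfl := Option.some.inj h
        refine ⟨by omega, h₂, fun t ht hPt => ?_⟩
        rcases Nat.lt_succ_iff_lt_or_eq.1 ht with ht | rfl
        · exact h₃ t ht hPt
        · exact not_lt.1 fun hlt => hP ⟨hPt, hlt⟩

/-- The cost of bringing the entries of the tuple `τ` to the top of a vote with the ranks `pos` and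
the prices `cst`. -/
def weight (m k : ℕ) (pos : ℕ → ℕ) (cst : ℕ → ℕ → ℕ) (τ : ℕ → ℕ) : ℕ :=
  ∑ s ∈ Finset.range k, ∑ a ∈ Finset.range m,
    if pos a < pos (τ s) ∧ ∀ s' < k, τ s' ≠ a then cst a (τ s) else 0

/-- The cost of bringing the set `S` to the top. -/
def setWeight (m : ℕ) (pos : ℕ → ℕ) (cst : ℕ → ℕ → ℕ) (S : Finset ℕ) : ℕ :=
  ∑ b ∈ S, ∑ a ∈ Finset.range m, if pos a < pos b ∧ a ∉ S then cst a b else 0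

/-- The program sums over places and the argument sums over sets; a repeated entry would be counted
twice. -/
theorem weight_eq_setWeight {m k : ℕ} {pos : ℕ → ℕ} {cst : ℕ → ℕ → ℕ} {τ : ℕ → ℕ}
    (h : Set.InjOn τ (Finset.range k : Set ℕ)) :
    weight m k pos cst τ = setWeight m pos cst ((Finset.range k).image τ) := by
  rw [weight, setWeight, Finset.sum_image h]
  simp

theorem weight_congr {m k : ℕ} {pos : ℕ → ℕ} {cst : ℕ → ℕ → ℕ} {τ τ' : ℕ → ℕ}
    (h : ∀ s < k, τ s = τ' s) : weight m k pos cst τ = weight m k pos cst τ' := by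
  refine Finset.sum_congr rfl fun s hs => Finset.sum_congr rfl fun a _ => ?_
  rw [h s (Finset.mem_range.1 hs)]
  congr 1
  rw [eq_iff_iff]
  exact and_congr_right fun _ => forall₂_congr fun s' hs' => by rw [h s' hs']

/-- The tuple `τ` of length `k` extends `Y`, avoids `H` in the other places, and has no repetitions;
if `b = 0`, then it also avoids `p`. -/
structure Fits (k p b : ℕ) (Y H : List ℕ) (τ : ℕ → ℕ) : Prop where
  ext : ∀ s < k, s < Y.length → τ s = Y.getD s 0
  avoid : ∀ s < k, Y.length ≤ s → τ s ∉ H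
  inj : ∀ s < k, ∀ s' < k, s ≠ s' → τ s ≠ τ s'
  pref : b = 0 → ∀ s < k, τ s ≠ p

theorem Fits.congr {k p b : ℕ} {Y H : List ℕ} {τ τ' : ℕ → ℕ} (h : Fits k p b Y H τ)
    (e : ∀ s < k, τ' s = τ s) : Fits k p b Y H τ' where
  ext s hs := by rw [e s hs]; exact h.ext s hs
  avoid s hs := by rw [e s hs]; exact h.avoid s hs
  inj s hs s' hs' := by rw [e s hs, e s' hs']; exact h.inj s hs s' hs'
  pref hb s hs := by rw [e s hs]; exact h.pref hb s hs

theorem Fits.mono {k p b : ℕ} {Y H H' : List ℕ} {τ : ℕ → ℕ} (h : Fits k p b Y H τ)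
    (e : H' ⊆ H) : Fits k p b Y H' τ :=
  ⟨h.ext, fun s hs hY h' => h.avoid s hs hY (e h'), h.inj, h.pref⟩

theorem Fits.injOn {k p b : ℕ} {Y H : List ℕ} {τ : ℕ → ℕ} (h : Fits k p b Y H τ) :
    Set.InjOn τ (Finset.range k : Set ℕ) := by
  intro s hs s' hs' e
  by_contra hne
  exact h.inj s (by simpa using hs) s' (by simpa using hs') hne e

section
variable (m k Q p : ℕ) (pos : ℕ → ℕ) (cst : ℕ → ℕ → ℕ) (b : ℕ)

/-- The cheapest tuple that fits. -/
noncomputable def cheapest (Y H : List ℕ) (N : ℕ) : Option ℕ :=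
  best (fun t => Fits k p b Y H (digit m t)) (fun t => weight m k pos cst (digit m t)) N

/-- The entries of the tuple `τ` from place `j` on. -/
def tail (j : ℕ) (τ : ℕ → ℕ) : List ℕ := ((List.range k).filter fun s => j ≤ s).map τ

/-- Append the new entries of a cheapest tuple to `H`. -/
noncomputable def enlarge (Y H : List ℕ) : List ℕ :=
  match cheapest m k p pos cst b Y H (m ^ k) with
  | none => H
  | some u => H ++ tail k Y.length (digit m u)

/-- The new entries of `Q` cheapest tuples that extend `Y`, disjoint apart from that. -/
noncomputable def pool (Y : List ℕ) : ℕ → List ℕ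
  | 0 => []
  | q + 1 => enlarge m k p pos cst b Y (pool Y q)

/-- The entry that follows `Y`, for the choice `z`. -/
noncomputable def next (Y : List ℕ) (z : ℕ) : ℕ :=
  if Y = [] ∧ b ≠ 0 then p else (pool m k p pos cst b Y Q).getD z 0

/-- The list that results from the choices `l`. -/
noncomputable def build (l : List ℕ) : List ℕ :=
  l.foldl (fun Y z => Y ++ [next m k Q p pos cst b Y z]) []
end

section
variable {m k Q p : ℕ} {pos : ℕ → ℕ} {cst : ℕ → ℕ → ℕ} {b : ℕ}

theorem mem_tail {j x : ℕ} {τ : ℕ → ℕ} : x ∈ tail k j τ ↔ ∃ s < k, j ≤ s ∧ τ s = x := by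
  simp [tail, and_assoc]

theorem length_tail_le {j : ℕ} {τ : ℕ → ℕ} : (tail k j τ).length ≤ k := by
  simpa [tail] using List.length_filter_le (fun s => decide (j ≤ s)) (List.range k)

theorem length_pool_le {Y : List ℕ} (q : ℕ) : (pool m k p pos cst b Y q).length ≤ q * k := by
  induction q with
  | zero => simp [pool]
  | succ q ih =>
    have : (pool m k p pos cst b Y (q + 1)).length ≤ (pool m k p pos cst b Y q).length + k := by
      simp only [pool, enlarge]
      split
      · omega
      · simpa using length_tail_le
    rw [Nat.succ_mul]
    omega

/-- For each small set `X`, the pool is exhausted, or contains a new entry of a cheapest tuple that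
avoids `X`. -/
theorem pool_spec {Y : List ℕ} (X : Finset ℕ) (hY : Y.length < k) (q : ℕ) :
    (∀ t < m ^ k, ¬ Fits k p b Y (pool m k p pos cst b Y q) (digit m t)) ∨
    (∃ u, Fits k p b Y [] (digit m u) ∧ (∀ x ∈ tail k Y.length (digit m u), x ∉ X) ∧
      (∃ x ∈ tail k Y.length (digit m u), x ∈ pool m k p pos cst b Y q) ∧
      ∀ t < m ^ k, Fits k p b Y (pool m k p pos cst b Y q) (digit m t) →
        weight m k pos cst (digit m u) ≤ weight m k pos cst (digit m t)) ∨
    q ≤ (X ∩ (pool m k p pos cst b Y q).toFinset).card := by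
  induction q with
  | zero => exact Or.inr (Or.inr (Nat.zero_le _))
  | succ q ih =>
    simp only [pool]
    set H := pool m k p pos cst b Y q
    cases hc : cheapest m k p pos cst b Y H (m ^ k) with
    | none =>
      have : enlarge m k p pos cst b Y H = H := by simp [enlarge, hc]
      rw [this]
      exact Or.inl (best_eq_none hc)
    | some u =>
      have he : enlarge m k p pos cst b Y H = H ++ tail k Y.length (digit m u) := by
        simp [enlarge, hc]
      obtain ⟨hu, hfit, hmin⟩ := best_eq_some hc
      rw [he]
      have hsub : H ⊆ H ++ tail k Y.length (digit m u) := List.subset_append_left _ _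
      -- The first two alternatives survive the growth of the pool, since fewer tuples fit a larger
      -- one.
      rcases ih with h | ⟨v, h₁, h₂, ⟨x, h₃, h₄⟩, h₅⟩ | h
      · exact Or.inl fun t ht hf => h t ht (hf.mono hsub)
      · exact Or.inr (Or.inl ⟨v, h₁, h₂, ⟨x, h₃, hsub h₄⟩, fun t ht hf => h₅ t ht (hf.mono hsub)⟩)
      · by_cases hX : ∀ x ∈ tail k Y.length (digit m u), x ∉ X
        -- Since `Y` is shorter than `k`, the new tuple has at least one new entry.
        · have hmem : digit m u Y.length ∈ tail k Y.length (digit m u) :=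
            mem_tail.2 ⟨_, hY, le_rfl, rfl⟩
          exact Or.inr (Or.inl ⟨u, hfit.mono (List.nil_subset _), hX,
            ⟨_, hmem, List.mem_append_right _ hmem⟩, fun t ht hf => hmin t ht (hf.mono hsub)⟩)
        · push Not at hX
          obtain ⟨x, hx, hxX⟩ := hX
          -- The new tuple meets `X` in an entry outside the old pool, so one more element of `X` is
          -- covered.
          refine Or.inr (Or.inr (lt_of_le_of_lt h (Finset.card_lt_card ?_)))
          refine Finset.ssubset_iff_of_subset (fun y hy => ?_) |>.2 ⟨x, ?_, ?_⟩
          · simp only [Finset.mem_inter, List.mem_toFinset] at hy ⊢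
            exact ⟨hy.1, hsub hy.2⟩
          · simp only [Finset.mem_inter, List.mem_toFinset]
            exact ⟨hxX, List.mem_append_right _ hx⟩
          · obtain ⟨s, hs, hjs, rfl⟩ := mem_tail.1 hx
            simp only [Finset.mem_inter, List.mem_toFinset, not_and]
            exact fun _ => hfit.avoid s hs hjs

/-- A set of `k` candidates that contains `p` if and only if `b ≠ 0`, and avoids `X`. -/
structure Proper (m k p b : ℕ) (X S : Finset ℕ) : Prop where
  subset : S ⊆ Finset.range m
  card : S.card = k
  pref : p ∈ S ↔ b ≠ 0
  disj : Disjoint X S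

/-- List `S` with `Y` in front and the rest in any order. Only the places after `Y` have to avoid
`H`. -/
theorem exists_fits {X S : Finset ℕ} {Y H : List ℕ} (hS : Proper m k p b X S) (hY : Y.Nodup)
    (hYS : Y.toFinset ⊆ S) (hH : ∀ x ∈ S, x ∉ Y → x ∉ H) :
    ∃ t < m ^ k, Fits k p b Y H (digit m t) ∧
      weight m k pos cst (digit m t) = setWeight m pos cst S := by
  set l := Y ++ (S \ Y.toFinset).toList with hl
  have hnd : l.Nodup := by
    refine List.Nodup.append hY (Finset.nodup_toList _) ?_
    intro x hx hx'
    simp [hx] at hx'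
  have hlS : l.toFinset = S := by
    rw [hl, List.toFinset_append, Finset.toList_toFinset]
    exact Finset.union_sdiff_of_subset hYS
  have hlen : l.length = k := by
    rw [← hS.card, ← hlS, List.toFinset_card_of_nodup hnd]
  have hmem : ∀ s < k, l.getD s 0 ∈ S := by
    intro s hs
    rw [← hlS, List.mem_toFinset, List.getD_eq_getElem _ _ (by omega)]
    exact List.getElem_mem _
  obtain ⟨t, ht, hd⟩ := exists_digit_eq (r := m) k (fun s => l.getD s 0)
    fun s hs => Finset.mem_range.1 (hS.subset (hmem s hs))
  have hfit : Fits k p b Y H (fun s => l.getD s 0) := by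
    refine ⟨fun s _ hs => ?_, fun s hs hs' => ?_, fun s hs s' hs' hne e => hne ?_, ?_⟩
    · simp only [hl]
      rw [List.getD_append _ _ _ _ hs]
    · refine hH _ (hmem s hs) fun h => ?_
      simp only [hl] at h
      rw [List.getD_append_right _ _ _ _ hs', List.getD_eq_getElem _ _
        (by simp only [hl, List.length_append] at hlen; omega)] at h
      have := List.getElem_mem (l := (S \ Y.toFinset).toList)
        (n := s - Y.length) (by simp only [hl, List.length_append] at hlen; omega)
      rw [Finset.mem_toList, Finset.mem_sdiff] at this
      exact this.2 (List.mem_toFinset.2 h)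
    · rw [List.getD_eq_getElem _ _ (by omega), List.getD_eq_getElem _ _ (by omega)] at e
      exact (hnd.getElem_inj_iff).1 e
    · rintro hb s hs e
      have := hmem s hs
      rw [e, hS.pref] at this
      exact this hb
  refine ⟨t, ht, hfit.congr hd, ?_⟩
  rw [weight_congr hd, weight_eq_setWeight hfit.injOn]
  congr 1
  refine Finset.eq_of_subset_of_card_le ?_ ?_
  · intro x hx
    obtain ⟨s, hs, rfl⟩ := Finset.mem_image.1 hx
    exact hmem s (Finset.mem_range.1 hs)
  · rw [Finset.card_image_of_injOn hfit.injOn, Finset.card_range, hS.card]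

/-- The entries from `Y` avoid `X` because they are in `S`, the others by assumption. For `b ≠ 0`
the candidate `p` is already in `Y`; for `b = 0` a tuple that fits avoids it. -/
theorem Fits.proper {X S : Finset ℕ} {Y H : List ℕ} {t : ℕ} (h : Fits k p b Y H (digit m t))
    (hS : Proper m k p b X S) (hYS : Y.toFinset ⊆ S) (hYk : Y.length ≤ k) (hp : b ≠ 0 → p ∈ Y)
    (hX : ∀ x ∈ tail k Y.length (digit m t), x ∉ X) :
    Proper m k p b X ((Finset.range k).image (digit m t)) ∧
      Y.toFinset ⊆ (Finset.range k).image (digit m t) := by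
  have hsub : Y.toFinset ⊆ (Finset.range k).image (digit m t) := by
    intro x hx
    obtain ⟨s, hs, rfl⟩ := List.mem_iff_getElem.1 (List.mem_toFinset.1 hx)
    refine Finset.mem_image.2 ⟨s, Finset.mem_range.2 (by omega), ?_⟩
    rw [h.ext s (by omega) hs, List.getD_eq_getElem _ _ hs]
  refine ⟨⟨?_, ?_, ⟨?_, ?_⟩, ?_⟩, hsub⟩
  · intro x hx
    obtain ⟨s, hs, rfl⟩ := Finset.mem_image.1 hx
    -- Digits in base `0` are unbounded, but without candidates `S` is empty and `k = 0`.
    rcases Nat.eq_zero_or_pos m with rfl | hm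
    · have hk : S = ∅ := by simpa using hS.subset
      have := hS.card
      simp only [hk, Finset.card_empty] at this
      simp only [Finset.mem_range] at hs; omega
    · exact Finset.mem_range.2 (digit_lt hm _ _)
  · rw [Finset.card_image_of_injOn h.injOn, Finset.card_range]
  · intro hpx hb
    obtain ⟨s, hs, e⟩ := Finset.mem_image.1 hpx
    exact h.pref hb s (Finset.mem_range.1 hs) e
  · exact fun hb => hsub (List.mem_toFinset.2 (hp hb))
  · rw [Finset.disjoint_right]
    intro x hx
    obtain ⟨s, hs, rfl⟩ := Finset.mem_image.1 hx
    rw [Finset.mem_range] at hs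
    by_cases hsY : s < Y.length
    · rw [h.ext s hs hsY, List.getD_eq_getElem _ _ hsY]
      exact Finset.disjoint_right.1 hS.disj (hYS (List.mem_toFinset.2 (List.getElem_mem _)))
    · exact hX _ (mem_tail.2 ⟨s, hs, by omega, rfl⟩)

/-- The exchange argument. `S` stands for the best completion of `Y` known so far; it may be changed
so that the next entry comes from the pool, without extra cost and still avoiding `X`. -/
theorem exists_next {X S : Finset ℕ} {Y : List ℕ} (hQ : 0 < Q) (hS : Proper m k p b X S)
    (hX : X.card < Q) (hY : Y.Nodup) (hYS : Y.toFinset ⊆ S) (hYk : Y.length < k)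
    (hp : b ≠ 0 → Y ≠ [] → p ∈ Y) :
    ∃ z < Q * k, ∃ S', Proper m k p b X S' ∧ setWeight m pos cst S' ≤ setWeight m pos cst S ∧
      (Y ++ [next m k Q p pos cst b Y z]).Nodup ∧
      (Y ++ [next m k Q p pos cst b Y z]).toFinset ⊆ S' ∧
      (b ≠ 0 → p ∈ Y ++ [next m k Q p pos cst b Y z]) := by
  by_cases h₀ : Y = [] ∧ b ≠ 0
  · refine ⟨0, Nat.mul_pos hQ (by omega), S, hS, le_rfl, ?_⟩
    have : p ∈ S := hS.pref.2 h₀.2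
    simp [next, h₀, this]
  have hp' : b ≠ 0 → p ∈ Y := fun hb => hp hb fun h => h₀ ⟨h, hb⟩
  suffices ∃ x ∈ pool m k p pos cst b Y Q, x ∉ Y ∧ ∃ S', Proper m k p b X S' ∧
      setWeight m pos cst S' ≤ setWeight m pos cst S ∧ Y.toFinset ⊆ S' ∧ x ∈ S' by
    obtain ⟨x, hx, hxY, S', h₁, h₂, h₃, h₄⟩ := this
    obtain ⟨z, hz, rfl⟩ := List.mem_iff_getElem.1 hx
    have hn : next m k Q p pos cst b Y z = (pool m k p pos cst b Y Q)[z] := by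
      rw [next, if_neg h₀, List.getD_eq_getElem _ _ hz]
    refine ⟨z, hz.trans_le (length_pool_le Q), S', h₁, h₂, ?_, ?_, ?_⟩
    · rw [hn]
      exact List.Nodup.append hY (List.nodup_singleton _) (by simpa using hxY)
    · rw [hn, List.toFinset_append]
      exact Finset.union_subset h₃ (by simpa using h₄)
    · exact fun hb => List.mem_append_left _ (hp' hb)
  -- If `S` meets the pool outside `Y`, `S` itself can stay.
  by_cases hmeet : ∃ x ∈ S, x ∉ Y ∧ x ∈ pool m k p pos cst b Y Q
  · obtain ⟨x, hxS, hxY, hx⟩ := hmeet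
    exact ⟨x, hx, hxY, S, hS, le_rfl, hYS, hxS⟩
  · push Not at hmeet
    -- Otherwise `S` still fits the full pool: the pool is not exhausted, and an extension collected
    -- there that avoids `X` is no more expensive than `S`.
    obtain ⟨t, ht, hfit, hw⟩ := exists_fits (pos := pos) (cst := cst) hS hY hYS hmeet
    rcases pool_spec (m := m) (p := p) (pos := pos) (cst := cst) (b := b) X hYk Q with
      h | ⟨u, h₁, h₂, ⟨x, h₃, h₄⟩, h₅⟩ | h
    · exact absurd hfit (h t ht)
    · obtain ⟨hS', hY'⟩ := h₁.proper hS hYS hYk.le hp' h₂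
      obtain ⟨s, hs, hjs, rfl⟩ := mem_tail.1 h₃
      refine ⟨_, h₄, ?_, _, hS', ?_, hY', Finset.mem_image.2 ⟨s, Finset.mem_range.2 hs, rfl⟩⟩
      · intro hmem
        obtain ⟨s', hs', e⟩ := List.mem_iff_getElem.1 hmem
        rw [← List.getD_eq_getElem _ 0 hs', ← h₁.ext s' (by omega) hs'] at e
        exact h₁.inj s' (by omega) s hs (by omega) e
      · rw [← hw, ← weight_eq_setWeight h₁.injOn]
        exact h₅ t ht hfit
    -- The pool cannot cover `Q` elements of a set with fewer than `Q` elements.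
    · exact absurd (h.trans (Finset.card_le_card Finset.inter_subset_left)) (by omega)

/-- Each proper set can be replaced by one that results from some choices, without extra cost. -/
theorem exists_build {X S : Finset ℕ} (hQ : 0 < Q) (hS : Proper m k p b X S) (hX : X.card < Q) :
    ∃ l : List ℕ, l.length = k ∧ (∀ z ∈ l, z < Q * k) ∧
      (build m k Q p pos cst b l).Nodup ∧
      Proper m k p b X (build m k Q p pos cst b l).toFinset ∧
      setWeight m pos cst (build m k Q p pos cst b l).toFinset ≤ setWeight m pos cst S := by
  have key : ∀ j ≤ k, ∃ l : List ℕ, l.length = j ∧ (∀ z ∈ l, z < Q * k) ∧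
      (build m k Q p pos cst b l).length = j ∧
      (build m k Q p pos cst b l).Nodup ∧
      (b ≠ 0 → build m k Q p pos cst b l ≠ [] → p ∈ build m k Q p pos cst b l) ∧
      ∃ S', Proper m k p b X S' ∧ setWeight m pos cst S' ≤ setWeight m pos cst S ∧
        (build m k Q p pos cst b l).toFinset ⊆ S' := by
    intro j
    induction j with
    | zero => exact fun _ => ⟨[], rfl, by simp, rfl, by simp [build], by simp [build], S, hS, le_rfl,
        by simp [build]⟩
    | succ j ih =>
      intro hj
      obtain ⟨l, h₁, h₂, h₃, h₄, h₅, S', h₆, h₇, h₈⟩ := ih (by omega)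
      obtain ⟨z, hz, S'', g₁, g₂, g₃, g₄, g₅⟩ := exists_next (pos := pos) (cst := cst) hQ h₆ hX h₄
        h₈ (by omega) h₅
      have e : build m k Q p pos cst b (l ++ [z]) = build m k Q p pos cst b l ++
          [next m k Q p pos cst b (build m k Q p pos cst b l) z] := by simp [build]
      refine ⟨l ++ [z], by simp [h₁], ?_, ?_, ?_, ?_, S'', g₁, g₂.trans h₇, ?_⟩
      · intro y hy
        rcases List.mem_append.1 hy with hy | hy
        · exact h₂ y hy
        · rw [List.mem_singleton.1 hy]; exact hz
      · simp [e, h₃]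
      · rwa [e]
      · rw [e]; exact fun hb _ => g₅ hb
      · rwa [e]
  obtain ⟨l, h₁, h₂, h₃, h₄, h₅, S', h₆, h₇, h₈⟩ := key k le_rfl
  -- After `k` entries without repetition inside a set of size `k`, nothing is missing.
  have : (build m k Q p pos cst b l).toFinset = S' := by
    refine Finset.eq_of_subset_of_card_le h₈ ?_
    rw [h₆.card, List.toFinset_card_of_nodup h₄, h₃]
  exact ⟨l, h₁, h₂, h₄, this ▸ h₆, this ▸ h₇⟩
end

end Representatives

/-! ### Tables of approved candidates -/

namespace SwapBribery

open Representatives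

variable (I : SwapBribery)

/-- The rank of the candidate `a` in the vote `i`, and `0` outside the range. -/
def rank (i a : ℕ) : ℕ := if h : i < I.n ∧ a < I.m then I.votes ⟨i, h.1⟩ ⟨a, h.2⟩ else 0

/-- The price of the swap of `a` and `b` in the vote `i`, and `0` outside the range. -/
def price (i a b : ℕ) : ℕ :=
  if h : i < I.n ∧ a < I.m ∧ b < I.m then I.cost ⟨i, h.1⟩ ⟨a, h.2.1⟩ ⟨b, h.2.2⟩ else 0

/-- The number of places of the table `Y` in which the candidate `d` stands. -/
def count (Y : ℕ → ℕ → ℕ) (d : ℕ) : ℕ :=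
  ∑ i ∈ Finset.range I.n, ∑ s ∈ Finset.range I.k, if Y i s = d then 1 else 0

/-- The table `Y` of approved candidates describes a solution. -/
structure Valid (Y : ℕ → ℕ → ℕ) : Prop where
  lt : ∀ i < I.n, ∀ s < I.k, Y i s < I.m
  inj : ∀ i < I.n, ∀ s < I.k, ∀ s' < I.k, s ≠ s' → Y i s ≠ Y i s'
  winner : ∀ d < I.m, I.count Y d ≤ I.count Y I.preferred
  cost : ∑ i ∈ Finset.range I.n, weight I.m I.k (I.rank i) (I.price i) (Y i) ≤ I.budget

/-- The swaps for the table `Y`, as they are written to the output. -/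
def swaps (Y : ℕ → ℕ → ℕ) : List ℕ :=
  (List.range I.n).flatMap fun i => (List.range I.k).flatMap fun s =>
    (List.range I.m).flatMap fun a =>
      if I.rank i a < I.rank i (Y i s) ∧ ∀ s' < I.k, Y i s' ≠ a then [i, a, Y i s] else []

variable {I} {Y : ℕ → ℕ → ℕ}

@[simp] theorem rank_fin (i : Fin I.n) (a : Fin I.m) : I.rank i a = I.votes i a := by simp [rank]

@[simp] theorem price_fin (i : Fin I.n) (a b : Fin I.m) : I.price i a b = I.cost i a b := by
  simp [price]

/-- The candidates approved in each vote, according to the table `Y`. -/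
def approved (I : SwapBribery) (Y : ℕ → ℕ → ℕ) (i : Fin I.n) : Finset (Fin I.m) :=
  Finset.univ.filter fun c => ∃ s < I.k, Y i s = c

theorem mem_approved {i : Fin I.n} {c : Fin I.m} :
    c ∈ I.approved Y i ↔ ∃ s < I.k, Y i s = c := by simp [approved]

theorem Valid.sum_approved (h : I.Valid Y) (i : Fin I.n) (f : ℕ → ℕ) :
    ∑ c ∈ I.approved Y i, f c = ∑ s ∈ Finset.range I.k, f (Y i s) := by
  symm
  refine Finset.sum_bij (fun s hs => ⟨Y i s, h.lt i i.2 s (Finset.mem_range.1 hs)⟩) ?_ ?_ ?_ ?_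
  · intro s hs
    exact mem_approved.2 ⟨s, Finset.mem_range.1 hs, rfl⟩
  · intro s hs s' hs' e
    by_contra hne
    exact h.inj i i.2 s (Finset.mem_range.1 hs) s' (Finset.mem_range.1 hs') hne (Fin.mk.inj e)
  · intro c hc
    obtain ⟨s, hs, e⟩ := mem_approved.1 hc
    exact ⟨s, Finset.mem_range.2 hs, Fin.ext e⟩
  · intro s hs; rfl

theorem Valid.count_eq (h : I.Valid Y) (d : Fin I.m) :
    I.count Y d = (Finset.univ.filter fun i => d ∈ I.approved Y i).card := by
  rw [count, Finset.sum_range, Finset.card_filter]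
  refine Finset.sum_congr rfl fun i _ => ?_
  rw [← h.sum_approved i fun c => if c = d then 1 else 0]
  simp [← Fin.ext_iff]

theorem Valid.isTarget (h : I.Valid Y) : I.IsTarget (I.approved Y) where
  card i := by
    have := h.sum_approved i fun _ => 1
    simpa using this
  winner d := by
    rw [← h.count_eq, ← h.count_eq]
    exact h.winner d d.2
  cost := by
    refine le_trans (le_of_eq ?_) h.cost
    rw [Finset.sum_range]
    refine Finset.sum_congr rfl fun i _ => ?_
    rw [weight, ← h.sum_approved i fun b => ∑ a ∈ Finset.range I.m,
      if I.rank i a < I.rank i b ∧ ∀ s' < I.k, Y i s' ≠ a then I.price i a b else 0]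
    rw [Vote.crossing, Finset.sum_filter, Fintype.sum_prod_type_right]
    rw [← Finset.sum_subset (Finset.subset_univ (I.approved Y i))]
    · refine Finset.sum_congr rfl fun b hb => ?_
      rw [Finset.sum_range]
      refine Finset.sum_congr rfl fun a _ => ?_
      simp only [rank_fin, price_fin, hb, true_and, mem_approved, not_exists, not_and,
        Fin.val_fin_lt, ne_eq]
      congr 1
      rw [and_comm]
    · intro b _ hb
      simp [hb]

theorem Valid.correctOutput (h : I.Valid Y) : I.CorrectOutput (1 :: I.swaps Y) := by
  right
  set L : List (Fin I.n × Fin I.m × Fin I.m) :=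
    (List.finRange I.n).flatMap fun i : Fin I.n => (List.finRange I.k).flatMap fun s : Fin I.k =>
      (List.finRange I.m).flatMap fun a : Fin I.m =>
        if I.rank i a < I.rank i (Y i s) ∧ ∀ s' < I.k, Y i s' ≠ a then
          [(i, a, ⟨Y i s, h.lt i i.2 s s.2⟩)] else [] with hL
  have hmem : ∀ t, t ∈ L ↔ t.2 ∈ (I.votes t.1).crossing (I.approved Y t.1) := by
    rintro ⟨i, a, b⟩
    simp only [hL, List.mem_flatMap, List.mem_finRange, true_and, Vote.mem_crossing, mem_approved]
    constructor
    · rintro ⟨i', s, a', ht⟩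
      split_ifs at ht with hc
      · simp only [List.mem_singleton, Prod.mk.injEq] at ht
        obtain ⟨rfl, rfl, rfl⟩ := ht
        refine ⟨fun ⟨s', hs', e⟩ => hc.2 s' hs' e, ⟨s, s.2, rfl⟩, ?_⟩
        have := hc.1
        rw [Fin.lt_def, ← rank_fin, ← rank_fin]
        exact this
      · simp at ht
    · rintro ⟨h₁, ⟨s, hs, e⟩, h₂⟩
      refine ⟨i, ⟨s, hs⟩, a, ?_⟩
      rw [if_pos]
      · simp [e]
      · simp only [e, rank_fin]
        exact ⟨h₂, fun s' hs' e' => h₁ ⟨s', hs', e'⟩⟩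
  refine ⟨L, ?_, ?_, ?_⟩
  · rw [hL, List.nodup_flatMap]
    refine ⟨fun i _ => ?_, ?_⟩
    · rw [List.nodup_flatMap]
      refine ⟨fun s _ => ?_, ?_⟩
      · rw [List.nodup_flatMap]
        refine ⟨fun a _ => by split_ifs <;> simp, ?_⟩
        refine (List.nodup_finRange _).imp fun {a a'} hne => ?_
        intro t ht ht'
        beta_reduce at ht ht'
        split_ifs at ht ht' <;> simp_all
      · refine (List.nodup_finRange _).imp fun {s s'} hne => ?_
        intro t ht ht'
        simp only [List.mem_flatMap, List.mem_finRange, true_and] at ht ht'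
        obtain ⟨a, ht⟩ := ht
        obtain ⟨a', ht'⟩ := ht'
        split_ifs at ht ht'
        -- Different places of a row hold different candidates, so their swaps differ in the last
        -- component.
        · have e : Y i s ≠ Y i s' := h.inj i i.2 s s.2 s' s'.2 fun e => hne (Fin.ext e)
          simp only [List.mem_singleton] at ht ht'
          rw [ht] at ht'
          simp only [Prod.mk.injEq, Fin.mk.injEq] at ht'
          exact e ht'.2.2
        all_goals simp_all
    · refine (List.nodup_finRange _).imp fun {i i'} hne => ?_
      intro t ht ht'
      simp only [List.mem_flatMap, List.mem_finRange, true_and] at ht ht'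
      obtain ⟨s, a, ht⟩ := ht
      obtain ⟨s', a', ht'⟩ := ht'
      split_ifs at ht ht' <;> simp_all
  · convert h.isTarget.isSolution using 1
    ext t
    rw [List.mem_toFinset, hmem, Finset.mem_filter]
    simp
  · have hr : ∀ N, List.range N = (List.finRange N).map Fin.val := fun N => by simp
    rw [swaps, hL]
    simp only [hr, List.flatMap_map, List.flatMap_assoc]
    congr 1
    refine List.flatMap_congr fun i _ => List.flatMap_congr fun s _ =>
      List.flatMap_congr fun a _ => ?_
    split_ifs <;> simp

/-- A choice of approved candidates that describes a solution. -/
structure Feasible (I : SwapBribery) (T : ℕ → Finset ℕ) : Prop where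
  subset : ∀ i < I.n, T i ⊆ Finset.range I.m
  card : ∀ i < I.n, (T i).card = I.k
  winner : ∀ d, ((Finset.range I.n).filter fun i => d ∈ T i).card ≤
    ((Finset.range I.n).filter fun i => (I.preferred : ℕ) ∈ T i).card
  cost : ∑ i ∈ Finset.range I.n, setWeight I.m (I.rank i) (I.price i) (T i) ≤ I.budget

/-- A change of types only: the program and the representative sets work with plain numbers. Numbers
from `m` on occur in none of the sets. -/
theorem IsTarget.exists_feasible {S : Fin I.n → Finset (Fin I.m)} (h : I.IsTarget S) :
    ∃ T, I.Feasible T := by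
  set T : ℕ → Finset ℕ := fun i => if hi : i < I.n then (S ⟨i, hi⟩).map Fin.valEmbedding else ∅
  have hT (i : Fin I.n) : T i = (S i).map Fin.valEmbedding := by simp [T]
  have hcount (d : Fin I.m) : ((Finset.range I.n).filter fun i => (d : ℕ) ∈ T i).card =
      (Finset.univ.filter fun i => d ∈ S i).card := by
    rw [Finset.card_filter, Finset.sum_range, Finset.card_filter]
    refine Finset.sum_congr rfl fun i _ => ?_
    rw [hT]
    simp [← Fin.ext_iff]
  have hsub : ∀ i < I.n, T i ⊆ Finset.range I.m := by
    intro i hi x hx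
    rw [hT ⟨i, hi⟩] at hx
    obtain ⟨c, -, rfl⟩ := Finset.mem_map.1 hx
    simp
  refine ⟨T, hsub, fun i hi => ?_, fun d => ?_, ?_⟩
  · rw [hT ⟨i, hi⟩, Finset.card_map, h.card]
  · by_cases hd : d < I.m
    · have := h.winner ⟨d, hd⟩
      rwa [← hcount, ← hcount] at this
    · rw [Finset.filter_false_of_mem]
      · simp
      · intro i hi hdi
        exact hd (Finset.mem_range.1 (hsub i (Finset.mem_range.1 hi) hdi))
  · refine le_trans (le_of_eq ?_) h.cost
    rw [Finset.sum_range]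
    refine Finset.sum_congr rfl fun i _ => ?_
    rw [hT, setWeight, Finset.sum_map, Vote.crossing, Finset.sum_filter,
      Fintype.sum_prod_type_right]
    rw [← Finset.sum_subset (Finset.subset_univ (S i))]
    · refine Finset.sum_congr rfl fun b hb => ?_
      rw [Finset.sum_range]
      refine Finset.sum_congr rfl fun a _ => ?_
      simp [hb, ← Fin.ext_iff, and_comm]
    · intro b _ hb
      simp [hb]

/-- The other approved candidates, which must not be approved in addition. -/
def others (I : SwapBribery) (T : ℕ → Finset ℕ) (i : ℕ) : Finset ℕ :=
  ((Finset.range I.n).erase i).biUnion T \ T i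

/-- This is where the size of the pool comes from: `Q` is one more than this bound. -/
theorem Feasible.card_others {T : ℕ → Finset ℕ} (h : I.Feasible T) {i : ℕ} (hi : i < I.n) :
    (I.others T i).card ≤ (I.n - 1) * I.k := by
  refine (Finset.card_le_card Finset.sdiff_subset).trans ?_
  refine (Finset.card_biUnion_le_card_mul _ _ I.k fun j hj => ?_).trans (le_of_eq ?_)
  · exact (h.card j (Finset.mem_range.1 (Finset.mem_of_mem_erase hj))).le
  · rw [Finset.card_erase_of_mem (Finset.mem_range.2 hi), Finset.card_range]

/-- The score of the preferred candidate stays the same. A candidate that is new in vote `i` is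
approved nowhere else, and no other candidate gains. -/
theorem Feasible.update {T : ℕ → Finset ℕ} (h : I.Feasible T) {i b : ℕ} (hi : i < I.n)
    {S : Finset ℕ} (hS : Proper I.m I.k I.preferred b (I.others T i) S)
    (hb : (I.preferred : ℕ) ∈ T i ↔ b ≠ 0)
    (hw : setWeight I.m (I.rank i) (I.price i) S ≤ setWeight I.m (I.rank i) (I.price i) (T i)) :
    I.Feasible (Function.update T i S) where
  subset j hj := by
    by_cases e : j = i
    · subst e; simpa using hS.subset
    · simpa [e] using h.subset j hj
  card j hj := by
    by_cases e : j = i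
    · subst e; simpa using hS.card
    · simpa [e] using h.card j hj
  winner d := by
    have hp : ((Finset.range I.n).filter fun j => (I.preferred : ℕ) ∈ Function.update T i S j) =
        (Finset.range I.n).filter fun j => (I.preferred : ℕ) ∈ T j := by
      refine Finset.filter_congr fun j _ => ?_
      by_cases e : j = i
      · subst e; simp only [Function.update_self]; rw [hb, hS.pref]
      · simp [e]
    rw [hp]
    by_cases hd : d ∈ S ∧ d ∉ T i
    · have hone : ((Finset.range I.n).filter fun j => d ∈ Function.update T i S j) ⊆ {i} := by
        intro j hj
        rw [Finset.mem_singleton]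
        by_contra e
        simp only [Finset.mem_filter, Function.update_of_ne e] at hj
        refine Finset.disjoint_right.1 hS.disj hd.1 (Finset.mem_sdiff.2 ⟨?_, hd.2⟩)
        exact Finset.mem_biUnion.2 ⟨j, Finset.mem_erase.2 ⟨e, hj.1⟩, hj.2⟩
      refine (Finset.card_le_card hone).trans ?_
      rw [Finset.card_singleton]
      -- As `k ≥ 1`, someone has a positive score, hence so does the winner, and score one is
      -- harmless.
      obtain ⟨c, hc⟩ : (T i).Nonempty := Finset.card_pos.1 (by rw [h.card i hi]; exact I.k_pos)
      refine le_trans ?_ (h.winner c)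
      exact Finset.card_pos.2 ⟨i, Finset.mem_filter.2 ⟨Finset.mem_range.2 hi, hc⟩⟩
    · refine (Finset.card_le_card fun j hj => ?_).trans (h.winner d)
      rw [Finset.mem_filter] at hj ⊢
      refine ⟨hj.1, ?_⟩
      by_cases e : j = i
      · subst e
        have := hj.2
        rw [Function.update_self] at this
        by_contra hn
        exact hd ⟨this, hn⟩
      · simpa [e] using hj.2
  cost := by
    refine (Finset.sum_le_sum fun j _ => ?_).trans h.cost
    by_cases e : j = i
    · subst e; simpa using hw
    · simp [e]

/-- The table that results from the choices `b` and `z`. -/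
noncomputable def table (I : SwapBribery) (b : ℕ → ℕ) (z : ℕ → ℕ → ℕ) (i s : ℕ) : ℕ :=
  (build I.m I.k ((I.n - 1) * I.k + 1) I.preferred (I.rank i) (I.price i) (b i)
    ((List.range I.k).map (z i))).getD s 0

/-- Replace the sets of the votes one after the other by built ones. The obstacles for vote `j` are
taken in the current choice, whose earlier votes have already been replaced. -/
theorem IsSolution.exists_valid_table {Γ : Finset (Fin I.n × Fin I.m × Fin I.m)}
    (hΓ : I.IsSolution Γ) : ∃ (b : ℕ → ℕ) (z : ℕ → ℕ → ℕ), (∀ i, b i < 2) ∧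
      (∀ i s, z i s < ((I.n - 1) * I.k + 1) * I.k) ∧ I.Valid (I.table b z) := by
  obtain ⟨S, hS⟩ := hΓ.exists_isTarget
  have hk := I.k_pos
  have key : ∀ j ≤ I.n, ∃ T, I.Feasible T ∧ ∃ (b : ℕ → ℕ) (z : ℕ → ℕ → ℕ), (∀ i, b i < 2) ∧
      (∀ i s, z i s < ((I.n - 1) * I.k + 1) * I.k) ∧ ∀ i < j, ∃ Y : List ℕ,
        Y = build I.m I.k ((I.n - 1) * I.k + 1) I.preferred (I.rank i) (I.price i) (b i)
          ((List.range I.k).map (z i)) ∧ Y.Nodup ∧ Y.toFinset = T i := by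
    intro j
    induction j with
    | zero =>
      obtain ⟨T, hT⟩ := hS.exists_feasible
      exact fun _ => ⟨T, hT, 0, 0, by simp, by simp; omega, by simp⟩
    | succ j ih =>
      intro hj
      obtain ⟨T, hT, b, z, hb, hz, hY⟩ := ih (by omega)
      classical
      -- The bit records the current attitude of vote `j` to the preferred candidate, which the
      -- replacement keeps.
      set c := if (I.preferred : ℕ) ∈ T j then 1 else 0 with hc
      have hc' : (I.preferred : ℕ) ∈ T j ↔ c ≠ 0 := by simp [hc]
      have hprop : Proper I.m I.k I.preferred c (I.others T j) (T j) :=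
        ⟨hT.subset j hj, hT.card j hj, hc', Finset.sdiff_disjoint⟩
      obtain ⟨l, hl, hlt, hnd, hp, hw⟩ := exists_build (pos := I.rank j) (cst := I.price j)
        (Nat.succ_pos ((I.n - 1) * I.k)) hprop (Nat.lt_succ_of_le (hT.card_others hj))
      refine ⟨_, hT.update hj hp hc' hw, Function.update b j c,
        Function.update z j fun s => l.getD s 0, fun i => ?_, fun i s => ?_, fun i hi => ?_⟩
      · by_cases e : i = j
        · subst e; simp only [Function.update_self, hc]; split_ifs <;> simp
        · simpa [e] using hb i
      · by_cases e : i = j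
        · subst e
          simp only [Function.update_self]
          by_cases hs : s < l.length
          · rw [List.getD_eq_getElem _ _ hs]; exact hlt _ (List.getElem_mem _)
          -- Beyond place `k` the choice is the default `0`, which is in range because `Q * k > 0`.
          · rw [List.getD_eq_default _ _ (by omega)]; positivity
        · simpa [e] using hz i s
      · by_cases e : i = j
        · subst e
          have hmap : (List.range I.k).map (fun s => l.getD s 0) = l := by
            refine List.ext_getElem (by simp [hl]) fun s h₁ h₂ => ?_
            simp [List.getElem?_eq_getElem h₂]
          simp only [Function.update_self, hmap]
          exact ⟨_, rfl, hnd, rfl⟩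
        · simp only [Function.update_of_ne e]
          exact hY i (by omega)
  obtain ⟨T, hT, b, z, hb, hz, hY⟩ := key I.n le_rfl
  have hdata : ∀ i < I.n, ∃ Y : List ℕ, I.table b z i = (fun s => Y.getD s 0) ∧ Y.Nodup ∧
      Y.toFinset = T i ∧ Y.length = I.k := by
    intro i hi
    obtain ⟨Y, e, h₁, h₂⟩ := hY i hi
    refine ⟨Y, funext fun s => by rw [table, e], h₁, h₂, ?_⟩
    rw [← List.toFinset_card_of_nodup h₁, h₂, hT.card i hi]
  have hinj : ∀ i < I.n, Set.InjOn (I.table b z i) (Finset.range I.k : Set ℕ) := by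
    intro i hi s hs s' hs' e
    obtain ⟨Y, e', h₁, h₂, h₃⟩ := hdata i hi
    simp only [Finset.coe_range, Set.mem_Iio] at hs hs'
    simp only [e'] at e
    rw [List.getD_eq_getElem _ _ (by omega), List.getD_eq_getElem _ _ (by omega)] at e
    exact h₁.getElem_inj_iff.1 e
  have himg : ∀ i < I.n, (Finset.range I.k).image (I.table b z i) = T i := by
    intro i hi
    obtain ⟨Y, e', h₁, h₂, h₃⟩ := hdata i hi
    refine Finset.eq_of_subset_of_card_le (fun x hx => ?_) ?_
    · obtain ⟨s, hs, rfl⟩ := Finset.mem_image.1 hx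
      rw [Finset.mem_range] at hs
      simp only [e']
      rw [← h₂, List.mem_toFinset, List.getD_eq_getElem _ _ (by omega)]
      exact List.getElem_mem _
    · rw [Finset.card_image_of_injOn (hinj i hi), Finset.card_range, hT.card i hi]
  have hcount : ∀ d, I.count (I.table b z) d =
      ((Finset.range I.n).filter fun i => d ∈ T i).card := by
    intro d
    rw [count, Finset.card_filter]
    refine Finset.sum_congr rfl fun i hi => ?_
    rw [Finset.mem_range] at hi
    rw [← himg i hi, ← Finset.sum_image (f := fun x => if x = d then 1 else 0) (hinj i hi)]
    exact Finset.sum_ite_eq' _ _ _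
  refine ⟨b, z, hb, hz, ⟨fun i hi s hs => ?_, fun i hi s hs s' hs' hne e => hne ?_, fun d _ => ?_,
    ?_⟩⟩
  · refine Finset.mem_range.1 (hT.subset i hi ?_)
    rw [← himg i hi]
    exact Finset.mem_image.2 ⟨s, Finset.mem_range.2 hs, rfl⟩
  · exact hinj i hi (by simpa using hs) (by simpa using hs') e
  · rw [hcount, hcount]; exact hT.winner d
  · refine le_trans (le_of_eq (Finset.sum_congr rfl fun i hi => ?_)) hT.cost
    rw [Finset.mem_range] at hi
    rw [weight_eq_setWeight (hinj i hi), himg i hi]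

end SwapBribery

/-! ### Derived terms, frames and cost bounds -/

namespace Bounded

variable {x : List ℕ} {ν : ℕ → ℕ} {s s' : State}

namespace Term

/-- The term has a nonzero value. -/
def Holds (x : List ℕ) (ν : ℕ → ℕ) (e : Term) (s : State) : Prop := e.eval x ν s ≠ 0

instance (e : Term) : Decidable (e.Holds x ν s) := inferInstanceAs (Decidable (_ ≠ _))

/-- Negation. -/
def not (e : Term) : Term := ite e (lit 0) (lit 1)
/-- Conjunction. -/
def and (e f : Term) : Term := ite e f (lit 0)
/-- Implication. -/
def imp (e f : Term) : Term := ite e f (lit 1)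
/-- Strict comparison. -/
def lt (e f : Term) : Term := sub f e
/-- Weak comparison. -/
def le (e f : Term) : Term := not (lt f e)
/-- Equality. -/
def eq (e f : Term) : Term := sub (lit 1) (add (sub e f) (sub f e))
/-- Inequality. -/
def ne (e f : Term) : Term := add (sub e f) (sub f e)
/-- Bounded universal quantification. -/
def all (y p : ℕ) (e : Term) : Term := not (sum y p (not e))

variable {e f c : Term} {y p : ℕ} {j : Fin 16}

@[simp] theorem eval_lit {c : ℕ} : (lit c).eval x ν s = c := rfl
@[simp] theorem eval_par : (par p).eval x ν s = ν p := rfl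
@[simp] theorem eval_var : (var y).eval x ν s = s.var y := rfl
@[simp] theorem eval_inp : (inp e).eval x ν s = x.getD (e.eval x ν s) 0 := rfl
@[simp] theorem eval_arr : (arr j e).eval x ν s = s.arr j (e.eval x ν s) := rfl
@[simp] theorem eval_add : (add e f).eval x ν s = e.eval x ν s + f.eval x ν s := rfl
@[simp] theorem eval_sub : (sub e f).eval x ν s = e.eval x ν s - f.eval x ν s := rfl
@[simp] theorem eval_ite : (ite c e f).eval x ν s =
    if c.Holds x ν s then e.eval x ν s else f.eval x ν s := rfl
@[simp] theorem eval_sum : (sum y p e).eval x ν s =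
    ∑ i ∈ Finset.range (ν p), e.eval x ν (s.setVar y i) := rfl

@[simp] theorem holds_var : (var y).Holds x ν s ↔ s.var y ≠ 0 := Iff.rfl
@[simp] theorem holds_arr : (arr j e).Holds x ν s ↔ s.arr j (e.eval x ν s) ≠ 0 := Iff.rfl
@[simp] theorem holds_not : (not e).Holds x ν s ↔ ¬ e.Holds x ν s := by
  by_cases h : e.eval x ν s = 0 <;> simp [not, Holds, h]
@[simp] theorem holds_and : (and e f).Holds x ν s ↔ e.Holds x ν s ∧ f.Holds x ν s := by
  by_cases h : e.eval x ν s = 0 <;> simp [and, Holds, h]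
@[simp] theorem holds_imp : (imp e f).Holds x ν s ↔ (e.Holds x ν s → f.Holds x ν s) := by
  by_cases h : e.eval x ν s = 0 <;> simp [imp, Holds, h]
@[simp] theorem holds_lt : (lt e f).Holds x ν s ↔ e.eval x ν s < f.eval x ν s := by
  simp [lt, Holds, Nat.sub_eq_zero_iff_le]
@[simp] theorem holds_le : (le e f).Holds x ν s ↔ e.eval x ν s ≤ f.eval x ν s := by
  simp [le]
@[simp] theorem holds_eq : (eq e f).Holds x ν s ↔ e.eval x ν s = f.eval x ν s := by
  simp only [Holds, eq, eval_sub, eval_add, eval_lit]; omega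
@[simp] theorem holds_ne : (ne e f).Holds x ν s ↔ e.eval x ν s ≠ f.eval x ν s := by
  simp only [Holds, ne, eval_sub, eval_add]; omega
@[simp] theorem holds_all :
    (all y p e).Holds x ν s ↔ ∀ i < ν p, e.Holds x ν (s.setVar y i) := by
  have : (sum y p (not e)).Holds x ν s ↔ ∃ i < ν p, (not e).Holds x ν (s.setVar y i) := by
    simp [Holds]
  rw [all, holds_not, this]
  simp

end Term

theorem iter_induction {f : ℕ → State → State} {N : ℕ} (J : ℕ → State → Prop) (h₀ : J 0 s)
    (h : ∀ i < N, ∀ s, J i s → J (i + 1) (f i s)) : J N (iter f N s) := by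
  induction N with
  | zero => exact h₀
  | succ N ih => exact h N (Nat.lt_succ_self N) _ (ih fun i hi => h i (by omega))

namespace Cmd

variable {c d : Cmd} {e f : Term} {y p : ℕ} {j : Fin 16}

@[simp] theorem exec_set : (set y e).exec x ν s = s.setVar y (e.eval x ν s) := rfl
@[simp] theorem exec_put :
    (put j e f).exec x ν s = s.putArr j (e.eval x ν s) (f.eval x ν s) := rfl
@[simp] theorem exec_emit : (emit e).exec x ν s = s.emit (e.eval x ν s) := rfl
@[simp] theorem exec_seq : (seq c d).exec x ν s = d.exec x ν (c.exec x ν s) := rfl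
@[simp] theorem exec_cond : (cond e c d).exec x ν s =
    if e.Holds x ν s then c.exec x ν s else d.exec x ν s := rfl
@[simp] theorem exec_skip : skip.exec x ν s = s := rfl

theorem loop_induction (J : ℕ → State → Prop) (h₀ : J 0 s)
    (h : ∀ i < ν p, ∀ s, J i s → J (i + 1) (c.exec x ν (s.setVar y i))) :
    J (ν p) ((loop y p c).exec x ν s) := iter_induction J h₀ h

/-- The variables to which a command assigns. -/
def vars : Cmd → List ℕ
  | set y _ => [y]
  | put _ _ _ => []
  | emit _ => []
  | seq c d => c.vars ++ d.vars
  | cond _ c d => c.vars ++ d.vars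
  | loop y _ c => y :: c.vars
  | skip => []

/-- The arrays to which a command assigns. -/
def arrs : Cmd → List (Fin 16)
  | set _ _ => []
  | put j _ _ => [j]
  | emit _ => []
  | seq c d => c.arrs ++ d.arrs
  | cond _ c d => c.arrs ++ d.arrs
  | loop _ _ c => c.arrs
  | skip => []

/-- The command writes nothing to the output. -/
def silent : Cmd → Bool
  | emit _ => false
  | seq c d => c.silent && d.silent
  | cond _ c d => c.silent && d.silent
  | loop _ _ c => c.silent
  | _ => true

theorem exec_var (c : Cmd) {y : ℕ} (h : y ∉ c.vars) (s : State) :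
    (c.exec x ν s).var y = s.var y := by
  induction c generalizing s with
  | set z e => simp only [vars, List.mem_singleton] at h; simp [h]
  | put j e f => rfl
  | emit e => rfl
  | seq c d ihc ihd =>
    simp only [vars, List.mem_append, not_or] at h
    rw [exec_seq, ihd h.2, ihc h.1]
  | cond e c d ihc ihd =>
    simp only [vars, List.mem_append, not_or] at h
    rw [exec_cond]
    split_ifs
    · exact ihc h.1 s
    · exact ihd h.2 s
  | loop z p c ih =>
    simp only [vars, List.mem_cons, not_or] at h
    refine loop_induction (fun _ s' => s'.var y = s.var y) rfl fun i _ s' hs' => ?_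
    rw [ih h.2, State.setVar_var, if_neg h.1, hs']
  | skip => rfl

theorem exec_arr (c : Cmd) {j : Fin 16} (h : j ∉ c.arrs) (s : State) :
    (c.exec x ν s).arr j = s.arr j := by
  induction c generalizing s with
  | set z e => rfl
  | put j' e f =>
    simp only [arrs, List.mem_singleton] at h
    funext i
    simp [h]
  | emit e => rfl
  | seq c d ihc ihd =>
    simp only [arrs, List.mem_append, not_or] at h
    rw [exec_seq, ihd h.2, ihc h.1]
  | cond e c d ihc ihd =>
    simp only [arrs, List.mem_append, not_or] at h
    rw [exec_cond]
    split_ifs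
    · exact ihc h.1 s
    · exact ihd h.2 s
  | loop z p c ih =>
    refine loop_induction (fun _ s' => s'.arr j = s.arr j) rfl fun i _ s' hs' => ?_
    rw [ih h, State.setVar_arr, hs']
  | skip => rfl

theorem exec_out (c : Cmd) (h : c.silent = true) (s : State) :
    (c.exec x ν s).out = s.out := by
  induction c generalizing s with
  | set z e => rfl
  | put j' e f => rfl
  | emit e => simp [silent] at h
  | seq c d ihc ihd =>
    simp only [silent, Bool.and_eq_true] at h
    rw [exec_seq, ihd h.2, ihc h.1]
  | cond e c d ihc ihd =>
    simp only [silent, Bool.and_eq_true] at h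
    rw [exec_cond]
    split_ifs
    · exact ihc h.1 s
    · exact ihd h.2 s
  | loop z p c ih =>
    refine loop_induction (fun _ s' => s'.out = s.out) rfl fun i _ s' hs' => ?_
    rw [ih h, State.setVar_out, hs']
  | skip => rfl

end Cmd

/-- The constant in the bound on the cost of a term. -/
def Term.coeff : Term → ℕ
  | lit _ => 1
  | par _ => 3
  | var _ => 3
  | inp e => e.coeff + 2
  | arr _ e => e.coeff + 14
  | add e f => e.coeff + f.coeff + 3
  | sub e f => e.coeff + f.coeff + 3
  | ite c e f => c.coeff + e.coeff + f.coeff + 2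
  | sum _ _ e => e.coeff + 30

/-- The largest number of nested iterations in the evaluation of a term. -/
def Term.depth (ν : ℕ → ℕ) : Term → ℕ
  | lit _ => 1
  | par _ => 1
  | var _ => 1
  | inp e => e.depth ν
  | arr _ e => e.depth ν
  | add e f => max (e.depth ν) (f.depth ν)
  | sub e f => max (e.depth ν) (f.depth ν)
  | ite c e f => max (c.depth ν) (max (e.depth ν) (f.depth ν))
  | sum _ p e => max 1 (ν p) * e.depth ν

/-- The constant in the bound on the cost of a command. -/
def Cmd.coeff : Cmd → ℕ
  | set _ e => e.coeff + 4
  | put _ e f => e.coeff + f.coeff + 16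
  | emit e => e.coeff + 2
  | seq c d => c.coeff + d.coeff + 1
  | cond e c d => e.coeff + c.coeff + d.coeff + 2
  | loop _ _ c => c.coeff + 30
  | skip => 1

/-- The largest number of nested iterations in the execution of a command. -/
def Cmd.depth (ν : ℕ → ℕ) : Cmd → ℕ
  | set _ e => e.depth ν
  | put _ e f => max (e.depth ν) (f.depth ν)
  | emit e => e.depth ν
  | seq c d => max (c.depth ν) (d.depth ν)
  | cond e c d => max (e.depth ν) (max (c.depth ν) (d.depth ν))
  | loop _ p c => max 1 (ν p) * c.depth ν
  | skip => 1

theorem Term.one_le_depth (e : Term) : 1 ≤ e.depth ν := by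
  induction e with
  | sum y p e ih => exact Nat.mul_pos (by omega) ih
  | _ => simp only [depth]; omega

theorem Cmd.one_le_depth (c : Cmd) : 1 ≤ c.depth ν := by
  induction c with
  | loop y p c ih => exact Nat.mul_pos (by omega) ih
  | set y e => exact e.one_le_depth
  | emit e => exact e.one_le_depth
  | put j e f => exact le_max_of_le_left e.one_le_depth
  | skip => exact le_rfl
  | _ => simp only [depth]; omega

theorem add_le_mul_max {a b u v A B r : ℕ} (h₁ : a ≤ u * A) (h₂ : b ≤ v * B) (hA : 1 ≤ A) :
    a + b + r ≤ (u + v + r) * max A B := by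
  have e₁ : u * A ≤ u * max A B := Nat.mul_le_mul_left _ (le_max_left _ _)
  have e₂ : v * B ≤ v * max A B := Nat.mul_le_mul_left _ (le_max_right _ _)
  have e₃ : r ≤ r * max A B := Nat.le_mul_of_pos_right _ (by omega)
  rw [Nat.add_mul, Nat.add_mul]
  omega

theorem add_le_mul_self {a u A r : ℕ} (h₁ : a ≤ u * A) (hA : 1 ≤ A) :
    a + r ≤ (u + r) * A := by
  have e₃ : r ≤ r * A := Nat.le_mul_of_pos_right _ hA
  rw [Nat.add_mul]
  omega

/-- The constant is `30 = 11 + 19`. An empty loop still costs its overhead, hence `max 1 q`. -/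
theorem loop_le_mul {a u A q : ℕ} (h : a ≤ u * A) (hA : 1 ≤ A) :
    q * (a + 11) + 19 ≤ (u + 30) * (max 1 q * A) := by
  have hq : q ≤ max 1 q := le_max_right _ _
  have h1 : 1 ≤ max 1 q := le_max_left _ _
  calc q * (a + 11) + 19 ≤ max 1 q * (u * A + 11 * A) + 19 * (max 1 q * A) := by
        refine Nat.add_le_add (Nat.mul_le_mul hq (by omega)) ?_
        exact Nat.le_mul_of_pos_right _ (Nat.mul_pos h1 hA)
    _ = (u + 30) * (max 1 q * A) := by ring

theorem Term.cost_le (e : Term) : e.cost ν ≤ e.coeff * e.depth ν := by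
  induction e with
  | lit c => simp [cost, coeff, depth]
  | par c => simp [cost, coeff, depth]
  | var c => simp [cost, coeff, depth]
  | inp e ih => exact add_le_mul_self ih e.one_le_depth
  | arr j e ih => exact add_le_mul_self ih e.one_le_depth
  | add e f ihe ihf => exact add_le_mul_max ihe ihf e.one_le_depth
  | sub e f ihe ihf => exact add_le_mul_max ihe ihf e.one_le_depth
  | ite c e f ihc ihe ihf =>
    have := add_le_mul_max (r := 0) ihe ihf e.one_le_depth
    have := add_le_mul_max (r := 2) ihc this c.one_le_depth
    simp only [cost, coeff, depth]
    calc _ = c.cost ν + (e.cost ν + f.cost ν + 0) + 2 := by ring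
      _ ≤ _ := this
      _ = _ := by ring
  | sum y p e ih => exact loop_le_mul ih e.one_le_depth

/-- `coeff` does not depend on the parameters, so the whole growth is in `depth`, which takes maxima
over sequences and products over nested loops. -/
theorem Cmd.cost_le (c : Cmd) : c.cost ν ≤ c.coeff * c.depth ν := by
  induction c with
  | set y e => exact add_le_mul_self e.cost_le e.one_le_depth
  | emit e => exact add_le_mul_self e.cost_le e.one_le_depth
  | put j e f => exact add_le_mul_max e.cost_le f.cost_le e.one_le_depth
  | seq c d ihc ihd => exact add_le_mul_max ihc ihd c.one_le_depth
  | cond e c d ihc ihd =>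
    have := add_le_mul_max (r := 0) ihc ihd c.one_le_depth
    have := add_le_mul_max (r := 2) (e.cost_le (ν := ν)) this e.one_le_depth
    simp only [cost, coeff, depth]
    calc _ = e.cost ν + (c.cost ν + d.cost ν + 0) + 2 := by ring
      _ ≤ _ := this
      _ = _ := by ring
  | loop y p c ih => exact loop_le_mul ih c.one_le_depth
  | skip => simp [cost, coeff, depth]

end Bounded

/-! ### The program -/

namespace Bounded

open Representatives

/-- The array of the bits that say where the preferred candidate is approved. -/
abbrev aBit : Fin 16 := 0
/-- The array of the other choices. -/
abbrev aChoice : Fin 16 := 1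
/-- The current tuple of candidates. -/
abbrev aTuple : Fin 16 := 2
/-- The cheapest tuple so far. -/
abbrev aBest : Fin 16 := 3
/-- The pool of candidates. -/
abbrev aPool : Fin 16 := 4
/-- The table of approved candidates. -/
abbrev aTable : Fin 16 := 5
/-- The multiples of `k`. -/
abbrev aMulK : Fin 16 := 6
/-- The multiples of `m`. -/
abbrev aMulM : Fin 16 := 7
/-- The multiples of `m * m`. -/
abbrev aMulMM : Fin 16 := 8
/-- The ranks. -/
abbrev aRank : Fin 16 := 9

/-- The number of votes. -/
abbrev pN : ℕ := 0
/-- The number of candidates. -/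
abbrev pM : ℕ := 1
/-- The number of approved candidates in each vote. -/
abbrev pK : ℕ := 2
/-- The preferred candidate. -/
abbrev pPref : ℕ := 3
/-- The budget. -/
abbrev pBudget : ℕ := 4
/-- The number of places in the table. -/
abbrev pPlaces : ℕ := 5
/-- The number of cheapest tuples in the pool. -/
abbrev pQ : ℕ := 6
/-- The number of entries of the pool. -/
abbrev pR : ℕ := 7
/-- The number of bit vectors. -/
abbrev pBits : ℕ := 8
/-- The number of tuples. -/
abbrev pTuples : ℕ := 9
/-- The number of vectors of choices. -/
abbrev pChoices : ℕ := 10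
/-- The position of the prices in the input. -/
abbrev pBase : ℕ := 11

/-- The current vote. -/
abbrev vI : ℕ := 1
/-- The current place in the vote. -/
abbrev vJ : ℕ := 2
/-- A running place. -/
abbrev vS : ℕ := 5
/-- Whether a tuple has been found. -/
abbrev vFound : ℕ := 7
/-- The cost of the cheapest tuple so far. -/
abbrev vCost : ℕ := 8
/-- The length of the pool. -/
abbrev vLen : ℕ := 9
/-- The carry of a counter. -/
abbrev vCarry : ℕ := 10
/-- Whether a solution has been written. -/
abbrev vDone : ℕ := 11
/-- A running candidate. -/
abbrev vA : ℕ := 14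

/-- Add one to the number with the digits `arr j`, with `par q` places in base `par p`. -/
def incr (j : Fin 16) (p q : ℕ) : Cmd :=
  .seq (.set vCarry (.lit 1)) <| .loop vS q <| .cond (.var vCarry)
    (.seq (.put j (.var vS) (.add (.arr j (.var vS)) (.lit 1)))
      (.cond (.eq (.arr j (.var vS)) (.par p)) (.put j (.var vS) (.lit 0))
        (.set vCarry (.lit 0)))) .skip

/-- The rank of a candidate in a vote. -/
def rankT (i a : Term) : Term := .arr aRank (.add (.arr aMulM i) a)

/-- The price of a swap. -/
def priceT (i a b : Term) : Term :=
  .inp (.add (.par pBase) (.add (.arr aMulMM i) (.add (.arr aMulM a) b)))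

/-- The candidate `a` has to be swapped with the entry `b` of the tuple `τ`. -/
def crossT (i a b : Term) (τ : Term → Term) : Term :=
  .and (.lt (rankT i a) (rankT i b)) (.all 22 pK (.ne (τ (.var 22)) a))

/-- The cost of bringing the entries of the tuple `τ` to the top of a vote. -/
def weightT (i : Term) (τ : Term → Term) : Term :=
  .sum 20 pK <| .sum 21 pM <|
    .ite (crossT i (.var 21) (τ (.var 20)) τ) (priceT i (.var 21) (τ (.var 20))) (.lit 0)

/-- An entry of the current tuple. -/
def tupleT (s : Term) : Term := .arr aTuple s

/-- An entry of the table. -/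
def tableT (i s : Term) : Term := .arr aTable (.add (.arr aMulK i) s)

/-- The current tuple fits. -/
def fitsT : Term :=
  .and (.all 20 pK (.imp (.lt (.var 20) (.var vJ))
    (.eq (tupleT (.var 20)) (tableT (.var vI) (.var 20))))) <|
  -- Only a parameter can bound the quantifier; the test against `vLen` discards stale entries
  -- beyond the current pool.
  .and (.all 20 pK (.imp (.le (.var vJ) (.var 20)) (.all 21 pR (.imp (.lt (.var 21) (.var vLen))
    (.ne (.arr aPool (.var 21)) (tupleT (.var 20))))))) <|
  .and (.all 20 pK (.all 21 pK (.imp (.ne (.var 20) (.var 21))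
    (.ne (tupleT (.var 20)) (tupleT (.var 21)))))) <|
  .imp (.eq (.arr aBit (.var vI)) (.lit 0)) (.all 20 pK (.ne (tupleT (.var 20)) (.par pPref)))

/-- Keep the current tuple if it fits and is cheaper than the cheapest one so far. -/
def tryTuple : Cmd :=
  .cond (.and fitsT (.imp (.var vFound) (.lt (weightT (.var vI) tupleT) (.var vCost))))
    (.seq (.set vFound (.lit 1)) <| .seq (.set vCost (weightT (.var vI) tupleT)) <|
      .loop vS pK (.put aBest (.var vS) (tupleT (.var vS)))) .skip

/-- Find a cheapest tuple that fits. -/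
def search : Cmd :=
  -- The tuple needs no reset: after `m ^ k` increments the counter is back at zero.
  .seq (.set vFound (.lit 0)) <| .loop 4 pTuples <| .seq tryTuple (incr aTuple pM pK)

/-- Append the new entries of the cheapest tuple to the pool. -/
def appendPool : Cmd :=
  .cond (.var vFound)
    (.loop vS pK <| .cond (.le (.var vJ) (.var vS))
      (.seq (.put aPool (.var vLen) (.arr aBest (.var vS)))
        (.set vLen (.add (.var vLen) (.lit 1)))) .skip) .skip

/-- Fill the pool. -/
def fillPool : Cmd :=
  .seq (.set vLen (.lit 0)) <| .loop 3 pQ <| .seq search appendPool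

/-- The place of the current entry of the table. -/
def placeT : Term := .add (.arr aMulK (.var vI)) (.var vJ)

/-- Determine the current entry of the table. -/
def chooseEntry : Cmd :=
  .cond (.and (.eq (.var vJ) (.lit 0)) (.arr aBit (.var vI)))
    (.put aTable placeT (.par pPref))
    (.seq fillPool <| .put aTable placeT <|
      -- The default `0` agrees with the `getD` in `next`.
      .ite (.lt (.arr aChoice placeT) (.var vLen)) (.arr aPool (.arr aChoice placeT)) (.lit 0))

/-- Determine the table. -/
def fillTable : Cmd := .loop vI pN <| .loop vJ pK chooseEntry

/-- The number of places in which the candidate `d` stands. -/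
def countT (d : Term) : Term :=
  .sum 20 pN <| .sum 21 pK <| .ite (.eq (tableT (.var 20) (.var 21)) d) (.lit 1) (.lit 0)

/-- The table describes a solution. -/
def validT : Term :=
  .and (.all 20 pN (.all 21 pK (.lt (tableT (.var 20) (.var 21)) (.par pM)))) <|
  .and (.all 20 pN (.all 21 pK (.all 22 pK (.imp (.ne (.var 21) (.var 22))
    (.ne (tableT (.var 20) (.var 21)) (tableT (.var 20) (.var 22))))))) <|
  .and (.all 23 pM (.le (countT (.var 23)) (countT (.par pPref)))) <|
  .le (.sum 24 pN (weightT (.var 24) (tableT (.var 24)))) (.par pBudget)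

/-- Write the swaps for the table. -/
def emitSwaps : Cmd :=
  .loop vI pN <| .loop vS pK <| .loop vA pM <|
    .cond (crossT (.var vI) (.var vA) (tableT (.var vI) (.var vS)) (tableT (.var vI)))
      (.seq (.emit (.var vI)) <| .seq (.emit (.var vA)) <|
        .emit (tableT (.var vI) (.var vS))) .skip

/-- Compute the multiples and the ranks. -/
def prepareTables : Cmd :=
  .seq (.loop vI pN <| .seq (.put aMulK (.var vI) (.sum 20 pK (.var vI))) <|
    .put aMulMM (.var vI) (.sum 20 pM (.sum 21 pM (.var vI)))) <|
  -- The multiples of `m` are needed both for votes and for candidates, so both ranges are filled;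
  -- where they overlap the entries agree.
  .seq (.loop vI pN <| .put aMulM (.var vI) (.sum 20 pM (.var vI))) <|
  .seq (.loop vA pM <| .put aMulM (.var vA) (.sum 20 pM (.var vA))) <|
  .loop vI pN <| .loop vA pM <|
    -- The input lists candidates by rank; storing the rank at the place of the candidate inverts
    -- this permutation.
    .put aRank (.add (.arr aMulM (.var vI))
      (.inp (.add (.lit 5) (.add (.arr aMulM (.var vI)) (.var vA))))) (.var vA)

/-- Write the solution for the current choices, if it is the first one. -/
def tryTable : Cmd :=
  .seq fillTable <| .cond (.and (.eq (.var vDone) (.lit 0)) validT)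
    (.seq (.emit (.lit 1)) <| .seq emitSwaps <| .set vDone (.lit 1)) .skip

/-- Try all choices. -/
def tryAll : Cmd :=
  .loop 12 pBits <| .seq (.loop 13 pChoices (.seq tryTable (incr aChoice pR pPlaces)))
    -- Here `12` is the parameter with value two, the base of the bits; it is independent of the
    -- loop variable `12`.
    (incr aBit 12 pN)

/-- The main part of the program. -/
def mainCmd : Cmd :=
  .seq prepareTables <| .seq tryAll <| .cond (.var vDone) .skip (.emit (.lit 0))

/-- The computation of the parameters. -/
def parameters : List (Cmd × ℕ × ℕ) :=
  [(.set 0 (.inp (.lit 0)), pN, 0), (.set 0 (.inp (.lit 1)), pM, 0),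
   (.set 0 (.inp (.lit 2)), pK, 0), (.set 0 (.inp (.lit 3)), pPref, 0),
   (.set 0 (.inp (.lit 4)), pBudget, 0), (.set 0 (.sum 20 pN (.par pK)), pPlaces, 0),
   -- `n * k - k + 1` equals `(n - 1) * k + 1` also under truncated subtraction.
   (.set 0 (.add (.sub (.par pPlaces) (.par pK)) (.lit 1)), pQ, 0),
   (.set 0 (.sum 20 pQ (.par pK)), pR, 0),
   (.seq (.set 0 (.lit 1)) (.loop 1 pN (.set 0 (.add (.var 0) (.var 0)))), pBits, 0),
   (.seq (.set 0 (.lit 1)) (.loop 1 pK (.set 0 (.sum 20 pM (.var 0)))), pTuples, 0),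
   (.seq (.set 0 (.lit 1)) (.loop 1 pPlaces (.set 0 (.sum 20 pR (.var 0)))), pChoices, 0),
   (.set 0 (.add (.lit 5) (.sum 20 pN (.par pM))), pBase, 0),
   (.set 0 (.lit 2), 12, 0)]

/-! ### Its parts -/

/-- The parameters have the intended values. -/
structure Params (I : SwapBribery) (ν : ℕ → ℕ) : Prop where
  n : ν pN = I.n
  m : ν pM = I.m
  k : ν pK = I.k
  pref : ν pPref = I.preferred
  budget : ν pBudget = I.budget
  places : ν pPlaces = I.n * I.k
  q : ν pQ = (I.n - 1) * I.k + 1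
  r : ν pR = ((I.n - 1) * I.k + 1) * I.k
  bits : ν pBits = 2 ^ I.n
  tuples : ν pTuples = I.m ^ I.k
  choices : ν pChoices = (((I.n - 1) * I.k + 1) * I.k) ^ (I.n * I.k)
  base : ν pBase = 5 + I.n * I.m
  two : ν 12 = 2

section
variable {x : List ℕ} {ν : ℕ → ℕ} {s : State} {I : SwapBribery}

/-- A carry reaches place `q` exactly if `r ^ q` divides the new number. -/
theorem digit_succ {r t q : ℕ} :
    digit r (t + 1) q = if r ^ q ∣ t + 1 then (digit r t q + 1) % r else digit r t q := by
  simp only [digit]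
  rw [Nat.succ_div]
  split_ifs
  · rw [Nat.mod_add_mod]
  · rfl

theorem pow_succ_dvd_iff {r t q : ℕ} (hr : 0 < r) :
    r ^ (q + 1) ∣ t + 1 ↔ r ^ q ∣ t + 1 ∧ digit r (t + 1) q = 0 := by
  constructor
  · intro h
    refine ⟨(pow_dvd_pow r (Nat.le_succ q)).trans h, ?_⟩
    obtain ⟨u, hu⟩ := h
    rw [digit, hu, pow_succ, mul_assoc, Nat.mul_div_cancel_left _ (by positivity)]
    exact Nat.mul_mod_right _ _
  · rintro ⟨⟨u, hu⟩, h⟩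
    rw [digit, hu, Nat.mul_div_cancel_left _ (by positivity)] at h
    obtain ⟨v, rfl⟩ := Nat.dvd_of_mod_eq_zero h
    exact ⟨v, by rw [hu, pow_succ, mul_assoc]⟩

theorem digit_zero {r q : ℕ} : digit r 0 q = 0 := by simp [digit]

/-- A full cycle brings a counter with `N` places back to zero, which makes the nested enumerations
restart by themselves. -/
theorem digit_pow {r q N : ℕ} (hr : 0 < r) (hq : q < N) : digit r (r ^ N) q = 0 := by
  rw [digit, Nat.pow_div hq.le hr]
  obtain ⟨d, rfl⟩ := Nat.exists_eq_add_of_lt hq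
  rw [show q + d + 1 - q = d + 1 by omega, pow_succ]
  exact Nat.mul_mod_left _ _

theorem exec_incr {j : Fin 16} {p q t : ℕ} (hr : 0 < ν p)
    (h : ∀ i < ν q, s.arr j i = digit (ν p) t i) :
    ∀ i < ν q, ((incr j p q).exec x ν s).arr j i = digit (ν p) (t + 1) i := by
  set r := ν p with hrdef
  have key := Cmd.loop_induction (x := x) (ν := ν) (y := vS) (p := q)
    (s := s.setVar vCarry 1)
    (c := .cond (.var vCarry)
      (.seq (.put j (.var vS) (.add (.arr j (.var vS)) (.lit 1)))
        (.cond (.eq (.arr j (.var vS)) (.par p)) (.put j (.var vS) (.lit 0))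
          (.set vCarry (.lit 0)))) .skip)
    -- The places below `a` are up to date, and the carry into place `a` is expressed by
    -- divisibility.
    (fun a s' => (s'.var vCarry ≠ 0 ↔ r ^ a ∣ t + 1) ∧
      (∀ i < ν q, s'.arr j i = if i < a then digit r (t + 1) i else digit r t i))
    ⟨by simp, fun i hi => by simp [h i hi]⟩
    (by
      rintro a ha s' ⟨hc, hd⟩
      have hda := hd a ha
      rw [if_neg (lt_irrefl a)] at hda
      have hlt : digit r t a < r := digit_lt hr _ _
      have hdvd := pow_succ_dvd_iff (t := t) (q := a) hr
      have hsucc := digit_succ (r := r) (t := t) (q := a)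
      simp only [Cmd.exec_cond, Term.holds_var, State.setVar_var]
      rw [if_neg (show vCarry ≠ vS by decide)]
      by_cases hcar : s'.var vCarry = 0
      · have hn : ¬ r ^ a ∣ t + 1 := fun h => (hc.2 h) hcar
        rw [if_neg (by simpa using hcar)]
        rw [if_neg hn] at hsucc
        refine ⟨?_, fun i hi => ?_⟩
        · rw [hdvd]
          simp [hcar, hn]
        · simp only [Cmd.exec_skip, State.setVar_arr, hd i hi]
          rcases lt_trichotomy i a with hia | rfl | hia
          · rw [if_pos hia, if_pos (by omega)]
          · rw [if_neg (by omega), if_pos (by omega), hsucc]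
          · rw [if_neg (by omega), if_neg (by omega)]
      · have hn : r ^ a ∣ t + 1 := hc.1 hcar
        rw [if_pos (by simpa using hcar)]
        rw [if_pos hn] at hsucc
        simp only [Cmd.exec_seq, Cmd.exec_put, Cmd.exec_cond, Term.eval_var, Term.eval_add,
          Term.eval_arr, Term.eval_lit, Term.holds_eq, State.putArr_var, State.putArr_arr,
          State.setVar_var, State.setVar_arr, Term.eval_par, if_true, true_and, hda, ← hrdef]
        split_ifs with hfull
        · rw [hfull, Nat.mod_self] at hsucc
          refine ⟨?_, fun i hi => ?_⟩
          · rw [hdvd]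
            simp [hn, hsucc, hcar, vCarry, vS]
          · simp only [State.putArr_arr, State.setVar_arr, true_and, hd i hi]
            rcases lt_trichotomy i a with hia | rfl | hia
            · rw [if_neg (by omega), if_neg (by omega), if_pos hia, if_pos (by omega)]
            · rw [if_pos rfl, if_pos (by omega), hsucc]
            · rw [if_neg (by omega), if_neg (by omega), if_neg (by omega), if_neg (by omega)]
        · rw [Nat.mod_eq_of_lt (by omega)] at hsucc
          refine ⟨?_, fun i hi => ?_⟩
          · rw [hdvd]
            simp [hsucc]
          · simp only [Cmd.exec_set, State.putArr_arr, State.setVar_arr, true_and, hd i hi]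
            rcases lt_trichotomy i a with hia | rfl | hia
            · rw [if_neg (by omega), if_pos hia, if_pos (by omega)]
            · rw [if_pos rfl, if_pos (by omega), hsucc]
            · rw [if_neg (by omega), if_neg (by omega), if_neg (by omega)])
  intro i hi
  have := key.2 i hi
  rwa [if_pos hi] at this

/-- The multiples and the ranks have been computed. -/
structure Tables (I : SwapBribery) (s : State) : Prop where
  mulK : ∀ i < I.n, s.arr aMulK i = i * I.k
  mulM : ∀ i < I.n, s.arr aMulM i = i * I.m
  mulM' : ∀ a < I.m, s.arr aMulM a = a * I.m
  mulMM : ∀ i < I.n, s.arr aMulMM i = i * (I.m * I.m)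
  rank : ∀ i < I.n, ∀ a < I.m, s.arr aRank (i * I.m + a) = I.rank i a

theorem Tables.congr {s' : State} (h : Tables I s) (e : ∀ j, 6 ≤ j → s'.arr j = s.arr j) :
    Tables I s' where
  mulK := by rw [e _ (by decide)]; exact h.mulK
  mulM := by rw [e _ (by decide)]; exact h.mulM
  mulM' := by rw [e _ (by decide)]; exact h.mulM'
  mulMM := by rw [e _ (by decide)]; exact h.mulMM
  rank := by rw [e _ (by decide)]; exact h.rank

theorem getD_flatMap {α : Type*} {l : List α} {f : α → List ℕ} {L i r : ℕ}
    (hf : ∀ a ∈ l, (f a).length = L) (hi : i < l.length) (hr : r < L) :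
    (l.flatMap f).getD (i * L + r) 0 = (f l[i]).getD r 0 := by
  induction l generalizing i with
  | nil => simp at hi
  | cons a l ih =>
    rw [List.flatMap_cons]
    have ha := hf a List.mem_cons_self
    cases i with
    | zero => rw [Nat.zero_mul, Nat.zero_add, List.getD_append _ _ _ _ (by omega)]; rfl
    | succ i =>
      have hle : (f a).length ≤ (i + 1) * L + r := by rw [ha, Nat.succ_mul]; omega
      rw [List.getD_append_right _ _ _ _ hle, ha,
        show (i + 1) * L + r - L = i * L + r by rw [Nat.succ_mul]; omega,
        ih (fun b hb => hf b (List.mem_cons_of_mem _ hb)) (by simpa using hi)]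
      rfl

theorem length_flatMap_const {α : Type*} {l : List α} {f : α → List ℕ} {L : ℕ}
    (hf : ∀ a ∈ l, (f a).length = L) : (l.flatMap f).length = l.length * L := by
  rw [List.length_flatMap, List.map_congr_left hf]
  simp

theorem encode_vote (i : Fin I.n) (r : Fin I.m) :
    I.encode.getD (5 + (i * I.m + r)) 0 = (I.votes i).symm r := by
  rw [SwapBribery.encode, List.append_assoc, List.getD_append_right _ _ _ _ (by simp),
    List.getD_append]
  · simp only [List.length_cons, List.length_nil]
    rw [show 5 + (↑i * I.m + ↑r) - (0 + 1 + 1 + 1 + 1 + 1) = i * I.m + r by omega,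
      getD_flatMap (by simp) (by simp) r.2]
    rw [List.getD_eq_getElem _ _ (by simp)]
    simp
  · rw [length_flatMap_const (L := I.m) (by simp)]
    simp only [List.length_cons, List.length_nil, List.length_finRange]
    have : (i + 1) * I.m ≤ I.n * I.m := Nat.mul_le_mul_right _ i.2
    rw [Nat.succ_mul] at this
    have := r.2
    omega

theorem encode_cost (i : Fin I.n) (a b : Fin I.m) :
    I.encode.getD (5 + I.n * I.m + (i * (I.m * I.m) + (a * I.m + b))) 0 = I.cost i a b := by
  have hlen : ((List.finRange I.n).flatMap fun i =>
      (List.finRange I.m).map fun r => ((I.votes i).symm r : ℕ)).length = I.n * I.m := by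
    rw [length_flatMap_const (L := I.m) (by simp), List.length_finRange]
  have hab : (a : ℕ) * I.m + b < I.m * I.m := by
    have : (a + 1) * I.m ≤ I.m * I.m := Nat.mul_le_mul_right _ a.2
    rw [Nat.succ_mul] at this
    have := b.2
    omega
  rw [SwapBribery.encode, List.getD_append_right]
  · rw [List.length_append, hlen]
    simp only [List.length_cons, List.length_nil]
    rw [show 5 + I.n * I.m + (↑i * (I.m * I.m) + (↑a * I.m + ↑b)) -
      (0 + 1 + 1 + 1 + 1 + 1 + I.n * I.m) = i * (I.m * I.m) + (a * I.m + b) by omega,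
      getD_flatMap (fun i _ => by rw [length_flatMap_const (L := I.m) (by simp)]; simp) (by simp)
        hab, getD_flatMap (by simp) (by simp) b.2, List.getD_eq_getElem _ _ (by simp)]
    simp
  · rw [List.length_append, hlen]
    simp only [List.length_cons, List.length_nil]
    omega
end
end Bounded

/-! ### Meaning of the terms -/

namespace Bounded

open Representatives

section
variable {ν : ℕ → ℕ} {s : State} {I : SwapBribery}

theorem eval_rankT {i a : Term} {x : List ℕ} (hT : Tables I s) (hi : i.eval x ν s < I.n)
    (ha : a.eval x ν s < I.m) :
    (rankT i a).eval x ν s = I.rank (i.eval x ν s) (a.eval x ν s) := by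
  simp only [rankT, Term.eval_arr, Term.eval_add, hT.mulM _ hi, hT.rank _ hi _ ha]

theorem eval_priceT {i a b : Term} (hp : Params I ν) (hT : Tables I s)
    (hi : i.eval I.encode ν s < I.n) (ha : a.eval I.encode ν s < I.m)
    (hb : b.eval I.encode ν s < I.m) :
    (priceT i a b).eval I.encode ν s =
      I.price (i.eval I.encode ν s) (a.eval I.encode ν s) (b.eval I.encode ν s) := by
  have := encode_cost (I := I) ⟨_, hi⟩ ⟨_, ha⟩ ⟨_, hb⟩
  simp only [priceT, Term.eval_inp, Term.eval_add, Term.eval_arr, Term.eval_par, hp.base,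
    hT.mulMM _ hi, hT.mulM' _ ha, this]
  rw [SwapBribery.price, dif_pos ⟨hi, ha, hb⟩]

/-- The term binds the variable 22, so `a` must not depend on it, and `τ` is described for every
value of it. -/
theorem holds_crossT {i a b : Term} {τ : Term → Term} {f : ℕ → ℕ} {x : List ℕ} (hp : Params I ν)
    (hT : Tables I s) (hi : i.eval x ν s < I.n) (ha : a.eval x ν s < I.m) (hb : b.eval x ν s < I.m)
    (ha' : ∀ z, a.eval x ν (s.setVar 22 z) = a.eval x ν s)
    (hτ : ∀ z, (τ (.var 22)).eval x ν (s.setVar 22 z) = f z) :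
    (crossT i a b τ).Holds x ν s ↔
      I.rank (i.eval x ν s) (a.eval x ν s) < I.rank (i.eval x ν s) (b.eval x ν s) ∧
        ∀ q < I.k, f q ≠ a.eval x ν s := by
  simp only [crossT, Term.holds_and, Term.holds_lt, eval_rankT hT hi ha, eval_rankT hT hi hb,
    Term.holds_all, Term.holds_ne, hp.k, hτ, ha']

/-- The vote must be held in a variable that the term does not bind. The entries must be candidates,
because the stored ranks and prices are meaningful only for these. -/
theorem eval_weightT {y : ℕ} {τ : Term → Term} {f : ℕ → ℕ} (hp : Params I ν) (hT : Tables I s)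
    (hy : y ≠ 20 ∧ y ≠ 21 ∧ y ≠ 22) (hi : s.var y < I.n)
    (hτ : ∀ (s' : State) (z : ℕ), s'.arr = s.arr → s'.var y = s.var y →
      (τ (.var z)).eval I.encode ν s' = f (s'.var z)) (hf : ∀ q < I.k, f q < I.m) :
    (weightT (.var y) τ).eval I.encode ν s =
      weight I.m I.k (I.rank (s.var y)) (I.price (s.var y)) f := by
  obtain ⟨h20, h21, h22⟩ := hy
  simp only [weightT, Term.eval_sum, weight, hp.k, hp.m]
  refine Finset.sum_congr rfl fun q hq => Finset.sum_congr rfl fun a ha => ?_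
  rw [Finset.mem_range] at hq ha
  set s' := (s.setVar 20 q).setVar 21 a with hs'
  have harr : s'.arr = s.arr := rfl
  have hvar : s'.var y = s.var y := by simp [hs', h20, h21]
  have hT' : Tables I s' := hT.congr fun _ _ => rfl
  have hb : (τ (.var 20)).eval I.encode ν s' = f q := by
    rw [hτ _ _ harr hvar]; simp [hs']
  have ha' : (Term.var 21).eval I.encode ν s' = a := by simp [hs']
  have hiv : (Term.var y).eval I.encode ν s' = s.var y := hvar
  have hb' : (τ (.var 20)).eval I.encode ν s' < I.m := by rw [hb]; exact hf q hq
  have hcross := holds_crossT (x := I.encode) (i := .var y) (a := .var 21) (b := τ (.var 20))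
    (τ := τ) (f := f) hp hT' (by rw [hiv]; exact hi) (by rw [ha']; exact ha) hb'
    (fun z => by simp [hs'])
    (fun z => by
      rw [hτ (s'.setVar 22 z) 22 rfl (by simp [hs', h20, h21, h22])]
      simp)
  have hprice := eval_priceT (i := .var y) (a := .var 21) (b := τ (.var 20)) hp hT'
    (by rw [hiv]; exact hi) (by rw [ha']; exact ha) hb'
  rw [hiv, ha', hb] at hcross hprice
  simp only [Term.eval_ite, Term.eval_lit, hcross, hprice]

theorem eval_tableT {i q : Term} {x : List ℕ} (hT : Tables I s) (hi : i.eval x ν s < I.n) :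
    (tableT i q).eval x ν s = s.arr aTable (i.eval x ν s * I.k + q.eval x ν s) := by
  simp only [tableT, Term.eval_arr, Term.eval_add, hT.mulK _ hi]

/-- The state in which the next entry of the table for the vote `i` is being determined, where `Y`
are the entries so far, `H` is the pool so far, and `b` is the bit for the vote. -/
structure Choosing (I : SwapBribery) (i b : ℕ) (Y H : List ℕ) (s : State) : Prop where
  tables : Tables I s
  vote : s.var vI = i
  vote_lt : i < I.n
  place : s.var vJ = Y.length
  bit : s.arr aBit i = b
  table : ∀ q < Y.length, s.arr aTable (i * I.k + q) = Y.getD q 0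
  len : s.var vLen = H.length
  len_le : H.length ≤ ((I.n - 1) * I.k + 1) * I.k
  pool : ∀ u < H.length, s.arr aPool u = H.getD u 0

theorem Choosing.congr {i b : ℕ} {Y H : List ℕ} {s' : State} (h : Choosing I i b Y H s)
    (ha : ∀ j, j ≠ aTuple → j ≠ aBest → s'.arr j = s.arr j)
    (hv : ∀ y ∈ [vI, vJ, vLen], s'.var y = s.var y) : Choosing I i b Y H s' where
  tables := h.tables.congr fun j hj => ha j (by rintro rfl; exact absurd hj (by decide))
    (by rintro rfl; exact absurd hj (by decide))
  vote := by rw [hv _ (by decide), h.vote]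
  vote_lt := h.vote_lt
  place := by rw [hv _ (by decide), h.place]
  bit := by rw [ha _ (by decide) (by decide), h.bit]
  table := by rw [ha _ (by decide) (by decide)]; exact h.table
  len := by rw [hv _ (by decide), h.len]
  len_le := h.len_le
  pool := by rw [ha _ (by decide) (by decide)]; exact h.pool

theorem holds_fitsT {i b : ℕ} {Y H : List ℕ} {τ : ℕ → ℕ} {x : List ℕ} (hp : Params I ν)
    (h : Choosing I i b Y H s) (hτ : ∀ q < I.k, s.arr aTuple q = τ q) :
    fitsT.Holds x ν s ↔ Fits I.k I.preferred b Y H τ := by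
  have htab : ∀ q, (tableT (.var vI) (.var 20)).eval x ν (s.setVar 20 q) =
      s.arr aTable (i * I.k + q) := by
    intro q
    have hT : Tables I (s.setVar 20 q) := h.tables.congr fun _ _ => rfl
    rw [eval_tableT hT]
    · simp [h.vote]
    · simpa [h.vote] using h.vote_lt
  have hR : ∀ u, u < ((I.n - 1) * I.k + 1) * I.k → u < H.length → s.arr aPool u = H.getD u 0 :=
    fun u _ => h.pool u
  simp only [fitsT, Term.holds_and, Term.holds_all, Term.holds_imp, Term.holds_lt, Term.holds_le,
    Term.holds_eq, Term.holds_ne, htab, tupleT, Term.eval_arr, Term.eval_var, Term.eval_lit,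
    Term.eval_par, State.setVar_arr, State.setVar_var, hp.k, hp.r, hp.pref, if_true,
    show vJ ≠ 20 by decide, show (20 : ℕ) ≠ 21 by decide, show vLen ≠ 20 by decide,
    show vLen ≠ 21 by decide, if_false, h.place, h.len, h.vote, h.bit]
  constructor
  · rintro ⟨h₁, h₂, h₃, h₄⟩
    refine ⟨fun q hq hqY => ?_, fun q hq hqY hmem => ?_, fun q hq q' hq' hne => ?_, fun hb q hq => ?_⟩
    · rw [← hτ q hq, h₁ q hq hqY, h.table q hqY]
    · obtain ⟨u, hu, e⟩ := List.mem_iff_getElem.1 hmem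
      -- The quantifier ends at `Q * k`, which `len_le` shows to be beyond the pool.
      refine h₂ q hq hqY u (hu.trans_le h.len_le) hu ?_
      rw [h.pool u hu, List.getD_eq_getElem _ _ hu, e, hτ q hq]
    · rw [← hτ q hq, ← hτ q' hq']; exact h₃ q hq q' hq' hne
    · rw [← hτ q hq]; exact h₄ hb q hq
  · rintro ⟨h₁, h₂, h₃, h₄⟩
    refine ⟨fun q hq hqY => ?_, fun q hq hqY u hu hu' => ?_, fun q hq q' hq' hne => ?_,
      fun hb q hq => ?_⟩
    · rw [hτ q hq, h₁ q hq hqY, h.table q hqY]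
    · rw [h.pool u hu', List.getD_eq_getElem _ _ hu', hτ q hq]
      exact fun e => h₂ q hq hqY (e ▸ List.getElem_mem _)
    · rw [hτ q hq, hτ q' hq']; exact h₃ q hq q' hq' hne
    · rw [hτ q hq]; exact h₄ hb q hq

/-- The result of the search so far is `o`. -/
def Found (I : SwapBribery) (i : ℕ) (o : Option ℕ) (s : State) : Prop :=
  match o with
  | none => s.var vFound = 0
  | some u => s.var vFound ≠ 0 ∧
      s.var vCost = weight I.m I.k (I.rank i) (I.price i) (digit I.m u) ∧
      ∀ q < I.k, s.arr aBest q = digit I.m u q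

theorem Found.congr {i : ℕ} {o : Option ℕ} {s' : State} (h : Found I i o s)
    (ha : s'.arr aBest = s.arr aBest) (h₁ : s'.var vFound = s.var vFound)
    (h₂ : s'.var vCost = s.var vCost) : Found I i o s' := by
  cases o with
  | none => simpa [Found, h₁] using h
  | some u => simpa [Found, h₁, h₂, ha] using h

/-- The command performs one step of the recursion of `best`; both keep the earlier tuple on ties.
-/
theorem exec_tryTuple {i b t : ℕ} {Y H : List ℕ} (hp : Params I ν) (hm : 0 < I.m)
    (h : Choosing I i b Y H s) (hτ : ∀ q < I.k, s.arr aTuple q = digit I.m t q)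
    (hF : Found I i (cheapest I.m I.k I.preferred (I.rank i) (I.price i) b Y H t) s) :
    Found I i (cheapest I.m I.k I.preferred (I.rank i) (I.price i) b Y H (t + 1))
      (tryTuple.exec I.encode ν s) := by
  have hw : ∀ s' : State, s'.arr = s.arr → s'.var vI = s.var vI →
      (weightT (.var vI) tupleT).eval I.encode ν s' =
        weight I.m I.k (I.rank i) (I.price i) (digit I.m t) := by
    intro s' harr hvar
    have hT : Tables I s' := h.tables.congr fun _ _ => by rw [harr]
    rw [eval_weightT (f := fun q => s.arr aTuple q) hp hT (by decide)
      (by rw [hvar, h.vote]; exact h.vote_lt) (fun s'' z e _ => by simp [tupleT, e, harr])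
      (fun q hq => by rw [hτ q hq]; exact digit_lt hm _ _), hvar, h.vote]
    exact weight_congr hτ
  have hcond : (Term.and fitsT (.imp (.var vFound)
      (.lt (weightT (.var vI) tupleT) (.var vCost)))).Holds I.encode ν s ↔
      Fits I.k I.preferred b Y H (digit I.m t) ∧ (s.var vFound ≠ 0 →
        weight I.m I.k (I.rank i) (I.price i) (digit I.m t) < s.var vCost) := by
    rw [Term.holds_and, holds_fitsT hp h hτ, Term.holds_imp, Term.holds_lt, hw s rfl rfl]
    rfl
  have hnew : Found I i (some t) ((Cmd.seq (.set vFound (.lit 1)) <|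
      .seq (.set vCost (weightT (.var vI) tupleT)) <|
      .loop vS pK (.put aBest (.var vS) (tupleT (.var vS)))).exec I.encode ν s) := by
    simp only [Cmd.exec_seq, Cmd.exec_set, Term.eval_lit, hw (s.setVar vFound 1) rfl rfl]
    refine ⟨?_, ?_, ?_⟩
    · rw [Cmd.exec_var _ (by decide)]; simp [vFound, vCost]
    · rw [Cmd.exec_var _ (by decide)]; simp
    · have := Cmd.loop_induction (x := I.encode) (ν := ν) (y := vS) (p := pK)
        (c := .put aBest (.var vS) (tupleT (.var vS)))
        (s := (s.setVar vFound 1).setVar vCost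
          (weight I.m I.k (I.rank i) (I.price i) (digit I.m t)))
        (fun a s' => s'.arr aTuple = s.arr aTuple ∧ ∀ q < a, s'.arr aBest q = s.arr aTuple q)
        ⟨rfl, by simp⟩
        (by
          rintro a - s' ⟨h₁, h₂⟩
          refine ⟨?_, fun q hq => ?_⟩
          · rw [Cmd.exec_arr _ (by decide), State.setVar_arr, h₁]
          · simp only [Cmd.exec_put, tupleT, Term.eval_arr, Term.eval_var, State.putArr_arr,
              State.setVar_var, State.setVar_arr, if_true, true_and, h₁]
            split_ifs with e
            · rw [e]
            · exact h₂ q (by omega))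
      intro q hq
      rw [← hτ q hq]
      exact this.2 q (by rw [hp.k]; exact hq)
  rw [tryTuple, Cmd.exec_cond]
  classical
  rw [if_congr hcond rfl rfl]
  simp only [cheapest, best] at hF ⊢
  cases hc : best (fun t => Fits I.k I.preferred b Y H (digit I.m t))
      (fun t => weight I.m I.k (I.rank i) (I.price i) (digit I.m t)) t with
  | none =>
    rw [hc] at hF
    have hF' : s.var vFound = 0 := hF
    simp only [hF', ne_eq, not_true_eq_false, false_imp_iff, and_true]
    split_ifs with hfit
    · exact hnew
    · exact hF
  | some u =>
    rw [hc] at hF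
    obtain ⟨hF₁, hF₂, hF₃⟩ := id hF
    simp only [ne_eq, hF₁, not_false_eq_true, true_imp_iff, hF₂]
    split_ifs with hfit
    · exact hnew
    · exact hF

end
end Bounded

/-! ### Construction and validation of one table -/

namespace Bounded

open Representatives

section
variable {ν : ℕ → ℕ} {s : State} {I : SwapBribery} {i b : ℕ} {Y H : List ℕ}

theorem State.putArr_arr_of_ne {j j' : Fin 16} {q z : ℕ} (h : j' ≠ j) :
    (s.putArr j q z).arr j' = s.arr j' := funext fun q' => by simp [h]

theorem exec_search (hp : Params I ν) (hm : 0 < I.m) (h : Choosing I i b Y H s)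
    (hτ : ∀ q < I.k, s.arr aTuple q = 0) :
    Choosing I i b Y H (search.exec I.encode ν s) ∧
      (∀ q < I.k, (search.exec I.encode ν s).arr aTuple q = 0) ∧
      Found I i (cheapest I.m I.k I.preferred (I.rank i) (I.price i) b Y H (I.m ^ I.k))
        (search.exec I.encode ν s) := by
  have key := Cmd.loop_induction (x := I.encode) (ν := ν) (y := 4) (p := pTuples)
    (c := .seq tryTuple (incr aTuple pM pK)) (s := s.setVar vFound 0)
    (fun t s' => Choosing I i b Y H s' ∧ (∀ q < I.k, s'.arr aTuple q = digit I.m t q) ∧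
      Found I i (cheapest I.m I.k I.preferred (I.rank i) (I.price i) b Y H t) s')
    ⟨h.congr (fun _ _ _ => rfl) (by simp), by simpa [digit_zero] using hτ, rfl⟩
    (by
      rintro t - s' ⟨h₁, h₂, h₃⟩
      rw [Cmd.exec_seq]
      have h₁' : Choosing I i b Y H (s'.setVar 4 t) := h₁.congr (fun _ _ _ => rfl) (by simp)
      have h₃' := exec_tryTuple hp hm h₁' h₂ (h₃.congr rfl (by simp) (by simp))
      set s₂ := tryTuple.exec I.encode ν (s'.setVar 4 t) with hs₂
      have ht₂ : s₂.arr aTuple = s'.arr aTuple := Cmd.exec_arr _ (by decide) _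
      refine ⟨?_, ?_, ?_⟩
      · refine h₁'.congr (fun j hj hj' => ?_) (fun y hy => ?_)
        · rw [Cmd.exec_arr _ (by simpa [incr, Cmd.arrs] using hj),
            Cmd.exec_arr _ (by simpa [tryTuple, Cmd.arrs] using hj')]
        · have : y ∉ tryTuple.vars ∧ y ∉ (incr aTuple pM pK).vars := by
            simp only [List.mem_cons, List.not_mem_nil, or_false] at hy
            rcases hy with rfl | rfl | rfl <;> decide
          rw [Cmd.exec_var _ this.2, Cmd.exec_var _ this.1]
      · have := exec_incr (x := I.encode) (ν := ν) (s := s₂) (j := aTuple) (p := pM) (q := pK)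
          (t := t) (by rw [hp.m]; exact hm) (by rw [hp.k, hp.m, ht₂]; exact h₂)
        rwa [hp.k, hp.m] at this
      · exact h₃'.congr (Cmd.exec_arr _ (by decide) _) (Cmd.exec_var _ (by decide) _)
          (Cmd.exec_var _ (by decide) _))
  rw [hp.tuples] at key
  refine ⟨key.1, fun q hq => ?_, key.2.2⟩
  have := key.2.1 q hq
  -- The counter has completed its cycle and is ready for the next search.
  rwa [digit_pow hm hq] at this

theorem Choosing.push (h : Choosing I i b Y H s) {c : ℕ}
    (hlen : H.length + 1 ≤ ((I.n - 1) * I.k + 1) * I.k) :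
    Choosing I i b Y (H ++ [c])
      ((s.putArr aPool (s.var vLen) c).setVar vLen (s.var vLen + 1)) where
  tables := h.tables.congr fun j hj => by
    have : j ≠ aPool := by rintro rfl; exact absurd hj (by decide)
    funext u; simp [this]
  vote := by simpa using h.vote
  vote_lt := h.vote_lt
  place := by simpa using h.place
  bit := by rw [State.setVar_arr, State.putArr_arr_of_ne (by decide)]; exact h.bit
  table := by rw [State.setVar_arr, State.putArr_arr_of_ne (by decide)]; exact h.table
  len := by simp [h.len]
  len_le := by simpa using hlen
  pool u hu := by
    simp only [State.setVar_arr, State.putArr_arr, true_and, h.len]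
    rw [List.length_append, List.length_singleton] at hu
    split_ifs with e
    · rw [e, List.getD_append_right _ _ _ _ le_rfl]; simp
    · rw [List.getD_append _ _ _ _ (by omega)]
      exact h.pool u (by omega)

theorem exec_appendPool (hp : Params I ν) (h : Choosing I i b Y H s)
    (hF : Found I i (cheapest I.m I.k I.preferred (I.rank i) (I.price i) b Y H (I.m ^ I.k)) s)
    (hlen : H.length + I.k ≤ ((I.n - 1) * I.k + 1) * I.k) :
    Choosing I i b Y (enlarge I.m I.k I.preferred (I.rank i) (I.price i) b Y H)
      (appendPool.exec I.encode ν s) := by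
  rw [appendPool, Cmd.exec_cond, enlarge]
  cases hc : cheapest I.m I.k I.preferred (I.rank i) (I.price i) b Y H (I.m ^ I.k) with
  | none =>
    rw [hc] at hF
    rw [if_neg (by simpa [Found] using hF)]
    exact h
  | some u =>
    rw [hc] at hF
    obtain ⟨hF₁, -, hF₃⟩ := hF
    rw [if_pos (by simpa using hF₁)]
    have key := Cmd.loop_induction (x := I.encode) (ν := ν) (y := vS) (p := pK)
      (c := .cond (.le (.var vJ) (.var vS))
      (.seq (.put aPool (.var vLen) (.arr aBest (.var vS)))
        (.set vLen (.add (.var vLen) (.lit 1)))) .skip) (s := s)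
      (fun a s' => Choosing I i b Y
        (H ++ ((List.range a).filter fun q => Y.length ≤ q).map (digit I.m u)) s' ∧
        s'.arr aBest = s.arr aBest)
      ⟨by simpa using h, rfl⟩
      (by
        rintro a ha s' ⟨h₁, h₂⟩
        refine ⟨?_, by rw [Cmd.exec_arr _ (by decide), State.setVar_arr, h₂]⟩
        rw [hp.k] at ha
        have h₁' : Choosing I i b Y
            (H ++ ((List.range a).filter fun q => Y.length ≤ q).map (digit I.m u))
            (s'.setVar vS a) := h₁.congr (fun _ _ _ => rfl) (by simp)
        rw [Cmd.exec_cond, List.range_succ, List.filter_append, List.map_append, ← List.append_assoc]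
        by_cases hle : Y.length ≤ a
        · rw [if_pos (by simpa [h₁.place] using hle)]
          have hlen' : (H ++ ((List.range a).filter fun q => Y.length ≤ q).map
              (digit I.m u)).length + 1 ≤ ((I.n - 1) * I.k + 1) * I.k := by
            rw [List.length_append, List.length_map]
            have := List.length_filter_le (fun q => decide (Y.length ≤ q)) (List.range a)
            rw [List.length_range] at this
            omega
          have := h₁'.push (c := digit I.m u a) hlen'
          have hb : s'.arr aBest a = digit I.m u a := by rw [h₂]; exact hF₃ a ha
          simpa [hle, hb] using this
        · rw [if_neg (by simpa [h₁.place] using hle)]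
          simpa [hle] using h₁')
    rw [hp.k] at key
    exact key.1

theorem exec_fillPool (hp : Params I ν) (hm : 0 < I.m) (h : Choosing I i b Y [] (s.setVar vLen 0))
    (hτ : ∀ q < I.k, s.arr aTuple q = 0) :
    Choosing I i b Y (pool I.m I.k I.preferred (I.rank i) (I.price i) b Y ((I.n - 1) * I.k + 1))
      (fillPool.exec I.encode ν s) ∧
    ∀ q < I.k, (fillPool.exec I.encode ν s).arr aTuple q = 0 := by
  have key := Cmd.loop_induction (x := I.encode) (ν := ν) (y := 3) (p := pQ)
    (c := .seq search appendPool) (s := s.setVar vLen 0)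
    (fun t s' => Choosing I i b Y
      (pool I.m I.k I.preferred (I.rank i) (I.price i) b Y t) s' ∧
      ∀ q < I.k, s'.arr aTuple q = 0) ⟨h, hτ⟩
    (by
      rintro t ht s' ⟨h₁, h₂⟩
      rw [hp.q] at ht
      obtain ⟨g₁, g₂, g₃⟩ := exec_search hp hm
        (h₁.congr (s' := s'.setVar 3 t) (fun _ _ _ => rfl) (by simp)) h₂
      rw [Cmd.exec_seq]
      refine ⟨exec_appendPool hp g₁ g₃ ?_, fun q hq => ?_⟩
      · have h₁ := length_pool_le (m := I.m) (k := I.k) (p := I.preferred) (pos := I.rank i)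
          (cst := I.price i) (b := b) (Y := Y) t
        -- Before round `t < Q` the pool has at most `t * k` entries, so `k` more still fit.
        have h₂ : (t + 1) * I.k ≤ ((I.n - 1) * I.k + 1) * I.k := Nat.mul_le_mul_right _ ht
        rw [Nat.succ_mul] at h₂
        omega
      · rw [Cmd.exec_arr _ (by decide), g₂ q hq])
  rw [hp.q] at key
  exact key

theorem exec_chooseEntry (hp : Params I ν) (hm : 0 < I.m) {z : ℕ}
    (h : Choosing I i b Y [] (s.setVar vLen 0)) (hτ : ∀ q < I.k, s.arr aTuple q = 0)
    (hz : s.arr aChoice (i * I.k + Y.length) = z) :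
    (∀ q < I.k, (chooseEntry.exec I.encode ν s).arr aTuple q = 0) ∧
    ∀ q, (chooseEntry.exec I.encode ν s).arr aTable q = if q = i * I.k + Y.length then
      next I.m I.k ((I.n - 1) * I.k + 1) I.preferred (I.rank i) (I.price i) b Y z
      else s.arr aTable q := by
  have hvI : s.var vI = i := by simpa using h.vote
  have hvJ : s.var vJ = Y.length := by simpa using h.place
  have hbit : s.arr aBit i = b := h.bit
  have hplace : ∀ {s' : State}, Tables I s' → s'.var vI = i → s'.var vJ = Y.length →
      placeT.eval I.encode ν s' = i * I.k + Y.length := by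
    intro s' hT h₁ h₂
    simp [placeT, h₁, h₂, hT.mulK i h.vote_lt]
  have hcond : (Term.and (.eq (.var vJ) (.lit 0)) (.arr aBit (.var vI))).Holds I.encode ν s ↔
      Y = [] ∧ b ≠ 0 := by
    simp [hvI, hvJ, hbit]
  rw [chooseEntry, Cmd.exec_cond, if_congr hcond rfl rfl, next]
  by_cases hc : Y = [] ∧ b ≠ 0
  · rw [if_pos hc, if_pos hc]
    have hT : Tables I s := h.tables.congr fun _ _ => rfl
    have hpl := hplace hT hvI hvJ
    refine ⟨fun q hq => ?_, fun q => ?_⟩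
    · rw [Cmd.exec_put, State.putArr_arr_of_ne (by decide)]; exact hτ q hq
    · simp only [Cmd.exec_put, State.putArr_arr, true_and, hpl, Term.eval_par, hp.pref]
  · rw [if_neg hc, if_neg hc]
    obtain ⟨g, gτ⟩ := exec_fillPool hp hm h hτ
    rw [Cmd.exec_seq]
    have gc : (fillPool.exec I.encode ν s).arr aChoice = s.arr aChoice :=
      Cmd.exec_arr _ (by decide) _
    have gt : (fillPool.exec I.encode ν s).arr aTable = s.arr aTable :=
      Cmd.exec_arr _ (by decide) _
    have hpl := hplace g.tables g.vote g.place
    refine ⟨fun q hq => ?_, fun q => ?_⟩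
    · rw [Cmd.exec_put, State.putArr_arr_of_ne (by decide)]; exact gτ q hq
    · simp only [Cmd.exec_put, State.putArr_arr, true_and, Term.eval_ite, Term.holds_lt,
        Term.eval_arr, Term.eval_var, Term.eval_lit, hpl, gc, hz, g.len, gt]
      congr 1
      split_ifs with hlt
      · exact g.pool z hlt
      · rw [List.getD_eq_default _ _ (by omega)]

theorem build_append {m k Q p : ℕ} {pos : ℕ → ℕ} {cst : ℕ → ℕ → ℕ} {b : ℕ} (l : List ℕ) (z : ℕ) :
    build m k Q p pos cst b (l ++ [z]) = build m k Q p pos cst b l ++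
      [next m k Q p pos cst b (build m k Q p pos cst b l) z] := by simp [build]

theorem length_build {m k Q p : ℕ} {pos : ℕ → ℕ} {cst : ℕ → ℕ → ℕ} {b : ℕ} (l : List ℕ) :
    (build m k Q p pos cst b l).length = l.length := by
  induction l using List.reverseRecOn with
  | nil => rfl
  | append_singleton l z ih => rw [build_append]; simp [ih]

theorem mul_add_lt_mul {k i' i q' : ℕ} (hi : i' < i) (hq : q' < k) :
    i' * k + q' < i * k := by
  have : (i' + 1) * k ≤ i * k := Nat.mul_le_mul_right _ hi
  rw [Nat.succ_mul] at this
  omega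

/-- The state between the constructions of tables, for the choices `β` and `ζ`. -/
structure Ready (I : SwapBribery) (β : ℕ → ℕ) (ζ : ℕ → ℕ → ℕ) (s : State) : Prop where
  tables : Tables I s
  tuple : ∀ q < I.k, s.arr aTuple q = 0
  bit : ∀ i < I.n, s.arr aBit i = β i
  choice : ∀ i < I.n, ∀ q < I.k, s.arr aChoice (i * I.k + q) = ζ i q

theorem Ready.congr {β : ℕ → ℕ} {ζ : ℕ → ℕ → ℕ} {s' : State} (h : Ready I β ζ s)
    (ha : ∀ j, j ≠ aTuple → j ≠ aBest → j ≠ aPool → j ≠ aTable → s'.arr j = s.arr j)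
    (hτ : ∀ q < I.k, s'.arr aTuple q = 0) : Ready I β ζ s' where
  tables := h.tables.congr fun j hj => by
    refine ha j ?_ ?_ ?_ ?_ <;> (rintro rfl; exact absurd hj (by decide))
  tuple := hτ
  bit := by rw [ha _ (by decide) (by decide) (by decide) (by decide)]; exact h.bit
  choice := by rw [ha _ (by decide) (by decide) (by decide) (by decide)]; exact h.choice

theorem exec_fillTable {β : ℕ → ℕ} {ζ : ℕ → ℕ → ℕ} (hp : Params I ν) (hm : 0 < I.m)
    (h : Ready I β ζ s) :
    Ready I β ζ (fillTable.exec I.encode ν s) ∧ ∀ i < I.n, ∀ q < I.k,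
      (fillTable.exec I.encode ν s).arr aTable (i * I.k + q) = I.table β ζ i q := by
  have key := Cmd.loop_induction (x := I.encode) (ν := ν) (y := vI) (p := pN)
    (c := .loop vJ pK chooseEntry) (s := s)
    (fun i s' => Ready I β ζ s' ∧ ∀ i' < i, ∀ q < I.k,
      s'.arr aTable (i' * I.k + q) = I.table β ζ i' q) ⟨h, by simp⟩
    (by
      rintro i hi s' ⟨h₁, h₂⟩
      rw [hp.n] at hi
      -- The row after `j` places is what the first `j` choices build, since `build` appends one
      -- entry for each choice.
      set row : ℕ → List ℕ := fun j => build I.m I.k ((I.n - 1) * I.k + 1) I.preferred (I.rank i)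
        (I.price i) (β i) ((List.range j).map (ζ i)) with hrow
      have hlen : ∀ j, (row j).length = j := fun j => by simp [hrow, length_build]
      have inner := Cmd.loop_induction (x := I.encode) (ν := ν) (y := vJ) (p := pK)
        (c := chooseEntry) (s := s'.setVar vI i)
        (fun j s'' => Ready I β ζ s'' ∧ s''.var vI = i ∧ (∀ i' < i, ∀ q < I.k,
          s''.arr aTable (i' * I.k + q) = I.table β ζ i' q) ∧
          ∀ q < j, s''.arr aTable (i * I.k + q) = (row j).getD q 0)
        ⟨h₁.congr (fun _ _ _ _ _ => rfl) h₁.tuple, by simp, h₂, by simp⟩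
        (by
          rintro j hj s'' ⟨g₁, g₂, g₃, g₄⟩
          rw [hp.k] at hj
          -- The old pool length is irrelevant, so the pool counts as empty once `vLen` is set to
          -- zero.
          have hch : Choosing I i (β i) (row j) [] ((s''.setVar vJ j).setVar vLen 0) :=
            ⟨g₁.tables.congr fun _ _ => rfl, by simp [g₂], hi, by simp [hlen],
              g₁.bit i hi, by rw [hlen]; exact g₄, by simp, by simp, by simp⟩
          obtain ⟨e₁, e₂⟩ := exec_chooseEntry hp hm hch g₁.tuple
            (z := ζ i j) (by rw [hlen]; exact g₁.choice i hi j hj)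
          rw [hlen] at e₂
          refine ⟨g₁.congr (fun q a₁ a₂ a₃ a₄ => ?_) e₁, ?_, fun i' hi' q hq => ?_,
            fun q hq => ?_⟩
          · refine Cmd.exec_arr _ ?_ _
            simp only [chooseEntry, fillPool, search, tryTuple, incr, appendPool, Cmd.arrs]
            simp [a₁, a₂, a₃, a₄]
          · rw [Cmd.exec_var _ (by decide)]; simp [g₂]
          · rw [e₂, if_neg]
            · exact g₃ i' hi' q hq
            · have := mul_add_lt_mul hi' hq; omega
          · have hrs : row (j + 1) = row j ++ [next I.m I.k ((I.n - 1) * I.k + 1) I.preferred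
                (I.rank i) (I.price i) (β i) (row j) (ζ i j)] := by
              simp only [hrow, List.range_succ, List.map_append, List.map_singleton, build_append]
            rw [e₂, hrs]
            by_cases hqj : q = j
            · subst hqj
              rw [if_pos rfl, List.getD_append_right _ _ _ _ (hlen q).le, hlen]
              simp
            · rw [if_neg (by omega), List.getD_append _ _ _ _ (by rw [hlen]; omega)]
              exact g₄ q (by omega))
      rw [hp.k] at inner
      refine ⟨inner.1, fun i' hi' q hq => ?_⟩
      rcases Nat.lt_succ_iff_lt_or_eq.1 hi' with hi' | rfl
      · exact inner.2.2.1 i' hi' q hq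
      · exact inner.2.2.2 q hq)
  rw [hp.n] at key
  exact key

theorem holds_validT {T : ℕ → ℕ → ℕ} (hp : Params I ν) (hT : Tables I s)
    (hY : ∀ i < I.n, ∀ q < I.k, s.arr aTable (i * I.k + q) = T i q) :
    validT.Holds I.encode ν s ↔ I.Valid T := by
  have htab : ∀ {s' : State} {i q : Term}, s'.arr = s.arr → i.eval I.encode ν s' < I.n →
      q.eval I.encode ν s' < I.k → (tableT i q).eval I.encode ν s' =
        T (i.eval I.encode ν s') (q.eval I.encode ν s') := by
    intro s' i q e hi hq
    rw [eval_tableT (hT.congr fun _ _ => by rw [e]) hi, e, hY _ hi _ hq]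
  have hcount : ∀ {s' : State} {d : Term} {c : ℕ}, s'.arr = s.arr →
      (∀ i q, d.eval I.encode ν ((s'.setVar 20 i).setVar 21 q) = c) →
      (countT d).eval I.encode ν s' = I.count T c := by
    intro s' d c e hd
    simp only [countT, Term.eval_sum, SwapBribery.count, hp.n, hp.k]
    refine Finset.sum_congr rfl fun i hi => Finset.sum_congr rfl fun q hq => ?_
    rw [Finset.mem_range] at hi hq
    have := htab (s' := (s'.setVar 20 i).setVar 21 q) (i := .var 20) (q := .var 21) e
      (by simpa using hi) (by simpa using hq)
    simp only [Term.eval_ite, Term.holds_eq, this, hd, Term.eval_lit]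
    simp
  have h₁ : (Term.all 20 pN (.all 21 pK (.lt (tableT (.var 20) (.var 21)) (.par pM)))).Holds
      I.encode ν s ↔ ∀ i < I.n, ∀ q < I.k, T i q < I.m := by
    simp only [Term.holds_all, Term.holds_lt, hp.n, hp.k]
    refine forall₂_congr fun i hi => forall₂_congr fun q hq => ?_
    rw [htab (s' := (s.setVar 20 i).setVar 21 q) rfl (by simpa using hi) (by simpa using hq)]
    simp [hp.m]
  have h₂ : (Term.all 20 pN (.all 21 pK (.all 22 pK (.imp (.ne (.var 21) (.var 22))
      (.ne (tableT (.var 20) (.var 21)) (tableT (.var 20) (.var 22))))))).Holds I.encode ν s ↔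
      ∀ i < I.n, ∀ q < I.k, ∀ q' < I.k, q ≠ q' → T i q ≠ T i q' := by
    simp only [Term.holds_all, Term.holds_imp, Term.holds_ne, hp.n, hp.k]
    refine forall₂_congr fun i hi => forall₂_congr fun q hq => forall₂_congr fun q' hq' => ?_
    set s' := ((s.setVar 20 i).setVar 21 q).setVar 22 q' with hs'
    rw [htab (s' := s') (i := .var 20) (q := .var 21) rfl (by simpa [hs'] using hi)
        (by simpa [hs'] using hq),
      htab (s' := s') (i := .var 20) (q := .var 22) rfl (by simpa [hs'] using hi)
        (by simpa [hs'] using hq')]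
    simp [hs']
  have h₃ : (Term.all 23 pM (.le (countT (.var 23)) (countT (.par pPref)))).Holds I.encode ν s ↔
      ∀ d < I.m, I.count T d ≤ I.count T I.preferred := by
    simp only [Term.holds_all, Term.holds_le, hp.m]
    refine forall₂_congr fun d hd => ?_
    rw [hcount (s' := s.setVar 23 d) (c := d) rfl (by simp),
      hcount (s' := s.setVar 23 d) (c := I.preferred) rfl (by simp [hp.pref])]
  -- The budget test is meaningful only for tables with entries in range, which the first conjunct
  -- guarantees.
  have h₄ : (∀ i < I.n, ∀ q < I.k, T i q < I.m) →
      ((Term.le (.sum 24 pN (weightT (.var 24) (tableT (.var 24)))) (.par pBudget)).Holds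
        I.encode ν s ↔
      ∑ i ∈ Finset.range I.n, weight I.m I.k (I.rank i) (I.price i) (T i) ≤ I.budget) := by
    intro hlt
    simp only [Term.holds_le, Term.eval_sum, Term.eval_par, hp.budget, hp.n]
    have : ∀ i ∈ Finset.range I.n,
        (weightT (.var 24) (tableT (.var 24))).eval I.encode ν (s.setVar 24 i) =
        weight I.m I.k (I.rank i) (I.price i) (T i) := by
      intro i hi
      rw [Finset.mem_range] at hi
      have hTi : Tables I (s.setVar 24 i) := hT.congr fun _ _ => rfl
      have hi' : (s.setVar 24 i).var 24 = i := by simp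
      rw [eval_weightT (f := fun q => s.arr aTable (i * I.k + q)) hp hTi (by decide)
        (by rw [hi']; exact hi) (fun s' z e e' => ?_)
        (fun q hq => by rw [hY i hi q hq]; exact hlt i hi q hq), hi']
      · exact weight_congr fun q hq => hY i hi q hq
      · have hTs : Tables I s' := hT.congr fun _ _ => by rw [e]; rfl
        rw [hi'] at e'
        rw [eval_tableT hTs (by simpa [e'] using hi), e]
        simp [e']
    rw [Finset.sum_congr rfl this]
  rw [validT, Term.holds_and, Term.holds_and, Term.holds_and, h₁, h₂, h₃]
  constructor
  · rintro ⟨a, b, c, d⟩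
    exact ⟨a, b, c, (h₄ a).1 d⟩
  · rintro ⟨a, b, c, d⟩
    exact ⟨a, b, c, (h₄ a).2 d⟩

theorem out_emitSwaps {T : ℕ → ℕ → ℕ} (hp : Params I ν) (hT : Tables I s)
    (hY : ∀ i < I.n, ∀ q < I.k, s.arr aTable (i * I.k + q) = T i q) (hV : I.Valid T) :
    (emitSwaps.exec I.encode ν s).out = s.out ++ I.swaps T := by
  have key := Cmd.loop_induction (x := I.encode) (ν := ν) (y := vI) (p := pN) (s := s)
    (c := .loop vS pK <| .loop vA pM <|
    .cond (crossT (.var vI) (.var vA) (tableT (.var vI) (.var vS)) (tableT (.var vI)))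
      (.seq (.emit (.var vI)) <| .seq (.emit (.var vA)) <|
        .emit (tableT (.var vI) (.var vS))) .skip)
    (fun N s' => s'.arr = s.arr ∧ s'.out = s.out ++ (List.range N).flatMap fun i =>
      (List.range I.k).flatMap fun q => (List.range I.m).flatMap fun a =>
      if I.rank i a < I.rank i (T i q) ∧ ∀ q' < I.k, T i q' ≠ a then [i, a, T i q] else [])
    ⟨rfl, by simp⟩
    (by
      rintro i hi s₁ ⟨a₁, o₁⟩
      rw [hp.n] at hi
      have key := Cmd.loop_induction (x := I.encode) (ν := ν) (y := vS) (p := pK)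
        (s := s₁.setVar vI i) (c := .loop vA pM <|
        .cond (crossT (.var vI) (.var vA) (tableT (.var vI) (.var vS)) (tableT (.var vI)))
          (.seq (.emit (.var vI)) <| .seq (.emit (.var vA)) <|
            .emit (tableT (.var vI) (.var vS))) .skip)
        (fun N s' => s'.arr = s.arr ∧ s'.var vI = i ∧
          s'.out = s₁.out ++ (List.range N).flatMap fun q => (List.range I.m).flatMap fun a =>
          if I.rank i a < I.rank i (T i q) ∧ ∀ q' < I.k, T i q' ≠ a then [i, a, T i q] else [])
        ⟨a₁, by simp, by simp⟩
        (by
          rintro q hq s₂ ⟨a₂, v₂, o₂⟩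
          rw [hp.k] at hq
          have key := Cmd.loop_induction (x := I.encode) (ν := ν) (y := vA) (p := pM)
            (s := s₂.setVar vS q) (c :=
            .cond (crossT (.var vI) (.var vA) (tableT (.var vI) (.var vS)) (tableT (.var vI)))
              (.seq (.emit (.var vI)) <| .seq (.emit (.var vA)) <|
                .emit (tableT (.var vI) (.var vS))) .skip)
            (fun N s' => s'.arr = s.arr ∧ s'.var vI = i ∧ s'.var vS = q ∧
              s'.out = s₂.out ++ (List.range N).flatMap fun a =>
              if I.rank i a < I.rank i (T i q) ∧ ∀ q' < I.k, T i q' ≠ a then [i, a, T i q] else [])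
            ⟨a₂, by simp [v₂], by simp, by simp⟩
            (by
              rintro a ha s₃ ⟨a₃, v₃, w₃, o₃⟩
              rw [hp.m] at ha
              have hT₃ : Tables I (s₃.setVar vA a) := hT.congr fun _ _ => by
                rw [State.setVar_arr, a₃]
              have hiv : (Term.var vI).eval I.encode ν (s₃.setVar vA a) = i := by simp [v₃]
              have hav : (Term.var vA).eval I.encode ν (s₃.setVar vA a) = a := by simp
              have hqv : (Term.var vS).eval I.encode ν (s₃.setVar vA a) = q := by simp [w₃]
              have htv : ∀ s' : State, s'.arr = s.arr → s'.var vI = i → s'.var vS = q →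
                  (tableT (.var vI) (.var vS)).eval I.encode ν s' = T i q := by
                intro s' e₁ e₂ e₃
                have hT' : Tables I s' := hT.congr fun _ _ => by rw [e₁]
                rw [eval_tableT hT' (by simpa [e₂] using hi), e₁]
                simpa [e₂, e₃] using hY i hi q hq
              have ht := htv (s₃.setVar vA a) a₃ hiv hqv
              have hcr := holds_crossT (x := I.encode) (ν := ν) (i := .var vI) (a := .var vA)
                (b := tableT (.var vI) (.var vS)) (τ := tableT (.var vI))
                (f := fun q' => s.arr aTable (i * I.k + q')) hp hT₃
                (by rw [hiv]; exact hi) (by rw [hav]; exact ha)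
                (by rw [ht]; exact hV.lt i hi q hq) (fun z => by simp)
                (fun z => by
                  have hT' : Tables I ((s₃.setVar vA a).setVar 22 z) :=
                    hT₃.congr fun _ _ => rfl
                  rw [eval_tableT hT' (by simpa [v₃] using hi)]
                  simp [v₃, a₃])
              rw [hiv, hav, ht] at hcr
              have hcr' : (crossT (.var vI) (.var vA) (tableT (.var vI) (.var vS))
                  (tableT (.var vI))).Holds I.encode ν (s₃.setVar vA a) ↔
                  I.rank i a < I.rank i (T i q) ∧ ∀ q' < I.k, T i q' ≠ a := by
                rw [hcr]
                refine and_congr_right fun _ => forall₂_congr fun q' hq' => ?_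
                rw [hY i hi q' hq']
              rw [Cmd.exec_cond, if_congr hcr' rfl rfl, List.range_succ, List.flatMap_append,
                List.flatMap_singleton, ← List.append_assoc, ← o₃]
              split_ifs with hc
              · refine ⟨a₃, by simp [v₃], by simp [w₃], ?_⟩
                simp only [Cmd.exec_seq, Cmd.exec_emit, State.emit_out, State.setVar_out]
                rw [htv _ (by simp [a₃]) (by simp [v₃]) (by simp [w₃])]
                simp [v₃]
              · exact ⟨a₃, by simp [v₃], by simp [w₃], by simp⟩)
          rw [hp.m] at key
          obtain ⟨b₁, b₂, -, b₄⟩ := key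
          refine ⟨b₁, b₂, ?_⟩
          rw [b₄, o₂, List.range_succ, List.flatMap_append, List.flatMap_singleton,
            List.append_assoc])
      rw [hp.k] at key
      obtain ⟨b₁, -, b₃⟩ := key
      refine ⟨b₁, ?_⟩
      rw [b₃, o₁, List.range_succ, List.flatMap_append, List.flatMap_singleton, List.append_assoc])
  rw [hp.n] at key
  exact key.2
end
end Bounded

/-! ### Enumeration of all choices -/

namespace SwapBribery

open Representatives

theorem Valid.congr {I : SwapBribery} {Y Y' : ℕ → ℕ → ℕ} (h : I.Valid Y)
    (e : ∀ i < I.n, ∀ s < I.k, Y' i s = Y i s) : I.Valid Y' := by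
  have hc : ∀ d, I.count Y' d = I.count Y d := fun d =>
    Finset.sum_congr rfl fun i hi => Finset.sum_congr rfl fun s hs => by
      rw [e i (Finset.mem_range.1 hi) s (Finset.mem_range.1 hs)]
  refine ⟨fun i hi s hs => ?_, fun i hi s hs s' hs' => ?_, fun d hd => ?_, ?_⟩
  · rw [e i hi s hs]; exact h.lt i hi s hs
  · rw [e i hi s hs, e i hi s' hs']; exact h.inj i hi s hs s' hs'
  · rw [hc, hc]; exact h.winner d hd
  · refine le_trans (le_of_eq (Finset.sum_congr rfl fun i hi => ?_)) h.cost
    exact weight_congr (e i (Finset.mem_range.1 hi))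

theorem table_congr {I : SwapBribery} {b b' : ℕ → ℕ} {z z' : ℕ → ℕ → ℕ} {i : ℕ} (hb : b i = b' i)
    (hz : ∀ s < I.k, z i s = z' i s) : I.table b z i = I.table b' z' i := by
  funext s
  rw [table, table, hb]
  congr 2
  exact List.map_congr_left fun s hs => hz s (List.mem_range.1 hs)

end SwapBribery

namespace Bounded

open Representatives

section
variable {ν : ℕ → ℕ} {s : State} {I : SwapBribery}

theorem tables_prepareTables (hp : Params I ν) (s : State) :
    Tables I (prepareTables.exec I.encode ν s) := by
  set c₁ : Cmd := .loop vI pN <| .seq (.put aMulK (.var vI) (.sum 20 pK (.var vI))) <|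
    .put aMulMM (.var vI) (.sum 20 pM (.sum 21 pM (.var vI))) with hc₁
  set c₂ : Cmd := .loop vI pN <| .put aMulM (.var vI) (.sum 20 pM (.var vI)) with hc₂
  set c₃ : Cmd := .loop vA pM <| .put aMulM (.var vA) (.sum 20 pM (.var vA)) with hc₃
  set c₄ : Cmd := .loop vI pN <| .loop vA pM <|
    .put aRank (.add (.arr aMulM (.var vI))
      (.inp (.add (.lit 5) (.add (.arr aMulM (.var vI)) (.var vA))))) (.var vA) with hc₄
  set s₁ := c₁.exec I.encode ν s with hs₁
  set s₂ := c₂.exec I.encode ν s₁ with hs₂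
  set s₃ := c₃.exec I.encode ν s₂ with hs₃
  have hexec : prepareTables.exec I.encode ν s = c₄.exec I.encode ν s₃ := rfl
  have h₁ : (∀ i < I.n, s₁.arr aMulK i = i * I.k) ∧
      ∀ i < I.n, s₁.arr aMulMM i = i * (I.m * I.m) := by
    have := Cmd.loop_induction (x := I.encode) (ν := ν) (y := vI) (p := pN) (s := s)
      (c := .seq (.put aMulK (.var vI) (.sum 20 pK (.var vI))) <|
        .put aMulMM (.var vI) (.sum 20 pM (.sum 21 pM (.var vI))))
      (fun N s' => (∀ i < N, s'.arr aMulK i = i * I.k) ∧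
        ∀ i < N, s'.arr aMulMM i = i * (I.m * I.m)) ⟨by simp, by simp⟩
      (by
        rintro a - s' ⟨g₁, g₂⟩
        have e₁ : I.k * a = a * I.k := mul_comm _ _
        have e₂ : I.m * (I.m * a) = a * (I.m * I.m) := by ring
        refine ⟨fun i hi => ?_, fun i hi => ?_⟩
        · rw [Cmd.exec_seq, Cmd.exec_put, State.putArr_arr_of_ne (by decide)]
          by_cases e : i = a
          · subst e; simp [hp.k, e₁]
          · simp [e, g₁ i (by omega)]
        · rw [Cmd.exec_seq, Cmd.exec_put]
          by_cases e : i = a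
          · subst e; simp [hp.m, e₂]
          · simp only [State.putArr_arr, Term.eval_var, Cmd.exec_put, State.putArr_var,
              State.setVar_var, if_true, e, and_false, if_false, State.setVar_arr]
            exact g₂ i (by omega))
    rwa [hp.n] at this
  have h₂ : ∀ i < I.n, s₂.arr aMulM i = i * I.m := by
    have := Cmd.loop_induction (x := I.encode) (ν := ν) (y := vI) (p := pN) (s := s₁)
      (c := .put aMulM (.var vI) (.sum 20 pM (.var vI)))
      (fun N s' => ∀ i < N, s'.arr aMulM i = i * I.m) (by simp)
      (by
        intro a _ s' g i hi
        by_cases e : i = a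
        · subst e; simp [hp.m, mul_comm]
        · simp [e, g i (by omega)])
    rwa [hp.n] at this
  have h₃ : (∀ i < I.n, s₃.arr aMulM i = i * I.m) ∧ ∀ i < I.m, s₃.arr aMulM i = i * I.m := by
    have := Cmd.loop_induction (x := I.encode) (ν := ν) (y := vA) (p := pM) (s := s₂)
      (c := .put aMulM (.var vA) (.sum 20 pM (.var vA)))
      (fun N s' => (∀ i < I.n, s'.arr aMulM i = i * I.m) ∧ ∀ i < N, s'.arr aMulM i = i * I.m)
      ⟨h₂, by simp⟩
      (by
        rintro a - s' ⟨g₁, g₂⟩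
        refine ⟨fun i hi => ?_, fun i hi => ?_⟩
        · by_cases e : i = a
          · subst e; simp [hp.m, mul_comm]
          · simp [e, g₁ i hi]
        · by_cases e : i = a
          · subst e; simp [hp.m, mul_comm]
          · simp [e, g₂ i (by omega)])
    rwa [hp.m] at this
  have h₄ : ∀ i < I.n, ∀ a < I.m, (c₄.exec I.encode ν s₃).arr aRank (i * I.m + a) =
      I.rank i a := by
    have := Cmd.loop_induction (x := I.encode) (ν := ν) (y := vI) (p := pN) (s := s₃)
      (c := .loop vA pM <| .put aRank (.add (.arr aMulM (.var vI))
        (.inp (.add (.lit 5) (.add (.arr aMulM (.var vI)) (.var vA))))) (.var vA))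
      (fun N s' => s'.arr aMulM = s₃.arr aMulM ∧ ∀ i < N, ∀ a < I.m,
        s'.arr aRank (i * I.m + a) = I.rank i a) ⟨rfl, by simp⟩
      (by
        rintro i hi s' ⟨g₁, g₂⟩
        rw [hp.n] at hi
        have := Cmd.loop_induction (x := I.encode) (ν := ν) (y := vA) (p := pM)
          (s := s'.setVar vI i)
          (c := .put aRank (.add (.arr aMulM (.var vI))
            (.inp (.add (.lit 5) (.add (.arr aMulM (.var vI)) (.var vA))))) (.var vA))
          (fun N s'' => s''.arr aMulM = s₃.arr aMulM ∧ s''.var vI = i ∧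
            (∀ i' < i, ∀ a < I.m, s''.arr aRank (i' * I.m + a) = I.rank i' a) ∧
            -- The row is filled in the order of the ranks, so progress is measured along the
            -- inverse of the vote.
            ∀ r (hr : r < I.m), r < N →
              s''.arr aRank (i * I.m + (I.votes ⟨i, hi⟩).symm ⟨r, hr⟩) = r)
          ⟨g₁, by simp, g₂, by simp⟩
          (by
            rintro r hr s'' ⟨f₁, f₂, f₃, f₄⟩
            rw [hp.m] at hr
            have hv : (Term.add (.arr aMulM (.var vI))
                (.inp (.add (.lit 5) (.add (.arr aMulM (.var vI)) (.var vA))))).eval I.encode ν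
                (s''.setVar vA r) = i * I.m + (I.votes ⟨i, hi⟩).symm ⟨r, hr⟩ := by
              have := encode_vote (I := I) ⟨i, hi⟩ ⟨r, hr⟩
              have e : (s''.setVar vA r).var vI = i := by simp [f₂]
              simp only [Term.eval_add, Term.eval_arr, Term.eval_var, Term.eval_inp, Term.eval_lit,
                e, State.setVar_arr, f₁, h₃.1 i hi, State.setVar_var, if_true]
              rw [← this]
            rw [Cmd.exec_put, hv]
            refine ⟨by rw [State.putArr_arr_of_ne (by decide)]; exact f₁, by simp [f₂], ?_, ?_⟩
            · intro i' hi' a ha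
              have := mul_add_lt_mul hi' ha
              rw [State.putArr_arr, if_neg (by omega)]
              exact f₃ i' hi' a ha
            · intro r' hr' hlt
              rw [State.putArr_arr]
              by_cases e : r' = r
              · subst e; simp
              · rw [if_neg]
                · exact f₄ r' hr' (by omega)
                · rintro ⟨-, h⟩
                  have h' : (I.votes ⟨i, hi⟩).symm ⟨r', hr'⟩ = (I.votes ⟨i, hi⟩).symm ⟨r, hr⟩ :=
                    Fin.ext (by omega)
                  exact e (Fin.mk.inj ((I.votes ⟨i, hi⟩).symm.injective h')))
        rw [hp.m] at this
        obtain ⟨f₁, -, f₃, f₄⟩ := this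
        refine ⟨f₁, fun i' hi' a ha => ?_⟩
        rcases Nat.lt_succ_iff_lt_or_eq.1 hi' with hi' | rfl
        · exact f₃ i' hi' a ha
        -- Taking for `r` the rank of `a` gives the entry of `a`.
        · have := f₄ (I.votes ⟨i', hi⟩ ⟨a, ha⟩) (Fin.is_lt _) (Fin.is_lt _)
          rw [Fin.eta, Equiv.symm_apply_apply] at this
          rw [this, SwapBribery.rank, dif_pos ⟨hi, ha⟩])
    rw [hp.n] at this
    exact this.2
  rw [hexec]
  have f₄ : ∀ j ≠ aRank, (c₄.exec I.encode ν s₃).arr j = s₃.arr j := fun j hj =>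
    Cmd.exec_arr _ (by simpa [hc₄, Cmd.arrs] using hj) _
  have f₃ : ∀ j ≠ aMulM, s₃.arr j = s₂.arr j := fun j hj =>
    Cmd.exec_arr _ (by simpa [hc₃, Cmd.arrs] using hj) _
  have f₂ : ∀ j ≠ aMulM, s₂.arr j = s₁.arr j := fun j hj =>
    Cmd.exec_arr _ (by simpa [hc₂, Cmd.arrs] using hj) _
  refine ⟨?_, ?_, ?_, ?_, h₄⟩
  · rw [f₄ _ (by decide), f₃ _ (by decide), f₂ _ (by decide)]; exact h₁.1
  · rw [f₄ _ (by decide)]; exact h₃.1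
  · rw [f₄ _ (by decide)]; exact h₃.2
  · rw [f₄ _ (by decide), f₃ _ (by decide), f₂ _ (by decide)]; exact h₁.2

/-- The bits with the number `t`. -/
def bits (t i : ℕ) : ℕ := digit 2 t i

/-- The choices with the number `t`. -/
def choices (I : SwapBribery) (t i q : ℕ) : ℕ :=
  digit (((I.n - 1) * I.k + 1) * I.k) t (i * I.k + q)

/-- Either none of the tables with the numbers in `E` describes a solution, or a solution has been
written to the output. -/
def Status (I : SwapBribery) (E : ℕ → ℕ → Prop) (s : State) : Prop :=
  (s.var vDone = 0 ∧ s.out = [] ∧ ∀ t u, E t u → ¬ I.Valid (I.table (bits t) (choices I u))) ∨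
  (s.var vDone ≠ 0 ∧ ∃ Y, I.Valid Y ∧ s.out = 1 :: I.swaps Y)

theorem Status.congr {E E' : ℕ → ℕ → Prop} {s' : State} (h : Status I E s)
    (hE : ∀ t u, E' t u → E t u) (hv : s'.var vDone = s.var vDone) (ho : s'.out = s.out) :
    Status I E' s' := by
  rcases h with ⟨h₁, h₂, h₃⟩ | ⟨h₁, h₂⟩
  · exact Or.inl ⟨hv.trans h₁, ho.trans h₂, fun t u e => h₃ t u (hE t u e)⟩
  · exact Or.inr ⟨by rwa [hv], by rwa [ho]⟩

/-- The flag `vDone` lets only the first valid table be written; the search goes on without further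
output. -/
theorem exec_tryTable {E : ℕ → ℕ → Prop} {t u : ℕ} (hp : Params I ν) (hm : 0 < I.m)
    (h : Ready I (bits t) (choices I u) s) (hS : Status I E s) :
    Ready I (bits t) (choices I u) (tryTable.exec I.encode ν s) ∧
      Status I (fun t' u' => E t' u' ∨ (t' = t ∧ u' = u)) (tryTable.exec I.encode ν s) := by
  obtain ⟨h₁, h₂⟩ := exec_fillTable hp hm h
  rw [tryTable, Cmd.exec_seq]
  set s₁ := fillTable.exec I.encode ν s with hs₁
  have hS₁ : Status I E s₁ :=
    hS.congr (fun _ _ e => e) (Cmd.exec_var _ (by decide) _) (Cmd.exec_out _ (by decide) _)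
  have hv := holds_validT hp h₁.tables h₂
  have hc : (Term.and (.eq (.var vDone) (.lit 0)) validT).Holds I.encode ν s₁ ↔
      s₁.var vDone = 0 ∧ I.Valid (I.table (bits t) (choices I u)) := by
    rw [Term.holds_and, hv]; simp
  rw [Cmd.exec_cond]
  by_cases hcond : s₁.var vDone = 0 ∧ I.Valid (I.table (bits t) (choices I u))
  · rw [if_pos (hc.2 hcond)]
    obtain ⟨hd, hV⟩ := hcond
    have ho : s₁.out = [] := by
      rcases hS₁ with ⟨-, h, -⟩ | ⟨h, -⟩
      · exact h
      · exact absurd hd h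
    simp only [Cmd.exec_seq, Cmd.exec_set, Cmd.exec_emit, Term.eval_lit]
    have ha : (emitSwaps.exec I.encode ν (s₁.emit 1)).arr = s₁.arr := by
      funext j; exact Cmd.exec_arr _ (by simp [emitSwaps, Cmd.arrs]) _
    have hout := out_emitSwaps (s := s₁.emit 1) hp (h₁.tables.congr fun _ _ => rfl) h₂ hV
    refine ⟨h₁.congr (fun j _ _ _ _ => ?_) ?_, Or.inr ⟨by simp, _, hV, ?_⟩⟩
    · rw [State.setVar_arr, ha]
    · rw [State.setVar_arr, ha]; exact h₁.tuple
    · rw [State.setVar_out, hout, State.emit_out, ho]; rfl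
  · rw [if_neg (fun h => hcond (hc.1 h))]
    refine ⟨h₁, ?_⟩
    rcases hS₁ with ⟨g₁, g₂, g₃⟩ | g
    · refine Or.inl ⟨g₁, g₂, fun t' u' e => ?_⟩
      rcases e with e | ⟨rfl, rfl⟩
      · exact g₃ t' u' e
      · exact fun hV => hcond ⟨g₁, hV⟩
    · exact Or.inr g

theorem exists_place {n k q : ℕ} (hq : q < n * k) : ∃ i < n, ∃ r < k, i * k + r = q := by
  have hk : 0 < k := Nat.pos_of_ne_zero fun h => by simp [h] at hq
  exact ⟨q / k, Nat.div_lt_of_lt_mul (by rwa [mul_comm] at hq), q % k, Nat.mod_lt _ hk,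
    by rw [mul_comm]; exact Nat.div_add_mod q k⟩

theorem exec_tryAll (hp : Params I ν) (hm : 0 < I.m) (hT : Tables I s)
    (h₀ : ∀ j, j ≤ 5 → ∀ q, s.arr j q = 0) (hd : s.var vDone = 0) (ho : s.out = []) :
    Status I (fun t u => t < 2 ^ I.n ∧ u < (((I.n - 1) * I.k + 1) * I.k) ^ (I.n * I.k))
      (tryAll.exec I.encode ν s) := by
  have hR : 0 < ((I.n - 1) * I.k + 1) * I.k := Nat.mul_pos (Nat.succ_pos _) I.k_pos
  set N := (((I.n - 1) * I.k + 1) * I.k) ^ (I.n * I.k) with hN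
  have hchoice : ∀ {β ζ s'}, Ready I β ζ s' → ∀ u, (∀ i < I.n, ∀ q < I.k, ζ i q = choices I u i q) →
      Ready I β (choices I u) s' := fun h u e =>
    ⟨h.tables, h.tuple, h.bit, fun i hi q hq => by rw [h.choice i hi q hq, e i hi q hq]⟩
  have key := Cmd.loop_induction (x := I.encode) (ν := ν) (y := 12) (p := pBits) (s := s)
    (c := .seq (.loop 13 pChoices (.seq tryTable (incr aChoice pR pPlaces))) (incr aBit 12 pN))
    (fun t s' => Ready I (bits t) (choices I 0) s' ∧ Status I (fun t' u' => t' < t ∧ u' < N) s')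
    ⟨⟨hT, fun q _ => h₀ _ (by decide) q, fun i _ => by
        rw [h₀ _ (by decide), bits, digit_zero], fun i _ q _ => by
        rw [h₀ _ (by decide), choices, digit_zero]⟩, Or.inl ⟨hd, ho, by simp⟩⟩
    (by
      rintro t - s' ⟨g₁, g₂⟩
      rw [Cmd.exec_seq]
      have inner := Cmd.loop_induction (x := I.encode) (ν := ν) (y := 13) (p := pChoices)
        (s := s'.setVar 12 t) (c := .seq tryTable (incr aChoice pR pPlaces))
        (fun u s'' => Ready I (bits t) (choices I u) s'' ∧
          -- The pairs handled so far form an initial segment of the lexicographic order.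
          Status I (fun t' u' => (t' < t ∧ u' < N) ∨ (t' = t ∧ u' < u)) s'')
        ⟨g₁.congr (fun _ _ _ _ _ => rfl) g₁.tuple,
          g₂.congr (fun t' u' e => by simpa using e) (by simp) rfl⟩
        (by
          rintro u - s'' ⟨f₁, f₂⟩
          rw [Cmd.exec_seq]
          obtain ⟨e₁, e₂⟩ := exec_tryTable (s := s''.setVar 13 u) hp hm
            (f₁.congr (fun _ _ _ _ _ => rfl) f₁.tuple)
            (f₂.congr (fun _ _ e => e) (by simp) rfl)
          set s₁ := tryTable.exec I.encode ν (s''.setVar 13 u)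
          have hinc := exec_incr (x := I.encode) (ν := ν) (s := s₁) (j := aChoice) (p := pR)
            (q := pPlaces) (t := u) (by rw [hp.r]; exact hR) (by
              rw [hp.places, hp.r]
              intro q hq
              obtain ⟨i, hi, r, hr, rfl⟩ := exists_place hq
              exact e₁.choice i hi r hr)
          rw [hp.places, hp.r] at hinc
          have harr : ∀ j ≠ aChoice, ((incr aChoice pR pPlaces).exec I.encode ν s₁).arr j =
              s₁.arr j := fun j hj => Cmd.exec_arr _ (by simpa [incr, Cmd.arrs] using hj) _
          refine ⟨⟨e₁.tables.congr fun j hj => harr j ?_, ?_, ?_, fun i hi q hq => ?_⟩, ?_⟩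
          · rintro rfl; exact absurd hj (by decide)
          · rw [harr _ (by decide)]; exact e₁.tuple
          · rw [harr _ (by decide)]; exact e₁.bit
          · exact hinc _ (by
              have := mul_add_lt_mul hi hq
              omega)
          · refine e₂.congr (fun t' u' e => ?_) (Cmd.exec_var _ (by decide) _)
              (Cmd.exec_out _ (by decide) _)
            rcases e with e | ⟨e, e'⟩
            · exact Or.inl (Or.inl e)
            · rcases Nat.lt_succ_iff_lt_or_eq.1 e' with e' | e'
              · exact Or.inl (Or.inr ⟨e, e'⟩)
              · exact Or.inr ⟨e, e'⟩)
      rw [hp.choices] at inner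
      obtain ⟨f₁, f₂⟩ := inner
      set s₁ := (Cmd.loop 13 pChoices (.seq tryTable (incr aChoice pR pPlaces))).exec I.encode ν
        (s'.setVar 12 t)
      -- The counter of the choices has wrapped around to zero for the next bit vector.
      have f₁' : Ready I (bits t) (choices I 0) s₁ := hchoice f₁ 0 fun i hi q hq => by
        rw [choices, choices, digit_zero, digit_pow hR]
        have := mul_add_lt_mul hi hq
        omega
      have hinc := exec_incr (x := I.encode) (ν := ν) (s := s₁) (j := aBit) (p := 12)
        (q := pN) (t := t) (by rw [hp.two]; decide) (by rw [hp.n, hp.two]; exact f₁.bit)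
      rw [hp.n, hp.two] at hinc
      have harr : ∀ j ≠ aBit, ((incr aBit 12 pN).exec I.encode ν s₁).arr j =
          s₁.arr j := fun j hj => Cmd.exec_arr _ (by simpa [incr, Cmd.arrs] using hj) _
      refine ⟨⟨f₁'.tables.congr fun j hj => harr j ?_, ?_, hinc, ?_⟩, ?_⟩
      · rintro rfl; exact absurd hj (by decide)
      · rw [harr _ (by decide)]; exact f₁'.tuple
      · rw [harr _ (by decide)]; exact f₁'.choice
      · refine f₂.congr (fun t' u' e => ?_) (Cmd.exec_var _ (by decide) _)
          (Cmd.exec_out _ (by decide) _)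
        rcases Nat.lt_succ_iff_lt_or_eq.1 e.1 with e' | e'
        · exact Or.inl ⟨e', e.2⟩
        · exact Or.inr ⟨e', e.2⟩)
  rw [hp.bits] at key
  exact key.2

/-- If some set of swaps is a solution, then some table describes a solution. -/
theorem exists_valid_of_isSolution {Γ : Finset (Fin I.n × Fin I.m × Fin I.m)}
    (h : I.IsSolution Γ) : ∃ t < 2 ^ I.n, ∃ u < (((I.n - 1) * I.k + 1) * I.k) ^ (I.n * I.k),
      I.Valid (I.table (bits t) (choices I u)) := by
  obtain ⟨β, ζ, hβ, hζ, hV⟩ := h.exists_valid_table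
  obtain ⟨t, ht, ht'⟩ := exists_digit_eq (r := 2) I.n β fun i _ => hβ i
  obtain ⟨u, hu, hu'⟩ := exists_digit_eq (r := ((I.n - 1) * I.k + 1) * I.k) (I.n * I.k)
    -- All choices are digits of a single number; place `i * k + r` holds the one for place `r` of
    -- vote `i`.
    (fun q => ζ (q / I.k) (q % I.k)) fun q _ => hζ _ _
  refine ⟨t, ht, u, hu, hV.congr fun i hi q hq => ?_⟩
  refine congrFun (SwapBribery.table_congr (ht' i hi) fun r hr => ?_) q
  have hk : 0 < I.k := I.k_pos
  rw [choices, hu' _ (by have := mul_add_lt_mul hi hr; omega)]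
  congr 1
  · rw [mul_comm, Nat.mul_add_div hk, Nat.div_eq_of_lt hr, Nat.add_zero]
  · rw [mul_comm, Nat.mul_add_mod, Nat.mod_eq_of_lt hr]

theorem correctOutput_mainCmd (hp : Params I ν) (ha : ∀ j q, s.arr j q = 0)
    (hv : s.var vDone = 0) (ho : s.out = []) :
    I.CorrectOutput (mainCmd.exec I.encode ν s).out := by
  have hm : 0 < I.m := lt_of_lt_of_le I.k_pos I.k_le
  rw [mainCmd, Cmd.exec_seq, Cmd.exec_seq]
  have hS := exec_tryAll hp hm (tables_prepareTables hp s)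
    (fun j hj q => by
      rw [Cmd.exec_arr _ ?_, ha]
      have : ∀ j : Fin 16, j ≤ 5 → j ∉ prepareTables.arrs := by decide
      exact this j hj)
    (by rw [Cmd.exec_var _ (by decide), hv]) (by rw [Cmd.exec_out _ (by decide), ho])
  rw [Cmd.exec_cond]
  rcases hS with ⟨h₁, h₂, h₃⟩ | ⟨h₁, Y, hY, h₂⟩
  · rw [if_neg (by simpa using h₁)]
    left
    refine ⟨?_, by simp [h₂]⟩
    rintro ⟨Γ, hΓ⟩
    obtain ⟨t, ht, u, hu, hV⟩ := exists_valid_of_isSolution hΓ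
    exact h₃ t u ⟨ht, hu⟩ hV
  · rw [if_pos (by simpa using h₁), Cmd.exec_skip, h₂]
    exact hY.correctOutput

end
end Bounded

namespace Bounded

open Representatives

/-! ### The parameters and the running time -/

/-- The constant in the bound on the cost of a script, except the final command. -/
def prepareCoeff : List (Cmd × ℕ × ℕ) → ℕ
  | [] => 0
  | a :: l => a.1.coeff + 5 + prepareCoeff l

/-- From the parameters `ν`, the script leads to the parameters `ν'`, in time proportional to `M`. -/
def Prepares (x : List ℕ) (M : ℕ) (l : List (Cmd × ℕ × ℕ)) (ν ν' : ℕ → ℕ) : Prop :=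
  ∀ s, (prepare x l (ν, s)).1 = ν' ∧ prepareCost x l (ν, s) ≤ prepareCoeff l * M

theorem Prepares.nil {x : List ℕ} {M : ℕ} {ν : ℕ → ℕ} : Prepares x M [] ν ν :=
  fun _ => ⟨rfl, Nat.zero_le _⟩

/-- The published value does not depend on the state, so the parameters can be followed without
tracking the variables. -/
theorem exists_prepares_cons {x : List ℕ} {M : ℕ} {l : List (Cmd × ℕ × ℕ)} {ν : ℕ → ℕ} {c : Cmd}
    {p y : ℕ} {R : (ℕ → ℕ) → Prop} (v : ℕ) (hv : ∀ s, (c.exec x ν s).var y = v)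
    (hM : c.depth ν ≤ M) (h : ∃ ν', Prepares x M l (Function.update ν p v) ν' ∧ R ν') :
    ∃ ν', Prepares x M ((c, p, y) :: l) ν ν' ∧ R ν' := by
  obtain ⟨ν', h, hR⟩ := h
  refine ⟨ν', fun s => ?_, hR⟩
  obtain ⟨h₁, h₂⟩ := h (c.exec x ν s)
  refine ⟨by rw [prepare, hv, h₁], ?_⟩
  rw [prepareCost, hv]
  change c.cost ν + 5 + _ ≤ (c.coeff + 5 + prepareCoeff l) * M
  have h₃ : c.cost ν ≤ c.coeff * M := c.cost_le.trans (Nat.mul_le_mul_left _ hM)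
  have h₄ : 5 ≤ 5 * M := Nat.le_mul_of_pos_right _ (c.one_le_depth.trans hM)
  rw [Nat.add_mul, Nat.add_mul]
  omega

theorem exec_pow_two {x : List ℕ} {ν : ℕ → ℕ} {p : ℕ} (s : State) :
    ((Cmd.seq (.set 0 (.lit 1)) (.loop 1 p (.set 0 (.add (.var 0) (.var 0))))).exec x ν s).var 0 =
      2 ^ ν p := by
  refine Cmd.loop_induction (x := x) (ν := ν) (y := 1) (p := p) (s := s.setVar 0 1)
    (fun a s' => s'.var 0 = 2 ^ a) (by simp) fun a _ s' h => ?_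
  simp [h, pow_succ, mul_two]

theorem exec_pow {x : List ℕ} {ν : ℕ → ℕ} {p r : ℕ} (s : State) :
    ((Cmd.seq (.set 0 (.lit 1)) (.loop 1 p (.set 0 (.sum 20 r (.var 0))))).exec x ν s).var 0 =
      ν r ^ ν p := by
  refine Cmd.loop_induction (x := x) (ν := ν) (y := 1) (p := p) (s := s.setVar 0 1)
    (fun a s' => s'.var 0 = ν r ^ a) (by simp) fun a _ s' h => ?_
  simp [h, pow_succ']

theorem encode_head {I : SwapBribery} : I.encode.getD 0 0 = I.n ∧ I.encode.getD 1 0 = I.m ∧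
    I.encode.getD 2 0 = I.k ∧ I.encode.getD 3 0 = I.preferred ∧ I.encode.getD 4 0 = I.budget := by
  refine ⟨?_, ?_, ?_, ?_, ?_⟩ <;> rfl

/-- The number of iterations of the innermost loops. -/
def iterations (I : SwapBribery) : ℕ :=
  2 ^ I.n * ((((I.n - 1) * I.k + 1) * I.k) ^ (I.n * I.k) * (I.n * (I.k * (((I.n - 1) * I.k + 1) *
    (I.m ^ I.k * (I.k * (I.k * (I.m * ((I.n - 1) * I.k + 1)))))))))

theorem depth_mainCmd {I : SwapBribery} {ν : ℕ → ℕ} (hp : Params I ν) :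
    mainCmd.depth ν ≤ iterations I := by
  have hn := I.n_pos
  have hk := I.k_pos
  have hm : 1 ≤ I.m := hk.trans I.k_le
  -- As `k ≥ 1`, a factor `m` can be split off `m ^ k` to pay for loops over the candidates outside
  -- the search.
  obtain ⟨t, htm⟩ : ∃ t, I.m ^ I.k = t * I.m :=
    ⟨I.m ^ (I.k - 1), by rw [← pow_succ, Nat.sub_add_cancel hk]⟩
  rw [iterations]
  set n := I.n
  set k := I.k
  set m := I.m
  set Q := (n - 1) * k + 1 with hQ
  have hQ1 : 1 ≤ Q := Nat.succ_pos _
  have hB : 1 ≤ 2 ^ n := Nat.one_le_two_pow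
  have hN : 1 ≤ (Q * k) ^ (n * k) := Nat.one_le_pow _ _ (Nat.mul_pos hQ1 hk)
  have e0 : max 1 (ν pN) = n := by rw [hp.n]; exact max_eq_right hn
  have e1 : max 1 (ν pM) = m := by rw [hp.m]; exact max_eq_right hm
  have e2 : max 1 (ν pK) = k := by rw [hp.k]; exact max_eq_right hk
  have e3 : max 1 (ν pPlaces) = n * k := by
    rw [hp.places]; exact max_eq_right (Nat.mul_pos hn hk)
  have e4 : max 1 (ν pQ) = Q := by rw [hp.q]; exact max_eq_right hQ1
  have e5 : max 1 (ν pR) = Q * k := by rw [hp.r]; exact max_eq_right (Nat.mul_pos hQ1 hk)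
  have e6 : max 1 (ν pBits) = 2 ^ n := by rw [hp.bits]; exact max_eq_right hB
  have e7 : max 1 (ν pTuples) = m ^ k := by
    rw [hp.tuples]; exact max_eq_right (Nat.one_le_pow _ _ hm)
  have e8 : max 1 (ν pChoices) = (Q * k) ^ (n * k) := by
    rw [hp.choices]; exact max_eq_right hN
  -- `U` covers both parts of the test of a tuple: `k * (Q * k)` for comparing with the pool and `k
  -- * (m * k)` for the weight.
  set U := k * (k * (m * Q)) with hU
  set V := n * (k * (Q * (m ^ k * U))) with hV
  have hUpos : 0 < U := by positivity
  have hVpos : 0 < V := by positivity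
  -- The comparisons reduce to naming a cofactor, which `ring` then checks.
  have dU : ∀ {a : ℕ} (b : ℕ), a * b = U → a ≤ U := fun b h => Nat.le_of_dvd hUpos ⟨b, h.symm⟩
  have dV : ∀ {a : ℕ} (b : ℕ), a * b = V → a ≤ V := fun b h => Nat.le_of_dvd hVpos ⟨b, h.symm⟩
  have hincr : ∀ j p q, (incr j p q).depth ν = max 1 (ν q) := by
    intro j p q
    simp [incr, Cmd.depth, Term.depth, Term.eq]
  have k1 : max k 1 = k := max_eq_left hk
  have k2 : max 1 k = k := max_eq_right hk
  have m1 : max 1 m = m := max_eq_right hm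
  have mm : max 1 (m * m) = m * m := max_eq_right (Nat.mul_pos hm hm)
  have nk : max (n * k) 1 = n * k := max_eq_left (Nat.mul_pos hn hk)
  have kk : max (k * k) 1 = k * k := max_eq_left (Nat.mul_pos hk hk)
  have Qk : max (Q * k) 1 = Q * k := max_eq_left (Nat.mul_pos hQ1 hk)
  have Qk' : max 1 (Q * k) = Q * k := max_eq_right (Nat.mul_pos hQ1 hk)
  have hV' : V = n * (k * (Q * (t * m * U))) := by rw [hV, htm]
  have hkU : k ≤ U := dU (k * m * Q) (by rw [hU]; ring)
  have htry : tryTuple.depth ν ≤ U := by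
    simp only [tryTuple, Cmd.depth, Term.depth, Term.and, Term.imp, Term.lt, Term.le, Term.not,
      Term.all, Term.eq, Term.ne, fitsT, weightT, crossT, rankT, priceT, tupleT, tableT,
      e1, e2, e5, max_self, mul_one, k1, k2, Qk, Qk', max_le_iff]
    have h₁ : k * (Q * k) ≤ U := dU m (by rw [hU]; ring)
    have h₂ : k * k ≤ U := dU (m * Q) (by rw [hU]; ring)
    have h₃ : k * (m * k) ≤ U := dU Q (by rw [hU]; ring)
    have h₄ : 1 ≤ U := hUpos
    simp only [h₁, h₂, h₃, h₄, hkU, and_self]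
  have h₀ : 1 ≤ V := hVpos
  have hnkmk : n * (k * (m * k)) ≤ V :=
    dV (Q * (t * (k * (m * Q)))) (by rw [hV', hU]; ring)
  have hval : validT.depth ν ≤ V := by
    simp only [validT, countT, Term.depth, Term.and, Term.imp, Term.lt, Term.le, Term.not,
      Term.all, Term.eq, Term.ne, weightT, crossT, rankT, priceT, tableT,
      e0, e1, e2, max_self, mul_one, k1, k2, nk, kk, max_le_iff]
    have h₁ : n * k ≤ V := dV (Q * (m ^ k * U)) (by rw [hV]; ring)
    have h₂ : n * (k * k) ≤ V := dV (Q * (m ^ k * (k * (m * Q)))) (by rw [hV, hU]; ring)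
    have h₃ : m * (n * k) ≤ V := dV (Q * (t * U)) (by rw [hV']; ring)
    simp only [h₀, h₁, h₂, h₃, hnkmk, and_self]
  have hemit : emitSwaps.depth ν ≤ V := by
    simpa only [emitSwaps, Cmd.depth, Term.depth, Term.and, Term.lt, Term.not, Term.all, Term.ne,
      crossT, rankT, tableT, e0, e1, e2, max_self, mul_one, k1, k2] using hnkmk
  have hprep : prepareTables.depth ν ≤ V := by
    simp only [prepareTables, Cmd.depth, Term.depth, e0, e1, e2, max_self, mul_one, k2, m1, mm,
      ← Nat.mul_max_mul_left, max_le_iff]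
    refine ⟨⟨?_, ?_⟩, ?_, ?_, ?_⟩
    · exact dV (Q * (m ^ k * U)) (by rw [hV]; ring)
    · exact dV (k * (Q * (t * (k * (k * Q))))) (by rw [hV', hU]; ring)
    · exact dV (k * (Q * (t * U))) (by rw [hV']; ring)
    · exact dV (n * (k * (Q * (t * (k * (k * Q)))))) (by rw [hV', hU]; ring)
    · exact dV (k * (Q * (t * U))) (by rw [hV']; ring)
  have hmU : U ≤ m ^ k * U := Nat.le_mul_of_pos_left _ (by positivity)
  have hsearch : search.depth ν ≤ m ^ k * U := by
    simp only [search, Cmd.depth, Term.depth, hincr, e2, e7, max_le_iff]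
    exact ⟨hUpos.trans_le hmU, Nat.mul_le_mul_left _ (max_le htry hkU)⟩
  have hpos : 1 ≤ Q * (m ^ k * U) := Nat.mul_pos hQ1 (hUpos.trans_le hmU)
  have hpool : fillPool.depth ν ≤ Q * (m ^ k * U) := by
    simp only [fillPool, appendPool, Cmd.depth, Term.depth, Term.le, Term.lt, Term.not, e2, e4,
      max_self, mul_one, k1, k2]
    exact max_le hpos (Nat.mul_le_mul_left _ (max_le hsearch (hkU.trans hmU)))
  have hfill : fillTable.depth ν ≤ V := by
    simp only [fillTable, chooseEntry, placeT, Cmd.depth, Term.depth, Term.and, Term.eq, Term.lt,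
      e0, e2, max_self]
    refine Nat.mul_le_mul_left _ (Nat.mul_le_mul_left _ ?_)
    simp only [max_le_iff, hpool, hpos, and_self]
  have htable : tryTable.depth ν ≤ V := by
    simp only [tryTable, Cmd.depth, Term.depth, Term.and, Term.eq, max_le_iff, hfill, hval,
      hemit, h₀, and_self]
  have hall : tryAll.depth ν ≤ 2 ^ n * ((Q * k) ^ (n * k) * V) := by
    simp only [tryAll, Cmd.depth, hincr, e0, e3, e6, e8]
    refine Nat.mul_le_mul_left _ (max_le (Nat.mul_le_mul_left _ (max_le htable ?_)) ?_)
    · exact dV (Q * (m ^ k * U)) (by rw [hV]; ring)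
    · exact (dV (k * (Q * (m ^ k * U))) (by rw [hV])).trans (Nat.le_mul_of_pos_left _ hN)
  have hVle : V ≤ 2 ^ n * ((Q * k) ^ (n * k) * V) :=
    (Nat.le_mul_of_pos_left _ hN).trans (Nat.le_mul_of_pos_left _ hB)
  simp only [mainCmd, Cmd.depth, Term.depth, max_le_iff]
  exact ⟨hprep.trans hVle, hall, h₀.trans hVle, h₀.trans hVle, h₀.trans hVle⟩

theorem iterations_pos (I : SwapBribery) : 0 < iterations I := by
  have hn := I.n_pos
  have hk := I.k_pos
  have hm : 1 ≤ I.m := hk.trans I.k_le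
  rw [iterations]
  positivity

theorem prepares_parameters (I : SwapBribery) :
    ∃ ν, Prepares I.encode (iterations I) parameters (fun _ => 0) ν ∧ Params I ν := by
  obtain ⟨x0, x1, x2, x3, x4⟩ := encode_head (I := I)
  have hn := I.n_pos
  have hk := I.k_pos
  have hm : 1 ≤ I.m := hk.trans I.k_le
  obtain ⟨t, ht⟩ : ∃ t, I.m ^ I.k = I.m * t :=
    ⟨I.m ^ (I.k - 1), by rw [← pow_succ', Nat.sub_add_cancel hk]⟩
  have hQ : I.n * I.k - I.k + 1 = (I.n - 1) * I.k + 1 := by rw [Nat.sub_mul, Nat.one_mul]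
  obtain ⟨Q, hQ'⟩ : ∃ Q, Q = (I.n - 1) * I.k + 1 := ⟨_, rfl⟩
  have hQ1 : 1 ≤ Q := by omega
  obtain ⟨r, hr⟩ : ∃ r, (Q * I.k) ^ (I.n * I.k) = (Q * I.k) * r := by
    refine ⟨(Q * I.k) ^ (I.n * I.k - 1), ?_⟩
    rw [← pow_succ', Nat.sub_add_cancel (Nat.mul_pos hn hk)]
  have b0 : 1 ≤ iterations I := iterations_pos I
  have e : iterations I = 2 ^ I.n * (Q * I.k * r * (I.n * (I.k * (Q * (I.m * t *
      (I.k * (I.k * (I.m * Q)))))))) := by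
    rw [iterations, ← hQ', hr, ht]
  generalize iterations I = N at *
  generalize 2 ^ I.n = B at e
  have hN : ∀ {a : ℕ} (b : ℕ), a * b = N → a ≤ N := fun b h => Nat.le_of_dvd b0 ⟨b, h.symm⟩
  have b1 : I.n ≤ N := hN (B * (Q * I.k * r * (I.k * (Q * (I.m * t * (I.k * (I.k * (I.m * Q))))))))
    (by rw [e]; ring)
  have b2 : Q ≤ N := hN (B * (Q * I.k * r * (I.n * (I.k * (I.m * t * (I.k * (I.k * (I.m * Q))))))))
    (by rw [e]; ring)
  have b3 : I.k * I.m ≤ N := hN (B * (Q * I.k * r * (I.n * (Q * (t * (I.k * (I.k * (I.m * Q))))))))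
    (by rw [e]; ring)
  have b4 : I.n * I.k * (Q * I.k) ≤ N :=
    hN (B * (r * (Q * (I.m * t * (I.k * (I.k * (I.m * Q))))))) (by rw [e]; ring)
  refine exists_prepares_cons I.n (fun s => by simpa using x0) b0 ?_
  refine exists_prepares_cons I.m (fun s => by simpa using x1) b0 ?_
  refine exists_prepares_cons I.k (fun s => by simpa using x2) b0 ?_
  refine exists_prepares_cons I.preferred (fun s => by simpa using x3) b0 ?_
  refine exists_prepares_cons I.budget (fun s => by simpa using x4) b0 ?_
  refine exists_prepares_cons (I.n * I.k) (fun s => by simp)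
    (by simpa [Cmd.depth, Term.depth, Function.update_apply, b0] using b1) ?_
  refine exists_prepares_cons Q (fun s => by simp [hQ, hQ']) b0 ?_
  refine exists_prepares_cons (Q * I.k) (fun s => by simp)
    (by simpa [Cmd.depth, Term.depth, Function.update_apply, b0] using b2) ?_
  refine exists_prepares_cons (2 ^ I.n) (fun s => by rw [exec_pow_two]; simp)
    (by simpa [Cmd.depth, Term.depth, Function.update_apply, b0] using b1) ?_
  refine exists_prepares_cons (I.m ^ I.k) (fun s => by rw [exec_pow]; simp)
    (by simpa [Cmd.depth, Term.depth, Function.update_apply, b0, max_eq_right hm,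
      max_eq_right hk] using b3) ?_
  refine exists_prepares_cons ((Q * I.k) ^ (I.n * I.k))
    (fun s => by rw [exec_pow]; simp)
    (by simpa [Cmd.depth, Term.depth, Function.update_apply, b0,
      max_eq_right (show 1 ≤ Q * I.k from Nat.mul_pos hQ1 hk),
      max_eq_right (show 1 ≤ I.n * I.k from Nat.mul_pos hn hk)] using b4) ?_
  refine exists_prepares_cons (5 + I.n * I.m) (fun s => by simp)
    (by simpa [Cmd.depth, Term.depth, Function.update_apply, b0] using b1) ?_
  refine exists_prepares_cons 2 (fun s => by simp) b0 ?_
  refine ⟨_, .nil, ?_⟩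
  constructor <;> simp [hQ']

/-- Commands that leave the arrays, the output and the variable `z` alone do so in a script. -/
theorem prepare_preserves {x : List ℕ} {z : ℕ} {l : List (Cmd × ℕ × ℕ)}
    (h : ∀ a ∈ l, z ∉ a.1.vars ∧ a.1.arrs = [] ∧ a.1.silent = true) :
    ∀ (ν : ℕ → ℕ) (s : State), (prepare x l (ν, s)).2.var z = s.var z ∧
      (prepare x l (ν, s)).2.arr = s.arr ∧ (prepare x l (ν, s)).2.out = s.out := by
  induction l with
  | nil => exact fun ν s => ⟨rfl, rfl, rfl⟩
  | cons a l ih =>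
    obtain ⟨c, p, y⟩ := a
    intro ν s
    obtain ⟨h₁, h₂, h₃⟩ := h _ List.mem_cons_self
    have := ih (fun b hb => h b (List.mem_cons_of_mem _ hb))
      (Function.update ν p ((c.exec x ν s).var y)) (c.exec x ν s)
    rw [Cmd.exec_var c h₁, Cmd.exec_out c h₃,
      show (c.exec x ν s).arr = s.arr from funext fun j => Cmd.exec_arr c (by simp [h₂]) s] at this
    exact this

/-! ### Absorbing the lower-order factors -/

theorem two_pow_mul_cube_le {n : ℕ} (hn : 1 ≤ n) : 2 ^ n * n ^ 3 ≤ 8 * n ^ n := by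
  rcases Nat.lt_or_ge n 3 with h | h
  · interval_cases n <;> norm_num
  · obtain ⟨d, rfl⟩ := Nat.exists_eq_add_of_le' h
    rw [pow_add 2, pow_add (d + 3) d]
    have : 2 ^ d ≤ (d + 3) ^ d := Nat.pow_le_pow_left (by omega) d
    calc 2 ^ d * 2 ^ 3 * (d + 3) ^ 3 = 8 * (2 ^ d * (d + 3) ^ 3) := by ring
      _ ≤ _ := by gcongr

theorem succ_pow_five_le (j : ℕ) : (j + 1) ^ 5 ≤ 1024 * 4 ^ j := by
  rcases Nat.lt_or_ge j 3 with h | h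
  · interval_cases j <;> norm_num
  · obtain ⟨i, rfl⟩ := Nat.exists_eq_add_of_le' h
    clear h
    induction i with
    | zero => norm_num
    | succ i ih =>
      -- The ratio is at most `(5 / 4) ^ 5 < 4`; the induction starts at 3 because `(4 / 3) ^ 5 >
      -- 4`.
      have h : (i + 1 + 3 + 1) ^ 5 ≤ 4 * (i + 3 + 1) ^ 5 := by
        ring_nf
        omega
      calc (i + 1 + 3 + 1) ^ 5 ≤ 4 * (i + 3 + 1) ^ 5 := h
        _ ≤ 4 * (1024 * 4 ^ (i + 3)) := Nat.mul_le_mul_left _ ih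
        _ = 1024 * 4 ^ (i + 1 + 3) := by ring

theorem pow_three_le {k : ℕ} (hk : 1 ≤ k) : k ^ 3 ≤ 4 * k ^ k := by
  rcases Nat.lt_or_ge k 3 with h | h
  · interval_cases k <;> norm_num
  · exact (Nat.pow_le_pow_right hk h).trans (Nat.le_mul_of_pos_left _ (by norm_num))

theorem two_pow_mul_le {n k : ℕ} (hn : 2 ≤ n) (hk : 1 ≤ k) :
    2 ^ n * (n ^ 3 * k ^ 5) ≤ 2 ^ 13 * n ^ (n * k) := by
  obtain ⟨j, rfl⟩ := Nat.exists_eq_add_of_le' hk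
  -- This needs `n ≥ 2`, for then `4 ≤ n ^ 2 ≤ n ^ n`.
  have h₁ : 4 ^ j ≤ n ^ (n * j) := by
    rw [pow_mul]
    exact Nat.pow_le_pow_left ((Nat.pow_le_pow_left hn 2).trans
      (Nat.pow_le_pow_right (by omega) hn)) j
  calc 2 ^ n * (n ^ 3 * (j + 1) ^ 5) = (2 ^ n * n ^ 3) * (j + 1) ^ 5 := by ring
    _ ≤ (8 * n ^ n) * (1024 * n ^ (n * j)) :=
      Nat.mul_le_mul (two_pow_mul_cube_le (by omega))
        ((succ_pow_five_le j).trans (Nat.mul_le_mul_left _ h₁))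
    _ = 2 ^ 13 * n ^ (n * (j + 1)) := by rw [Nat.mul_succ, pow_add]; ring

/-- For `n ≥ 2`, `Q ≤ n * k` bounds the number of choice vectors by `(n * k * k) ^ (n * k)`, a
factor `n ^ (n * k)` below the target, and this slack takes up the rest. For `n = 1` there is no
such slack, but `Q = 1`, and a spare factor `k ^ k` takes up `k ^ 3`. -/
theorem two_pow_mul_pow_le {n k : ℕ} (hn : 1 ≤ n) (hk : 1 ≤ k) :
    2 ^ n * ((((n - 1) * k + 1) * k) ^ (n * k) * (n * (k ^ 3 * ((n - 1) * k + 1) ^ 2))) ≤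
      2 ^ 13 * (n * k) ^ (2 * (n * k)) := by
  rcases Nat.lt_or_ge n 2 with h | h
  · obtain rfl : n = 1 := by omega
    have h₁ := pow_three_le hk
    calc 2 ^ 1 * ((((1 - 1) * k + 1) * k) ^ (1 * k) * (1 * (k ^ 3 * ((1 - 1) * k + 1) ^ 2)))
        = 2 * (k ^ k * k ^ 3) := by simp
      _ ≤ 2 * (k ^ k * (4 * k ^ k)) := by gcongr
      _ = 8 * (1 * k) ^ (2 * (1 * k)) := by rw [Nat.one_mul, two_mul k, pow_add]; ring
      _ ≤ _ := Nat.mul_le_mul_right _ (by norm_num)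
  · have hQ : (n - 1) * k + 1 ≤ n * k := by
      obtain ⟨d, rfl⟩ := Nat.exists_eq_add_of_le' hn
      rw [Nat.add_sub_cancel, Nat.succ_mul]
      omega
    calc 2 ^ n * ((((n - 1) * k + 1) * k) ^ (n * k) * (n * (k ^ 3 * ((n - 1) * k + 1) ^ 2)))
        ≤ 2 ^ n * ((n * k * k) ^ (n * k) * (n * (k ^ 3 * (n * k) ^ 2))) := by gcongr
      _ = (2 ^ n * (n ^ 3 * k ^ 5)) * (n * k * k) ^ (n * k) := by ring
      _ ≤ (2 ^ 13 * n ^ (n * k)) * (n * k * k) ^ (n * k) :=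
        Nat.mul_le_mul_right _ (two_pow_mul_le h hk)
      _ = 2 ^ 13 * (n * k) ^ (2 * (n * k)) := by
        rw [two_mul (n * k), pow_add, mul_pow (n * k) k, mul_pow n k]; ring

theorem iterations_le (I : SwapBribery) :
    iterations I ≤ 2 ^ 13 * ((I.n * I.k) ^ (2 * (I.n * I.k)) * I.m ^ (I.k + 1)) := by
  calc iterations I = 2 ^ I.n * ((((I.n - 1) * I.k + 1) * I.k) ^ (I.n * I.k) *
        (I.n * (I.k ^ 3 * ((I.n - 1) * I.k + 1) ^ 2))) * I.m ^ (I.k + 1) := by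
        rw [iterations, pow_succ I.m I.k]
        generalize (((I.n - 1) * I.k + 1) * I.k) ^ (I.n * I.k) = N
        generalize (I.n - 1) * I.k + 1 = Q
        ring
    _ ≤ 2 ^ 13 * (I.n * I.k) ^ (2 * (I.n * I.k)) * I.m ^ (I.k + 1) :=
        Nat.mul_le_mul_right _ (two_pow_mul_pow_le I.n_pos I.k_pos)
    _ = _ := mul_assoc _ _ _

/-- The algorithm. -/
def solver : Prog := compileScript parameters mainCmd

/-- The constant in the bound on the running time of the algorithm. -/
def solverCoeff : ℕ := (prepareCoeff parameters + mainCmd.coeff) * 2 ^ 13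

theorem solver_halts (I : SwapBribery) :
    ∃ t ≤ solverCoeff * ((I.n * I.k) ^ (2 * (I.n * I.k)) * I.m ^ (I.k + 1)),
      ∀ ω, solver.HaltedAt I.encode ω t ∧
        ∀ s, solver.HaltedAt I.encode ω s → I.CorrectOutput (solver.run I.encode ω s).out := by
  obtain ⟨ν, hν, hp⟩ := prepares_parameters I
  obtain ⟨h₁, h₂⟩ := hν State.init
  obtain ⟨t, ht, h⟩ := compileScript_halts I.encode parameters mainCmd
  obtain ⟨hv, ha, ho⟩ := prepare_preserves (x := I.encode) (z := vDone) (l := parameters)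
    (by simp [parameters, Cmd.vars, Cmd.arrs, Cmd.silent]) (fun _ => 0) State.init
  rw [h₁] at ht h
  refine ⟨t, ht.trans ?_, fun ω => ⟨(h ω).1, fun s hs => ?_⟩⟩
  · have hb : ∀ a b : ℕ, a * iterations I + b * iterations I ≤
        (a + b) * 2 ^ 13 * ((I.n * I.k) ^ (2 * (I.n * I.k)) * I.m ^ (I.k + 1)) := fun a b => by
      rw [← Nat.add_mul, mul_assoc]
      exact Nat.mul_le_mul_left _ (iterations_le I)
    exact (Nat.add_le_add h₂ (mainCmd.cost_le.trans
      (Nat.mul_le_mul_left _ (depth_mainCmd hp)))).trans (hb _ _)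
  · rw [solver, (h ω).2 s hs]
    exact correctOutput_mainCmd hp (fun j q => by rw [ha]; rfl) hv ho

end Bounded

/-! ### From step counts to the stated bounds -/

namespace Prog

theorem HaltedAt.mono {P : Prog} {x : List ℕ} {ω : ℕ → Bool} {s t : ℕ} (h : P.HaltedAt x ω s)
    (hst : s ≤ t) : P.HaltedAt x ω t := by
  induction t, hst using Nat.le_induction with
  | base => exact h
  | succ t _ ih =>
    rw [HaltedAt] at ih ⊢
    rw [run, step, ih]
    exact ih

theorem time_le {P : Prog} {x : List ℕ} {ω : ℕ → Bool} {t : ℕ} (h : P.HaltedAt x ω t) :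
    P.time x ω ≤ t :=
  iInf₂_le t h

theorem expectedTime_le {P : Prog} {x : List ℕ} {t : ℕ} (h : ∀ ω, P.HaltedAt x ω t) :
    P.expectedTime x ≤ t := by
  have : IsProbabilityMeasure coinLaw := by unfold coinLaw; infer_instance
  calc P.expectedTime x ≤ ∫⁻ _, (t : ENNReal) ∂coinLaw :=
        lintegral_mono fun ω => by
          have := ENat.toENNReal_le.2 (time_le (h ω))
          simpa using this
    _ = t := by simp

end Prog

namespace Bounded

theorem deterministic_solver : solver.Deterministic := deterministic_compileScript _ _

/-- `log n + log k` is `log (n * k)`, so the exponential is a power of `n * k`. -/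
theorem two_rpow_logb {n k : ℕ} (hn : 1 ≤ n) (hk : 1 ≤ k) :
    (2 : ℝ) ^ (2 * ((Real.logb 2 n + Real.logb 2 k) * ((n : ℝ) * k))) =
      (((n * k) ^ (2 * (n * k)) : ℕ) : ℝ) := by
  have hn' : (0 : ℝ) < n := by exact_mod_cast hn
  have hk' : (0 : ℝ) < k := by exact_mod_cast hk
  rw [← Real.logb_mul hn'.ne' hk'.ne', mul_left_comm, Real.rpow_mul zero_le_two,
    Real.rpow_logb two_pos (by norm_num) (mul_pos hn' hk'), Nat.cast_pow, ← Real.rpow_natCast]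
  push_cast
  rfl

theorem computable_mul_pow (c k : ℕ) :
    Computable fun n : ℕ => c * (n * k) ^ (2 * (n * k)) := by
  have h : Primrec fun n : ℕ => n * k := Primrec.nat_mul.comp .id (.const k)
  have hp : Primrec₂ ((· ^ ·) : ℕ → ℕ → ℕ) := Primrec₂.unpaired'.1 Nat.Primrec.pow
  exact (Primrec.nat_mul.comp (.const c)
    (hp.comp h (Primrec.nat_mul.comp (.const 2) h))).to_comp

theorem length_le_bitLength (x : List ℕ) : x.length ≤ bitLength x := by
  induction x with
  | nil => exact Nat.zero_le _
  | cons a x ih =>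
    have : bitLength (a :: x) = (Nat.size a + 1) + bitLength x := by simp [bitLength]
    rw [this, List.length_cons]
    omega

/-- There is at least one vote, and it lists all `m` candidates. -/
theorem le_bitLength_encode (I : SwapBribery) : I.m ≤ bitLength I.encode := by
  refine le_trans ?_ (length_le_bitLength _)
  have : I.m ≤ I.n * I.m := Nat.le_mul_of_pos_left _ I.n_pos
  rw [SwapBribery.encode, List.length_append, List.length_append,
    length_flatMap_const (L := I.m) (by simp), List.length_finRange]
  omega

end Bounded

theorem theorem5 :
    -- a zero-error randomized algorithm
    (∃ P : Prog, ∃ C : ℝ, ∀ I : SwapBribery,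
      P.AlwaysCorrect I.encode I.CorrectOutput ∧
      P.expectedTime I.encode ≤ ENNReal.ofReal
        ((2 : ℝ) ^ (2 * (Real.logb 2 (I.n : ℝ) + Real.logb 2 (I.k : ℝ)) * ((I.n : ℝ) * (I.k : ℝ))) *
          (C * (I.m : ℝ) ^ (I.k + 1)))) ∧
    -- a deterministic algorithm
    (∃ P : Prog, P.Deterministic ∧ ∃ c C : ℝ, ∀ I : SwapBribery,
      ∃ t : ℕ, P.SolvesIn I.encode I.CorrectOutput t ∧
        (2 ≤ I.m → (t : ℝ) ≤
          (2 : ℝ) ^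
              (c * ((Real.logb 2 (I.n : ℝ) + Real.logb 2 (I.k : ℝ)) * ((I.n : ℝ) * (I.k : ℝ)))) *
            (C * ((I.m : ℝ) ^ (I.k + 1) * Real.logb 2 (I.m : ℝ))))) ∧
    -- fixed-parameter tractability in the number of votes, for constant `k`
    (∀ k : ℕ, 1 ≤ k →
      FixedParameterTractable (ι := {I : SwapBribery // I.k = k})
        (fun I => I.1.encode) (fun I => I.1.CorrectOutput) (fun I => I.1.n)) := by
  -- The same deterministic program serves for all three parts, with `c = 2` in the second one and
  -- the exponent `k + 1` in the third one.
  refine ⟨⟨Bounded.solver, Bounded.solverCoeff, fun I => ?_⟩,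
    ⟨Bounded.solver, Bounded.deterministic_solver, 2, Bounded.solverCoeff, fun I => ?_⟩, fun k _ =>
    ⟨Bounded.solver, Bounded.deterministic_solver, fun n => Bounded.solverCoeff * (n * k) ^ (2 * (n * k)),
      Bounded.computable_mul_pow _ _, k + 1, fun I => ?_⟩⟩
  · obtain ⟨t, ht, h⟩ := Bounded.solver_halts I
    refine ⟨fun ω s hs => (h ω).2 s hs, (Prog.expectedTime_le fun ω => (h ω).1).trans ?_⟩
    rw [mul_assoc 2, Bounded.two_rpow_logb I.n_pos I.k_pos, ← ENNReal.ofReal_natCast]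
    refine ENNReal.ofReal_le_ofReal ((Nat.cast_le.2 ht).trans_eq ?_)
    push_cast
    ring
  · obtain ⟨t, ht, h⟩ := Bounded.solver_halts I
    refine ⟨t, ⟨(h _).1, (h _).2 t (h _).1⟩, fun hm => ?_⟩
    rw [Bounded.two_rpow_logb I.n_pos I.k_pos]
    -- For `m ≥ 2` the additional logarithmic factor only weakens the bound.
    have hlog : 1 ≤ Real.logb 2 (I.m : ℝ) := by
      rw [Real.le_logb_iff_rpow_le one_lt_two (by positivity), Real.rpow_one]
      exact_mod_cast hm
    calc (t : ℝ) ≤ ((Bounded.solverCoeff * ((I.n * I.k) ^ (2 * (I.n * I.k)) * I.m ^ (I.k + 1)) : ℕ) : ℝ) :=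
          Nat.cast_le.2 ht
      _ = (((I.n * I.k) ^ (2 * (I.n * I.k)) : ℕ) : ℝ) *
            (Bounded.solverCoeff * ((I.m : ℝ) ^ (I.k + 1) * 1)) := by push_cast; ring
      _ ≤ _ := by gcongr
  · obtain ⟨I, rfl⟩ := I
    obtain ⟨t, ht, h⟩ := Bounded.solver_halts I
    have ht' : t ≤ Bounded.solverCoeff * (I.n * I.k) ^ (2 * (I.n * I.k)) *
        bitLength I.encode ^ (I.k + 1) := by
      refine ht.trans ?_
      rw [mul_assoc]
      exact Nat.mul_le_mul_left _ (Nat.mul_le_mul_left _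
        (Nat.pow_le_pow_left (Bounded.le_bitLength_encode I) _))
    -- `SolvesIn` refers to one given number of steps, so halting is carried on from `t` to the
    -- bound.
    have hs := (h fun _ => false).1.mono ht'
    exact ⟨hs, (h _).2 _ hs⟩
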